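/- Let $\mathbb{F}$ be a field, let $r\ge 1$, and let $V=\mathbb{F}^2\otimes\mathbb{F}^3\otimes\mathbb{F}^r$. A fundamental tensor of $V$ is a tensor $v_1\otimes v_2\otimes v_3$ with $v_1\in\mathbb{F}^2$, $v_2\in\mathbb{F}^3$, $v_3\in\mathbb{F}^r$ all nonzero. Let $G\le \mathrm{GL}(V)$ be the setwise stabiliser of the set of fundamental tensors of $V$, and let $H\le G$ be the subgroup of all maps $g_1\otimes g_2\otimes g_3$ with $g_1\in\mathrm{GL}(\mathbb{F}^2)$, $g_2\in\mathrm{GL}(\mathbb{F}^3)$, $g_3\in\mathrm{GL}(\mathbb{F}^r)$. Orbits are orbits on all of $V$ (the zero tensor included). Theorem (orbit counts for algebraically closed fields and $\mathbb{R}$). (a) If $\mathbb{F}$ is algebraically closed, then the number of $H$-orbits on $V$ is $3, 9, 18, 24, 26$ for $r=1,2,3,4,5$ respectively, and $27$ for every $r\ge 6$; the number of $G$-orbits on $V$ is $3, 8, 15$ for $r=1,2,3$ respectively, and for every $r\ge 4$ it is equal to the number of $H$-orbits. (b) If $\mathbb{F}=\mathbb{R}$, then the number of $H$-orbits on $V$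 is $3, 10, 20, 27, 29$ for $r=1,2,3,4,5$ respectively, and $30$ for every $r\ge 6$; the number of $G$-orbits on $V$ is $3, 9, 17$ for $r=1,2,3$ respectively, and for every $r\ge 4$ it is equal to the number of $H$-orbits. -/

import Mathlib

open scoped TensorProduct Pointwise

noncomputable section

/-- The fundamental tensors `v₁ ⊗ v₂ ⊗ v₃` (all `vᵢ` nonzero) of `V₁ ⊗ V₂ ⊗ V₃`. -/
def fundamentalTensors (F V₁ V₂ V₃ : Type*) [Field F]
    [AddCommGroup V₁] [Module F V₁] [AddCommGroup V₂] [Module F V₂]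
    [AddCommGroup V₃] [Module F V₃] : Set (V₁ ⊗[F] V₂ ⊗[F] V₃) :=
  {t | ∃ v₁ : V₁, ∃ v₂ : V₂, ∃ v₃ : V₃,
    v₁ ≠ 0 ∧ v₂ ≠ 0 ∧ v₃ ≠ 0 ∧ t = v₁ ⊗ₜ[F] v₂ ⊗ₜ[F] v₃}

/-- The group `G`: the setwise stabiliser in `GL(V₁ ⊗ V₂ ⊗ V₃)` of the set of fundamental
tensors. -/
def groupG (F V₁ V₂ V₃ : Type*) [Field F]
    [AddCommGroup V₁] [Module F V₁] [AddCommGroup V₂] [Module F V₂]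
    [AddCommGroup V₃] [Module F V₃] :
    Subgroup ((V₁ ⊗[F] V₂ ⊗[F] V₃) ≃ₗ[F] (V₁ ⊗[F] V₂ ⊗[F] V₃)) :=
  MulAction.stabilizer _ (fundamentalTensors F V₁ V₂ V₃)

/-- The action of `GL(V₁) × GL(V₂) × GL(V₃)` on `V₁ ⊗ V₂ ⊗ V₃` by
`(g₁, g₂, g₃) ↦ g₁ ⊗ g₂ ⊗ g₃`. -/
def tensorRep (F V₁ V₂ V₃ : Type*) [Field F]
    [AddCommGroup V₁] [Module F V₁] [AddCommGroup V₂] [Module F V₂]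
    [AddCommGroup V₃] [Module F V₃] :
    (V₁ ≃ₗ[F] V₁) × (V₂ ≃ₗ[F] V₂) × (V₃ ≃ₗ[F] V₃) →*
      ((V₁ ⊗[F] V₂ ⊗[F] V₃) ≃ₗ[F] (V₁ ⊗[F] V₂ ⊗[F] V₃)) where
  toFun g := TensorProduct.congr (TensorProduct.congr g.1 g.2.1) g.2.2
  map_one' := by
    apply LinearEquiv.toLinearMap_injective
    ext x y z
    rfl
  map_mul' g h := by
    apply LinearEquiv.toLinearMap_injective
    ext x y z
    rfl

/-- The group `H`: all `g₁ ⊗ g₂ ⊗ g₃` with `gᵢ ∈ GL(Vᵢ)`. -/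
def groupH (F V₁ V₂ V₃ : Type*) [Field F]
    [AddCommGroup V₁] [Module F V₁] [AddCommGroup V₂] [Module F V₂]
    [AddCommGroup V₃] [Module F V₃] :
    Subgroup ((V₁ ⊗[F] V₂ ⊗[F] V₃) ≃ₗ[F] (V₁ ⊗[F] V₂ ⊗[F] V₃)) :=
  (tensorRep F V₁ V₂ V₃).range

/-- The number of `H`-orbits of tensors in `F² ⊗ F³ ⊗ Fʳ`
(with `Nat.card`, so a nonzero value also says that the number is finite). -/
def numOrbitsH (F : Type*) [Field F] (r : ℕ) : ℕ :=
  Nat.card (MulAction.orbitRel.Quotient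
    (groupH F (Fin 2 → F) (Fin 3 → F) (Fin r → F))
    ((Fin 2 → F) ⊗[F] (Fin 3 → F) ⊗[F] (Fin r → F)))

/-- The number of `G`-orbits of tensors in `F² ⊗ F³ ⊗ Fʳ`. -/
def numOrbitsG (F : Type*) [Field F] (r : ℕ) : ℕ :=
  Nat.card (MulAction.orbitRel.Quotient
    (groupG F (Fin 2 → F) (Fin 3 → F) (Fin r → F))
    ((Fin 2 → F) ⊗[F] (Fin 3 → F) ⊗[F] (Fin r → F)))

end

set_option linter.unusedSectionVars false
set_option linter.unusedDecidableInType false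
set_option linter.unusedFintypeInType false

/-! Contracting a tensor with the vectors of the third factor gives a space of 2 × 3 matrices of
dimension at most r. The group acting on the third factor only reparametrises this space, so
H-orbits correspond to subspaces of dimension at most r up to GL₂ × GL₃ (`hRel_iff_sliceSpan`,
`numClasses_eq`). The trace pairing exchanges classes of dimension d with classes of dimension 6 - d
(`orthogonalEquivOfAdd`), so dimensions up to 3 suffice, and all of these already occur for r = 3.
There a tensor is a pencil of 3 × 3 matrices, and a Kronecker-type classification applies.

Over a field where cubics have roots, every pencil has a singular member. Bringing that member to
rank normal form and reducing the rest by row and column operations leads to twenty normal forms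
(`hasNormalForm`); two of them, built on x² + 1, occur only when -1 is not a square. Ranks, members
of small rank and the roots of the determinant on the pencil distinguish the forms
(`eq_of_hRel_pencilRep`). The counts in dimensions 0, 1, 2, 3 are 1, 2, 6, 9 when -1 is a square and
1, 2, 7, 10 otherwise; partial sums of the palindromic sequence give the H-orbit numbers.

For G, the linear spaces all of whose nonzero members are pure sit in the "lines" obtained by
letting one tensor factor vary. Over an infinite field, and with all factors of dimension at least
2, a linear bijection preserving pure tensors permutes these lines (`exists_isLine_map`). Comparing
dimensions, it either keeps the three kinds of lines or exchanges two kinds of equal dimension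
(`preserves_types`); in the first case it is a product of three invertible maps
(`exists_tensAct_of_preserves_types`). Hence G and H have the same orbits for r ≥ 4. For r = 3 there
is also transposition of the last two factors, which merges three pairs of classes; for r = 2 there
is exchange of the first and last factors, which merges one pair. For r = 1 the three H-orbits are
told apart directly by being zero, pure or neither. -/

namespace TensorOrbits

/-- Tensors of `F^I ⊗ F^J ⊗ F^K` in coordinates, as families of matrices. -/
abbrev Tens (I J K F : Type*) := I → Matrix J K F

/-! ### Coordinates for tensors and for the two orbit relations -/

section Coordinates

variable {F I J K : Type*} [Field F]

/-- The coordinates of `a ⊗ b ⊗ c`. -/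
def pureTens (a : I → F) (b : J → F) (c : K → F) : Tens I J K F :=
  fun i j k => a i * b j * c k

/-- The set of coordinate arrays of fundamental tensors. -/
def pureSet (I J K F : Type*) [Field F] : Set (Tens I J K F) :=
  {t | ∃ a b c, a ≠ 0 ∧ b ≠ 0 ∧ c ≠ 0 ∧ t = pureTens a b c}

variable [Fintype I] [Fintype J] [Fintype K] [DecidableEq I] [DecidableEq J] [DecidableEq K]

/-- The action of three matrices on a coordinate array. -/
def tensAct (M : Matrix I I F) (P : Matrix J J F) (Q : Matrix K K F) :
    Tens I J K F →ₗ[F] Tens I J K F where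
  toFun t i := ∑ i', M i i' • (P * t i' * Q.transpose)
  map_add' s t := by
    funext i
    simp [Matrix.mul_add, Matrix.add_mul, Finset.sum_add_distrib]
  map_smul' c t := by
    funext i
    simp [Finset.smul_sum, smul_comm c]

theorem tensAct_apply (M : Matrix I I F) (P : Matrix J J F) (Q : Matrix K K F)
    (t : Tens I J K F) (i : I) :
    tensAct M P Q t i = ∑ i', M i i' • (P * t i' * Q.transpose) := rfl

theorem tensAct_tensAct (M M' : Matrix I I F) (P P' : Matrix J J F) (Q Q' : Matrix K K F)
    (t : Tens I J K F) :
    tensAct M P Q (tensAct M' P' Q' t) = tensAct (M * M') (P * P') (Q * Q') t := by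
  funext i
  simp only [tensAct_apply, Matrix.mul_apply, Finset.sum_smul, Matrix.transpose_mul,
    Matrix.mul_sum, Matrix.sum_mul, Finset.smul_sum]
  rw [Finset.sum_comm]
  refine Finset.sum_congr rfl fun x _ => Finset.sum_congr rfl fun y _ => ?_
  simp [Matrix.mul_assoc, smul_smul]

theorem tensAct_one (t : Tens I J K F) : tensAct 1 1 1 t = t := by
  funext i
  simp [tensAct_apply, Matrix.one_apply]

theorem pureTens_eq (a : I → F) (b : J → F) (c : K → F) (i : I) :
    pureTens a b c i = a i • Matrix.vecMulVec b c := by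
  ext j k
  simp [pureTens, Matrix.vecMulVec_apply, mul_assoc]

theorem tensAct_pureTens (M : Matrix I I F) (P : Matrix J J F) (Q : Matrix K K F)
    (a : I → F) (b : J → F) (c : K → F) :
    tensAct M P Q (pureTens a b c) = pureTens (M.mulVec a) (P.mulVec b) (Q.mulVec c) := by
  funext i
  simp only [tensAct_apply, pureTens_eq, Matrix.mulVec, dotProduct, Finset.sum_smul]
  refine Finset.sum_congr rfl fun x _ => ?_
  rw [Matrix.mul_smul, Matrix.smul_mul, smul_smul, Matrix.mul_vecMulVec, Matrix.vecMulVec_mul,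
    Matrix.vecMul_transpose]

/-- Equivalence of coordinate arrays under `GL × GL × GL`. -/
def HRel (s t : Tens I J K F) : Prop :=
  ∃ (M : GL I F) (P : GL J F) (Q : GL K F), tensAct M.1 P.1 Q.1 s = t

theorem HRel.refl (t : Tens I J K F) : HRel t t := ⟨1, 1, 1, tensAct_one t⟩

theorem HRel.symm {s t : Tens I J K F} : HRel s t → HRel t s := by
  rintro ⟨M, P, Q, rfl⟩
  refine ⟨M⁻¹, P⁻¹, Q⁻¹, ?_⟩
  rw [tensAct_tensAct]
  simp only [← Units.val_mul, inv_mul_cancel, Units.val_one, tensAct_one]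

theorem HRel.trans {s t u : Tens I J K F} : HRel s t → HRel t u → HRel s u := by
  rintro ⟨M, P, Q, rfl⟩ ⟨M', P', Q', rfl⟩
  exact ⟨M' * M, P' * P, Q' * Q, by rw [tensAct_tensAct]; rfl⟩

/-- The setoid of `HRel`. -/
def hSetoid (I J K F : Type*) [Field F] [Fintype I] [Fintype J] [Fintype K]
    [DecidableEq I] [DecidableEq J] [DecidableEq K] : Setoid (Tens I J K F) :=
  ⟨HRel, HRel.refl, HRel.symm, HRel.trans⟩

/-- Equivalence of coordinate arrays under linear maps preserving the fundamental tensors. -/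
def GRel (s t : Tens I J K F) : Prop :=
  ∃ g : Tens I J K F ≃ₗ[F] Tens I J K F, g '' pureSet I J K F = pureSet I J K F ∧ g s = t

/-- The setoid of `GRel`. -/
def gSetoid (I J K F : Type*) [Field F] : Setoid (Tens I J K F) where
  r := GRel
  iseqv := by
    refine ⟨fun t => ⟨LinearEquiv.refl F _, Set.image_id _, rfl⟩, ?_, ?_⟩
    · rintro s t ⟨g, hg, rfl⟩
      refine ⟨g.symm, ?_, by simp⟩
      conv_lhs => rw [← hg]
      rw [← Set.image_comp]
      simp
    · rintro s t u ⟨g, hg, rfl⟩ ⟨g', hg', rfl⟩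
      refine ⟨g.trans g', ?_, by simp⟩
      have : ⇑(g.trans g') = g' ∘ g := rfl
      rw [this, Set.image_comp, hg, hg']

variable (F I J K) in
/-- The coordinate isomorphism. -/
noncomputable def coordEquiv : ((I → F) ⊗[F] (J → F) ⊗[F] (K → F)) ≃ₗ[F] Tens I J K F :=
  ((((Pi.basisFun F I).tensorProduct (Pi.basisFun F J)).tensorProduct
    (Pi.basisFun F K)).equivFun.trans (LinearEquiv.curry F F (I × J) K)).trans
    (LinearEquiv.curry F (K → F) I J)

theorem coordEquiv_tmul (a : I → F) (b : J → F) (c : K → F) :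
    coordEquiv F I J K (a ⊗ₜ b ⊗ₜ c) = pureTens a b c := by
  funext i j k
  change (((Pi.basisFun F I).tensorProduct (Pi.basisFun F J)).tensorProduct
    (Pi.basisFun F K)).repr (a ⊗ₜ b ⊗ₜ c) ((i, j), k) = _
  simp only [Module.Basis.tensorProduct_repr_tmul_apply, Pi.basisFun_repr, smul_eq_mul, pureTens]
  ring

theorem coordEquiv_image_fundamentalTensors :
    coordEquiv F I J K '' fundamentalTensors F (I → F) (J → F) (K → F) = pureSet I J K F := by
  ext t
  constructor
  · rintro ⟨_, ⟨a, b, c, ha, hb, hc, rfl⟩, rfl⟩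
    exact ⟨a, b, c, ha, hb, hc, coordEquiv_tmul a b c⟩
  · rintro ⟨a, b, c, ha, hb, hc, rfl⟩
    exact ⟨_, ⟨a, b, c, ha, hb, hc, rfl⟩, coordEquiv_tmul a b c⟩

/-- Invertible matrices as linear automorphisms of `I → F`. -/
noncomputable def glEquiv (F I : Type*) [Field F] [Fintype I] [DecidableEq I] :
    GL I F ≃* ((I → F) ≃ₗ[F] (I → F)) :=
  Matrix.GeneralLinearGroup.toLin.trans (LinearMap.GeneralLinearGroup.generalLinearEquiv F _)

theorem glEquiv_apply (g : GL I F) (v : I → F) : glEquiv F I g v = g.1.mulVec v := rfl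

theorem coordEquiv_tensorRep (M : GL I F) (P : GL J F) (Q : GL K F)
    (v : (I → F) ⊗[F] (J → F) ⊗[F] (K → F)) :
    coordEquiv F I J K (tensorRep F _ _ _ (glEquiv F I M, glEquiv F J P, glEquiv F K Q) v) =
      tensAct M.1 P.1 Q.1 (coordEquiv F I J K v) := by
  have h : (coordEquiv F I J K).toLinearMap ∘ₗ
      (tensorRep F _ _ _ (glEquiv F I M, glEquiv F J P, glEquiv F K Q)).toLinearMap =
      tensAct M.1 P.1 Q.1 ∘ₗ (coordEquiv F I J K).toLinearMap := by
    refine TensorProduct.ext_threefold fun a b c => ?_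
    simp only [LinearMap.comp_apply, LinearEquiv.coe_coe, coordEquiv_tmul, tensAct_pureTens]
    exact coordEquiv_tmul _ _ _
  exact LinearMap.congr_fun h v

theorem orbitRel_groupH_iff (v w : (I → F) ⊗[F] (J → F) ⊗[F] (K → F)) :
    MulAction.orbitRel (groupH F (I → F) (J → F) (K → F)) _ v w ↔
      HRel (coordEquiv F I J K v) (coordEquiv F I J K w) := by
  rw [MulAction.orbitRel_apply]
  constructor
  · rintro ⟨⟨_, ⟨⟨g₁, g₂, g₃⟩, rfl⟩⟩, rfl⟩
    refine HRel.symm ⟨(glEquiv F I).symm g₁, (glEquiv F J).symm g₂, (glEquiv F K).symm g₃, ?_⟩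
    rw [← coordEquiv_tensorRep]
    simp only [MulEquiv.apply_symm_apply]
    rfl
  · intro h
    obtain ⟨M, P, Q, h⟩ := h.symm
    rw [← coordEquiv_tensorRep] at h
    exact ⟨⟨_, ⟨_, rfl⟩⟩, (coordEquiv F I J K).injective h⟩

theorem orbitRel_groupG_iff (v w : (I → F) ⊗[F] (J → F) ⊗[F] (K → F)) :
    MulAction.orbitRel (groupG F (I → F) (J → F) (K → F)) _ v w ↔
      GRel (coordEquiv F I J K v) (coordEquiv F I J K w) := by
  set e := coordEquiv F I J K with he
  have key : GRel (e w) (e v) ↔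
      ∃ g : ((I → F) ⊗[F] (J → F) ⊗[F] (K → F)) ≃ₗ[F] ((I → F) ⊗[F] (J → F) ⊗[F] (K → F)),
        g ∈ groupG F (I → F) (J → F) (K → F) ∧ g w = v := by
    constructor
    · rintro ⟨g, hg, h⟩
      refine ⟨(e.trans g).trans e.symm, ?_, by simp [h]⟩
      rw [groupG, MulAction.mem_stabilizer_iff]
      change (fun x => e.symm (g (e x))) '' _ = _
      have : (fun x => e.symm (g (e x))) = e.symm ∘ g ∘ e := rfl
      rw [this, Set.image_comp, Set.image_comp, coordEquiv_image_fundamentalTensors, hg,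
        ← coordEquiv_image_fundamentalTensors, ← Set.image_comp]
      simp [he]
    · rintro ⟨g, hg, rfl⟩
      refine ⟨(e.symm.trans g).trans e, ?_, by simp⟩
      rw [groupG, MulAction.mem_stabilizer_iff] at hg
      have hg' : g '' fundamentalTensors F (I → F) (J → F) (K → F) = _ := hg
      have : ⇑((e.symm.trans g).trans e) = e ∘ g ∘ e.symm := rfl
      rw [this, Set.image_comp, Set.image_comp]
      conv_lhs => rw [← coordEquiv_image_fundamentalTensors, ← Set.image_comp e.symm]
      have h1 : ⇑(e.symm) ∘ ⇑e = id := by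
        funext x
        simp
      rw [h1, Set.image_id, hg', coordEquiv_image_fundamentalTensors]
  rw [MulAction.orbitRel_apply]
  have hs : GRel (e v) (e w) ↔ GRel (e w) (e v) :=
    ⟨(gSetoid I J K F).symm, (gSetoid I J K F).symm⟩
  rw [hs, key]
  constructor
  · rintro ⟨⟨g, hg⟩, h⟩
    exact ⟨g, hg, h⟩
  · rintro ⟨g, hg, h⟩
    exact ⟨⟨g, hg⟩, h⟩

end Coordinates

theorem numOrbitsH_eq (F : Type*) [Field F] (r : ℕ) :
    numOrbitsH F r = Nat.card (Quotient (hSetoid (Fin 2) (Fin 3) (Fin r) F)) :=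
  Nat.card_congr (Quotient.congr (coordEquiv F (Fin 2) (Fin 3) (Fin r)).toEquiv
    fun v w => orbitRel_groupH_iff v w)

theorem numOrbitsG_eq (F : Type*) [Field F] (r : ℕ) :
    numOrbitsG F r = Nat.card (Quotient (gSetoid (Fin 2) (Fin 3) (Fin r) F)) :=
  Nat.card_congr (Quotient.congr (coordEquiv F (Fin 2) (Fin 3) (Fin r)).toEquiv
    fun v w => orbitRel_groupG_iff v w)

/-! ### Linear spaces of pure tensors -/

section Lines

variable {F I J K : Type*} [Field F]

theorem pureTens_ne_zero {a : I → F} {b : J → F} {c : K → F} (ha : a ≠ 0) (hb : b ≠ 0)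
    (hc : c ≠ 0) : pureTens a b c ≠ 0 := by
  obtain ⟨i, hi⟩ := Function.ne_iff.1 ha
  obtain ⟨j, hj⟩ := Function.ne_iff.1 hb
  obtain ⟨k, hk⟩ := Function.ne_iff.1 hc
  intro h
  have := congrFun (congrFun (congrFun h i) j) k
  simp only [pureTens, Pi.zero_apply] at this hi hj hk
  exact mul_ne_zero (mul_ne_zero hi hj) hk this

theorem ne_zero_of_pureTens_ne_zero {a : I → F} {b : J → F} {c : K → F}
    (h : pureTens a b c ≠ 0) : a ≠ 0 ∧ b ≠ 0 ∧ c ≠ 0 := by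
  refine ⟨?_, ?_, ?_⟩ <;> rintro rfl <;> refine h ?_ <;> funext i j k <;> simp [pureTens]

theorem pureTens_inj {a a' : I → F} {b b' : J → F} {c c' : K → F} (ha : a ≠ 0) (hb : b ≠ 0)
    (hc : c ≠ 0) (h : pureTens a b c = pureTens a' b' c') :
    (∃ x : F, x ≠ 0 ∧ a' = x • a) ∧ (∃ x : F, x ≠ 0 ∧ b' = x • b) ∧
      (∃ x : F, x ≠ 0 ∧ c' = x • c) := by
  obtain ⟨i, hi⟩ := Function.ne_iff.1 ha
  obtain ⟨j, hj⟩ := Function.ne_iff.1 hb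
  obtain ⟨k, hk⟩ := Function.ne_iff.1 hc
  have e : ∀ i j k, a i * b j * c k = a' i * b' j * c' k := fun i j k =>
    congrFun (congrFun (congrFun h i) j) k
  simp only [Pi.zero_apply] at hi hj hk
  have h0 : a' i * b' j * c' k ≠ 0 := by
    rw [← e]
    exact mul_ne_zero (mul_ne_zero hi hj) hk
  have hi' : a' i ≠ 0 := fun h => h0 (by simp [h])
  have hj' : b' j ≠ 0 := fun h => h0 (by simp [h])
  have hk' : c' k ≠ 0 := fun h => h0 (by simp [h])
  refine ⟨⟨b j * c k / (b' j * c' k), by positivity, ?_⟩,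
    ⟨a i * c k / (a' i * c' k), by positivity, ?_⟩,
    ⟨a i * b j / (a' i * b' j), by positivity, ?_⟩⟩
  · funext x
    simp only [Pi.smul_apply, smul_eq_mul]
    field_simp
    linear_combination - e x j k
  · funext x
    simp only [Pi.smul_apply, smul_eq_mul]
    field_simp
    linear_combination - e i x k
  · funext x
    simp only [Pi.smul_apply, smul_eq_mul]
    field_simp
    linear_combination - e i j x

/-- A 2 × 2 minor of u ⊗ v + u' ⊗ v' is the product of a minor of (u, u') and a minor of (v, v'). It
vanishes because the sum has rank at most one, so one of the two pairs is dependent. -/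
theorem proportional_of_add_eq {X Y : Type*} {u u' u'' : X → F} {v v' v'' : Y → F} (hu : u ≠ 0)
    (hv : v ≠ 0) (h : ∀ x y, u x * v y + u' x * v' y = u'' x * v'' y) :
    (∃ s : F, u' = s • u) ∨ ∃ s : F, v' = s • v := by
  obtain ⟨x₀, hx⟩ := Function.ne_iff.1 hu
  obtain ⟨y₀, hy⟩ := Function.ne_iff.1 hv
  simp only [Pi.zero_apply] at hx hy
  by_cases hm : ∀ x, u x₀ * u' x - u x * u' x₀ = 0
  · left
    refine ⟨u' x₀ / u x₀, funext fun x => ?_⟩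
    simp only [Pi.smul_apply, smul_eq_mul]
    field_simp
    linear_combination hm x
  · right
    push Not at hm
    obtain ⟨x, hm⟩ := hm
    refine ⟨v' y₀ / v y₀, funext fun y => ?_⟩
    have : (u x₀ * u' x - u x * u' x₀) * (v y₀ * v' y - v y * v' y₀) = 0 := by
      have h1 := h x₀ y₀
      have h2 := h x₀ y
      have h3 := h x y₀
      have h4 := h x y
      have : (u x₀ * v y₀ + u' x₀ * v' y₀) * (u x * v y + u' x * v' y) =
          (u x₀ * v y + u' x₀ * v' y) * (u x * v y₀ + u' x * v' y₀) := by
        rw [h1, h2, h3, h4]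
        ring
      linear_combination this
    have := (mul_eq_zero.1 this).resolve_left hm
    simp only [Pi.smul_apply, smul_eq_mul]
    field_simp
    linear_combination this

/-- The map `a ↦ a ⊗ b ⊗ c`. -/
def pureMap₁ (b : J → F) (c : K → F) : (I → F) →ₗ[F] Tens I J K F where
  toFun a := pureTens a b c
  map_add' x y := by funext i j k; simp [pureTens]; ring
  map_smul' x y := by funext i j k; simp [pureTens]; ring

/-- The map `b ↦ a ⊗ b ⊗ c`. -/
def pureMap₂ (a : I → F) (c : K → F) : (J → F) →ₗ[F] Tens I J K F where
  toFun b := pureTens a b c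
  map_add' x y := by funext i j k; simp [pureTens]; ring
  map_smul' x y := by funext i j k; simp [pureTens]; ring

/-- The map `c ↦ a ⊗ b ⊗ c`. -/
def pureMap₃ (a : I → F) (b : J → F) : (K → F) →ₗ[F] Tens I J K F where
  toFun c := pureTens a b c
  map_add' x y := by funext i j k; simp [pureTens]; ring
  map_smul' x y := by funext i j k; simp [pureTens]; ring

@[simp] theorem pureMap₁_apply (a : I → F) (b : J → F) (c : K → F) :
    pureMap₁ b c a = pureTens a b c := rfl

@[simp] theorem pureMap₂_apply (a : I → F) (b : J → F) (c : K → F) :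
    pureMap₂ a c b = pureTens a b c := rfl

@[simp] theorem pureMap₃_apply (a : I → F) (b : J → F) (c : K → F) :
    pureMap₃ a b c = pureTens a b c := rfl

theorem pureMap₁_injective {b : J → F} {c : K → F} (hb : b ≠ 0) (hc : c ≠ 0) :
    Function.Injective (pureMap₁ b c : (I → F) →ₗ[F] Tens I J K F) := by
  rw [injective_iff_map_eq_zero]
  intro a h
  by_contra ha
  exact pureTens_ne_zero ha hb hc h

theorem pureMap₂_injective {a : I → F} {c : K → F} (ha : a ≠ 0) (hc : c ≠ 0) :
    Function.Injective (pureMap₂ a c : (J → F) →ₗ[F] Tens I J K F) := by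
  rw [injective_iff_map_eq_zero]
  intro b h
  by_contra hb
  exact pureTens_ne_zero ha hb hc h

theorem pureMap₃_injective {a : I → F} {b : J → F} (ha : a ≠ 0) (hb : b ≠ 0) :
    Function.Injective (pureMap₃ a b : (K → F) →ₗ[F] Tens I J K F) := by
  rw [injective_iff_map_eq_zero]
  intro c h
  by_contra hc
  exact pureTens_ne_zero ha hb hc h

/-- The space of all pure tensors through `a ⊗ b ⊗ c` that differ from it in one factor only. -/
def pureLine (a : I → F) (b : J → F) (c : K → F) : Fin 3 → Submodule F (Tens I J K F) :=
  ![LinearMap.range (pureMap₁ b c), LinearMap.range (pureMap₂ a c), LinearMap.range (pureMap₃ a b)]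

theorem self_mem_pureLine (a : I → F) (b : J → F) (c : K → F) (n : Fin 3) :
    pureTens a b c ∈ pureLine a b c n := by
  fin_cases n
  exacts [⟨a, rfl⟩, ⟨b, rfl⟩, ⟨c, rfl⟩]

theorem pureLine_smul {x y z : F} (hx : x ≠ 0) (hy : y ≠ 0) (hz : z ≠ 0) (a : I → F) (b : J → F)
    (c : K → F) (n : Fin 3) : pureLine (x • a) (y • b) (z • c) n = pureLine a b c n := by
  ext t
  fin_cases n
  · change (∃ _, _) ↔ ∃ _, _
    constructor
    · rintro ⟨u, rfl⟩
      refine ⟨(y * z) • u, ?_⟩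
      funext i j k
      simp [pureTens]
      ring
    · rintro ⟨u, rfl⟩
      refine ⟨(y * z)⁻¹ • u, ?_⟩
      funext i j k
      simp [pureTens]
      field_simp
  · change (∃ _, _) ↔ ∃ _, _
    constructor
    · rintro ⟨u, rfl⟩
      refine ⟨(x * z) • u, ?_⟩
      funext i j k
      simp [pureTens]
      ring
    · rintro ⟨u, rfl⟩
      refine ⟨(x * z)⁻¹ • u, ?_⟩
      funext i j k
      simp [pureTens]
      field_simp
  · change (∃ _, _) ↔ ∃ _, _
    constructor
    · rintro ⟨u, rfl⟩
      refine ⟨(x * y) • u, ?_⟩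
      funext i j k
      simp [pureTens]
      ring
    · rintro ⟨u, rfl⟩
      refine ⟨(x * y)⁻¹ • u, ?_⟩
      funext i j k
      simp [pureTens]
      field_simp

/-- `L` is one of the lines `V₁ ⊗ b ⊗ c` (`n = 0`), `a ⊗ V₂ ⊗ c` (`n = 1`), `a ⊗ b ⊗ V₃`
(`n = 2`). -/
def IsLine (n : Fin 3) (L : Submodule F (Tens I J K F)) : Prop :=
  ∃ a b c, a ≠ 0 ∧ b ≠ 0 ∧ c ≠ 0 ∧ L = pureLine a b c n

/-- The two frozen factors of a line are, up to scalars, those of any nonzero point on it. So a line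
of a given kind is determined by one such point. -/
theorem pureLine_eq_of_mem {a a' : I → F} {b b' : J → F} {c c' : K → F} (ha : a ≠ 0) (hb : b ≠ 0)
    (hc : c ≠ 0) {n : Fin 3} (h : pureTens a b c ∈ pureLine a' b' c' n) :
    pureLine a' b' c' n = pureLine a b c n := by
  have key : ∀ a'' b'' c'', pureTens a b c = pureTens a'' b'' c'' →
      pureLine a'' b'' c'' n = pureLine a b c n := by
    intro a'' b'' c'' h
    obtain ⟨⟨x, hx, rfl⟩, ⟨y, hy, rfl⟩, ⟨z, hz, rfl⟩⟩ := pureTens_inj ha hb hc h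
    exact pureLine_smul hx hy hz a b c n
  fin_cases n
  · obtain ⟨u, hu⟩ := h
    exact key u b' c' hu.symm
  · obtain ⟨u, hu⟩ := h
    exact key a' u c' hu.symm
  · obtain ⟨u, hu⟩ := h
    exact key a' b' u hu.symm

theorem IsLine.eq_pureLine {n : Fin 3} {L : Submodule F (Tens I J K F)} (hL : IsLine n L)
    {a : I → F} {b : J → F} {c : K → F} (ha : a ≠ 0) (hb : b ≠ 0) (hc : c ≠ 0)
    (h : pureTens a b c ∈ L) : L = pureLine a b c n := by
  obtain ⟨a', b', c', -, -, -, rfl⟩ := hL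
  exact pureLine_eq_of_mem ha hb hc h

theorem IsLine.mem_pureSet {n : Fin 3} {L : Submodule F (Tens I J K F)} (hL : IsLine n L)
    {t : Tens I J K F} (ht : t ∈ L) (h0 : t ≠ 0) : t ∈ pureSet I J K F := by
  obtain ⟨a, b, c, ha, hb, hc, rfl⟩ := hL
  have : ∃ a b c, pureTens a b c = t := by
    fin_cases n
    · obtain ⟨u, hu⟩ := ht
      exact ⟨_, _, _, hu⟩
    · obtain ⟨u, hu⟩ := ht
      exact ⟨_, _, _, hu⟩
    · obtain ⟨u, hu⟩ := ht
      exact ⟨_, _, _, hu⟩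
  obtain ⟨a', b', c', rfl⟩ := this
  obtain ⟨h1, h2, h3⟩ := ne_zero_of_pureTens_ne_zero h0
  exact ⟨a', b', c', h1, h2, h3, rfl⟩

/-- Two flattenings are used. In the flattening I against J × K, either the last two factors are
proportional to each other (kind 0) or the first ones are. In the latter case the flattening J
against I × K decides between kinds 1 and 2. -/
theorem mem_pureLine_of_add {a a' a'' : I → F} {b b' b'' : J → F} {c c' c'' : K → F} (ha : a ≠ 0)
    (hb : b ≠ 0) (hc : c ≠ 0)
    (h : pureTens a b c + pureTens a' b' c' = pureTens a'' b'' c'') :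
    ∃ n, pureTens a' b' c' ∈ pureLine a b c n := by
  have e : ∀ i j k, a i * b j * c k + a' i * b' j * c' k = a'' i * b'' j * c'' k := fun i j k =>
    congrFun (congrFun (congrFun h i) j) k
  obtain ⟨i, hi⟩ := Function.ne_iff.1 ha
  obtain ⟨j, hj⟩ := Function.ne_iff.1 hb
  obtain ⟨k, hk⟩ := Function.ne_iff.1 hc
  simp only [Pi.zero_apply] at hi hj hk
  rcases proportional_of_add_eq (u := a) (u' := a') (u'' := a'')
    (v := fun p : J × K => b p.1 * c p.2) (v' := fun p : J × K => b' p.1 * c' p.2)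
    (v'' := fun p : J × K => b'' p.1 * c'' p.2) ha
    (Function.ne_iff.2 ⟨(j, k), mul_ne_zero hj hk⟩)
    (fun x y => by linear_combination e x y.1 y.2) with ⟨x, hx⟩ | ⟨x, hx⟩
  · rcases proportional_of_add_eq (u := b) (u' := b') (u'' := b'')
      (v := fun p : I × K => a p.1 * c p.2) (v' := fun p : I × K => a' p.1 * c' p.2)
      (v'' := fun p : I × K => a'' p.1 * c'' p.2) hb
      (Function.ne_iff.2 ⟨(i, k), mul_ne_zero hi hk⟩)
      (fun x y => by linear_combination e y.1 x y.2) with ⟨y, hy⟩ | ⟨y, hy⟩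
    · refine ⟨2, (x * y) • c', ?_⟩
      funext i j k
      simp [pureTens, hx, hy]
      ring
    · refine ⟨1, y • b', ?_⟩
      funext i j k
      have := congrFun hy (i, k)
      simp only [Pi.smul_apply, smul_eq_mul] at this
      simp only [pureMap₂_apply, pureTens, Pi.smul_apply, smul_eq_mul]
      linear_combination -b' j * this
  · refine ⟨0, x • a', ?_⟩
    funext i j k
    have := congrFun hx (j, k)
    simp only [Pi.smul_apply, smul_eq_mul] at this
    simp only [pureMap₁_apply, pureTens, Pi.smul_apply, smul_eq_mul]
    linear_combination -a' i * this

/-- Adding the given point to any member of U stays in U, hence pure, so every member lies on one of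
the three lines through the point. A vector space over an infinite field is not a finite union of
proper subspaces, so a single line contains U. -/
theorem exists_le_pureLine [Infinite F] {U : Submodule F (Tens I J K F)}
    (hU : ∀ t ∈ U, t ≠ 0 → t ∈ pureSet I J K F) {a : I → F} {b : J → F} {c : K → F} (ha : a ≠ 0)
    (hb : b ≠ 0) (hc : c ≠ 0) (h : pureTens a b c ∈ U) : ∃ n, U ≤ pureLine a b c n := by
  classical
  set s : Finset (Submodule F U) :=
    Finset.univ.image fun n : Fin 3 => (pureLine a b c n).comap U.subtype with hs
  have hcov : ⋃ p ∈ s, (p : Set U) = Set.univ := by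
    rw [Set.eq_univ_iff_forall]
    rintro ⟨t, ht⟩
    have hpure : ∀ t ∈ U, ∃ a b c, t = pureTens a b c := by
      intro t ht
      by_cases h0 : t = 0
      · exact ⟨0, 0, 0, by rw [h0]; funext i j k; simp [pureTens]⟩
      · obtain ⟨a, b, c, -, -, -, h⟩ := hU t ht h0
        exact ⟨a, b, c, h⟩
    obtain ⟨a', b', c', rfl⟩ := hpure t ht
    obtain ⟨a'', b'', c'', h'⟩ := hpure _ (U.add_mem h ht)
    obtain ⟨n, hn⟩ := mem_pureLine_of_add ha hb hc h'
    simp only [hs, Finset.mem_image, Finset.mem_univ, true_and, Set.iUnion_exists,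
      Set.iUnion_iUnion_eq', Set.mem_iUnion]
    exact ⟨n, hn⟩
  have := Subspace.top_mem_of_biUnion_eq_univ hcov
  rw [hs, Finset.mem_image] at this
  obtain ⟨n, -, hn⟩ := this
  refine ⟨n, fun t ht => ?_⟩
  have : (⟨t, ht⟩ : U) ∈ (pureLine a b c n).comap U.subtype := by rw [hn]; trivial
  exact this

variable [Fintype I] [Fintype J] [Fintype K]

/-- The dimensions of the three kinds of lines. -/
def lineDim (I J K : Type*) [Fintype I] [Fintype J] [Fintype K] : Fin 3 → ℕ :=
  ![Fintype.card I, Fintype.card J, Fintype.card K]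

theorem IsLine.finrank_eq {n : Fin 3} {L : Submodule F (Tens I J K F)} (hL : IsLine n L) :
    Module.finrank F L = lineDim I J K n := by
  obtain ⟨a, b, c, ha, hb, hc, rfl⟩ := hL
  fin_cases n
  · exact (LinearMap.finrank_range_of_inj (pureMap₁_injective hb hc)).trans
      (Module.finrank_fintype_fun_eq_card F)
  · exact (LinearMap.finrank_range_of_inj (pureMap₂_injective ha hc)).trans
      (Module.finrank_fintype_fun_eq_card F)
  · exact (LinearMap.finrank_range_of_inj (pureMap₃_injective ha hb)).trans
      (Module.finrank_fintype_fun_eq_card F)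

theorem exists_not_proportional (hI : 2 ≤ Fintype.card I) (a : I → F) :
    ∃ x : I → F, x ≠ 0 ∧ ∀ s : F, x ≠ s • a := by
  by_contra! h
  have : Module.finrank F (I → F) ≤ 1 := by
    refine finrank_le_one a fun w => ?_
    by_cases hw : w = 0
    · exact ⟨0, by simp [hw]⟩
    · obtain ⟨s, hs⟩ := h w hw
      exact ⟨s, hs.symm⟩
  rw [Module.finrank_fintype_fun_eq_card] at this
  omega

/-- In dimension at least 2 the varying factor can be made non-proportional to its original value,
which is impossible on a line where that factor is frozen. -/
theorem eq_of_pureLine_le (hI : 2 ≤ Fintype.card I) (hJ : 2 ≤ Fintype.card J)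
    (hK : 2 ≤ Fintype.card K) {a : I → F} {b : J → F} {c : K → F} (ha : a ≠ 0) (hb : b ≠ 0)
    (hc : c ≠ 0) {m n : Fin 3} (h : pureLine a b c m ≤ pureLine a b c n) : m = n := by
  obtain ⟨x, hx, hxa⟩ := exists_not_proportional hI a
  obtain ⟨y, hy, hyb⟩ := exists_not_proportional hJ b
  obtain ⟨z, hz, hzc⟩ := exists_not_proportional hK c
  have hx' : pureTens x b c ∈ pureLine a b c 0 := ⟨x, rfl⟩
  have hy' : pureTens a y c ∈ pureLine a b c 1 := ⟨y, rfl⟩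
  have hz' : pureTens a b z ∈ pureLine a b c 2 := ⟨z, rfl⟩
  have k1 : ∀ b' c', pureTens a b' c' ≠ pureTens x b c := fun b' c' e => by
    obtain ⟨⟨s, hs, h⟩, -⟩ := pureTens_inj hx hb hc e.symm
    exact hxa s⁻¹ (by rw [h, inv_smul_smul₀ hs])
  have k2 : ∀ a' c', pureTens a' b c' ≠ pureTens a y c := fun a' c' e => by
    obtain ⟨-, ⟨s, hs, h⟩, -⟩ := pureTens_inj ha hy hc e.symm
    exact hyb s⁻¹ (by rw [h, inv_smul_smul₀ hs])
  have k3 : ∀ a' b', pureTens a' b' c ≠ pureTens a b z := fun a' b' e => by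
    obtain ⟨-, -, s, hs, h⟩ := pureTens_inj ha hb hz e.symm
    exact hzc s⁻¹ (by rw [h, inv_smul_smul₀ hs])
  fin_cases m <;> fin_cases n <;> first | rfl | exfalso
  · obtain ⟨u, hu⟩ := h hx'
    exact k1 _ _ hu
  · obtain ⟨u, hu⟩ := h hx'
    exact k1 _ _ hu
  · obtain ⟨u, hu⟩ := h hy'
    exact k2 _ _ hu
  · obtain ⟨u, hu⟩ := h hy'
    exact k2 _ _ hu
  · obtain ⟨u, hu⟩ := h hz'
    exact k3 _ _ hu
  · obtain ⟨u, hu⟩ := h hz'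
    exact k3 _ _ hu

theorem IsLine.eq_of_le (hI : 2 ≤ Fintype.card I) (hJ : 2 ≤ Fintype.card J)
    (hK : 2 ≤ Fintype.card K) {m n : Fin 3} {L L' : Submodule F (Tens I J K F)} (hL : IsLine m L)
    (hL' : IsLine n L') (h : L ≤ L') : m = n ∧ L = L' := by
  obtain ⟨a, b, c, ha, hb, hc, rfl⟩ := hL
  have h' := hL'.eq_pureLine ha hb hc (h (self_mem_pureLine a b c m))
  rw [h'] at h
  have := eq_of_pureLine_le hI hJ hK ha hb hc h
  exact ⟨this, by rw [h', this]⟩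

/-- The image of a line L consists of pure tensors, so it lies in some line L'. The same for the
inverse puts the preimage of L' in a line containing L; lines are never strictly nested, so the
image is all of L'. The kind may change, but not the dimension. -/
theorem exists_isLine_map [Infinite F] (hI : 2 ≤ Fintype.card I) (hJ : 2 ≤ Fintype.card J)
    (hK : 2 ≤ Fintype.card K) {g : Tens I J K F ≃ₗ[F] Tens I J K F}
    (hg : g '' pureSet I J K F = pureSet I J K F) {m : Fin 3} {L : Submodule F (Tens I J K F)}
    (hL : IsLine m L) :
    ∃ n, lineDim I J K n = lineDim I J K m ∧ IsLine n (L.map g.toLinearMap) := by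
  have key : ∀ g : Tens I J K F ≃ₗ[F] Tens I J K F, g '' pureSet I J K F = pureSet I J K F →
      ∀ (m : Fin 3) (L : Submodule F (Tens I J K F)), IsLine m L →
        ∃ n L', IsLine n L' ∧ L.map g.toLinearMap ≤ L' := by
    intro g hg m L hL
    obtain ⟨a, b, c, ha, hb, hc, rfl⟩ := id hL
    have hmem : g (pureTens a b c) ∈ pureSet I J K F := by
      rw [← hg]
      exact ⟨_, ⟨a, b, c, ha, hb, hc, rfl⟩, rfl⟩
    obtain ⟨a', b', c', ha', hb', hc', h'⟩ := hmem
    have hin : pureTens a' b' c' ∈ (pureLine a b c m).map g.toLinearMap := by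
      rw [← h']
      exact ⟨_, self_mem_pureLine a b c m, rfl⟩
    obtain ⟨n, hn⟩ := exists_le_pureLine (U := (pureLine a b c m).map g.toLinearMap) (by
      rintro _ ⟨t, ht, rfl⟩ h0
      have : t ≠ 0 := by
        rintro rfl
        exact h0 (map_zero _)
      rw [← hg]
      exact ⟨t, hL.mem_pureSet ht this, rfl⟩) ha' hb' hc' hin
    exact ⟨n, _, ⟨a', b', c', ha', hb', hc', rfl⟩, hn⟩
  obtain ⟨n, L', hL', hle⟩ := key g hg m L hL
  have hg' : g.symm '' pureSet I J K F = pureSet I J K F := by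
    conv_lhs => rw [← hg]
    rw [← Set.image_comp]
    simp
  obtain ⟨p, L'', hL'', hle'⟩ := key g.symm hg' n L' hL'
  have h1 : L ≤ L'' := fun t ht => hle' ⟨g t, hle ⟨t, ht, rfl⟩, by simp⟩
  obtain ⟨rfl, rfl⟩ := hL.eq_of_le hI hJ hK hL'' h1
  have h2 : L.map g.toLinearMap = L' := by
    refine le_antisymm hle fun t ht => ⟨g.symm t, hle' ⟨t, ht, rfl⟩, by simp⟩
  refine ⟨n, ?_, by rwa [h2]⟩
  rw [← hL'.finrank_eq, ← hL.finrank_eq, ← h2]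
  exact LinearEquiv.finrank_map_eq g L

end Lines

/-! ### Linear maps preserving the pure tensors -/

section Preserver

variable {F I J K : Type*} [Field F]

theorem isLine_pureLine {a : I → F} {b : J → F} {c : K → F} (ha : a ≠ 0) (hb : b ≠ 0)
    (hc : c ≠ 0) (n : Fin 3) : IsLine n (pureLine a b c n) := ⟨a, b, c, ha, hb, hc, rfl⟩

theorem exists_factor_of_range_le {U V W : Type*} [AddCommGroup U] [Module F U] [AddCommGroup V]
    [Module F V] [AddCommGroup W] [Module F W] (f : U →ₗ[F] W) {h : V →ₗ[F] W}
    (hh : Function.Injective h) (hle : ∀ u, ∃ v, h v = f u) :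
    ∃ A : U →ₗ[F] V, ∀ u, h (A u) = f u := by
  obtain ⟨l, hl⟩ := LinearMap.exists_leftInverse_of_injective h (LinearMap.ker_eq_bot.2 hh)
  refine ⟨l ∘ₗ f, fun u => ?_⟩
  obtain ⟨v, hv⟩ := hle u
  rw [LinearMap.comp_apply, ← hv, ← LinearMap.comp_apply l h, hl]
  rfl

variable [Fintype I] [Fintype J] [Fintype K]

/-- Dimension forces lines of kind 0 to keep their kind. At each point the other two lines keep or
exchange their kinds, and the work lies in showing that this alternative is the same at all points.
Moving along the second or third factor is easy, since neighbouring points share a line; moving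
along the first needs `haa`. -/
theorem preserves_types [Infinite F] (hI : 2 ≤ Fintype.card I) (hJ : 2 ≤ Fintype.card J)
    (hK : 2 ≤ Fintype.card K) (hIJ : Fintype.card I ≠ Fintype.card J)
    (hIK : Fintype.card I ≠ Fintype.card K) {g : Tens I J K F ≃ₗ[F] Tens I J K F}
    (hg : g '' pureSet I J K F = pureSet I J K F) :
    (∀ n L, IsLine n L → IsLine n (L.map g.toLinearMap)) ∨
      (Fintype.card J = Fintype.card K ∧
        ∀ n L, IsLine n L → IsLine (Equiv.swap 1 2 n) (L.map g.toLinearMap)) := by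
  have hinj : Function.Injective (Submodule.map g.toLinearMap) :=
    Submodule.map_injective_of_injective g.injective
  have h0 : ∀ L, IsLine 0 L → IsLine 0 (L.map g.toLinearMap) := by
    intro L hL
    obtain ⟨n, hn, h⟩ := exists_isLine_map hI hJ hK hg hL
    fin_cases n
    · exact h
    · exact absurd hn hIJ.symm
    · exact absurd hn hIK.symm
  have h12 : ∀ m L, m ≠ 0 → IsLine m L →
      IsLine 1 (L.map g.toLinearMap) ∨ IsLine 2 (L.map g.toLinearMap) := by
    intro m L hm hL
    obtain ⟨n, hn, h⟩ := exists_isLine_map hI hJ hK hg hL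
    fin_cases n
    · fin_cases m
      · exact absurd rfl hm
      · exact absurd hn hIJ
      · exact absurd hn hIK
    · exact Or.inl h
    · exact Or.inr h
  have hpure : ∀ {a : I → F} {b : J → F} {c : K → F}, a ≠ 0 → b ≠ 0 → c ≠ 0 →
      ∃ a' b' c', a' ≠ 0 ∧ b' ≠ 0 ∧ c' ≠ 0 ∧ g (pureTens a b c) = pureTens a' b' c' := by
    intro a b c ha hb hc
    have : g (pureTens a b c) ∈ pureSet I J K F := by
      rw [← hg]
      exact ⟨_, ⟨a, b, c, ha, hb, hc, rfl⟩, rfl⟩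
    exact this
  -- two distinct lines through a point have images of different kinds
  have hne : ∀ {a : I → F} {b : J → F} {c : K → F}, a ≠ 0 → b ≠ 0 → c ≠ 0 → ∀ n,
      ¬ (IsLine n ((pureLine a b c 1).map g.toLinearMap) ∧
        IsLine n ((pureLine a b c 2).map g.toLinearMap)) := by
    rintro a b c ha hb hc n ⟨h1, h2⟩
    obtain ⟨a', b', c', ha', hb', hc', h⟩ := hpure ha hb hc
    have e1 := h1.eq_pureLine ha' hb' hc' ⟨_, self_mem_pureLine a b c 1, h⟩
    have e2 := h2.eq_pureLine ha' hb' hc' ⟨_, self_mem_pureLine a b c 2, h⟩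
    have := hinj (e1.trans e2.symm)
    exact absurd (eq_of_pureLine_le hI hJ hK ha hb hc this.le) (by decide)
  have hiff : ∀ {a : I → F} {b : J → F} {c : K → F}, a ≠ 0 → b ≠ 0 → c ≠ 0 →
      ((IsLine 1 ((pureLine a b c 1).map g.toLinearMap) ∧
        IsLine 2 ((pureLine a b c 2).map g.toLinearMap)) ∨
      (IsLine 2 ((pureLine a b c 1).map g.toLinearMap) ∧
        IsLine 1 ((pureLine a b c 2).map g.toLinearMap))) := by
    intro a b c ha hb hc
    have h := hne ha hb hc
    rcases h12 1 _ (by decide) (isLine_pureLine ha hb hc 1) with h1 | h1 <;>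
    rcases h12 2 _ (by decide) (isLine_pureLine ha hb hc 2) with h2 | h2
    · exact absurd ⟨h1, h2⟩ (h 1)
    · exact Or.inl ⟨h1, h2⟩
    · exact Or.inr ⟨h1, h2⟩
    · exact absurd ⟨h1, h2⟩ (h 2)
  have hexcl : ∀ {L : Submodule F (Tens I J K F)}, IsLine 1 (L.map g.toLinearMap) → ¬ IsLine 2 (L.map g.toLinearMap) :=
    fun {L} h1 h2 => absurd (h1.eq_of_le hI hJ hK h2 le_rfl).1 (by decide)
  -- the behaviour at a point depends only on the first factor
  have hbc : ∀ {a : I → F} {b b' : J → F} {c c' : K → F}, a ≠ 0 → b ≠ 0 → b' ≠ 0 → c ≠ 0 →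
      c' ≠ 0 → IsLine 1 ((pureLine a b c 1).map g.toLinearMap) →
      IsLine 1 ((pureLine a b' c' 1).map g.toLinearMap) := by
    intro a b b' c c' ha hb hb' hc hc' h
    rcases hiff ha hb hc with ⟨-, h2⟩ | ⟨h1, -⟩
    · rcases hiff ha hb hc' with ⟨h3, -⟩ | ⟨-, h3⟩
      · exact h3
      · exact absurd h2 (hexcl h3)
    · exact absurd h1 (hexcl h)
  have haa : ∀ {a a' : I → F} {b : J → F} {c : K → F}, a ≠ 0 → a' ≠ 0 → b ≠ 0 → c ≠ 0 →
      IsLine 1 ((pureLine a b c 1).map g.toLinearMap) →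
      IsLine 1 ((pureLine a' b c 1).map g.toLinearMap) := by
    intro a a' b c ha ha' hb hc h
    rcases hiff ha' hb hc with ⟨h3, -⟩ | ⟨h3, -⟩
    · exact h3
    exfalso
    obtain ⟨α, β, γ, hα, hβ, hγ, -⟩ := hpure ha hb hc
    obtain ⟨α₁, β₁, γ₁, hα₁, hβ₁, hγ₁, e₁⟩ := h
    obtain ⟨α₂, β₂, γ₂, hα₂, hβ₂, hγ₂, e₂⟩ := h3
    -- The points a ⊗ y ⊗ c and a' ⊗ y ⊗ c lie on a line of kind 0, so their images share their last
    -- two factors up to scalars. If the second image runs along kind 2, its middle factor stays β₂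
    -- up to scalars for all y. Then the first image, which runs along kind 1, would also have a
    -- constant middle factor.
    have hle : pureLine α₁ β₂ γ₁ 1 ≤ pureLine α₁ β₂ γ₁ 2 := by
      change pureLine α₁ β₁ γ₁ 1 ≤ _
      rw [← e₁]
      rintro _ ⟨_, ⟨y, rfl⟩, rfl⟩
      by_cases hy : y = 0
      · subst hy
        convert (pureLine α₁ β₂ γ₁ 2).zero_mem
        rw [← map_zero g]
        exact congrArg g (map_zero (pureMap₂ a c))
      obtain ⟨x₁, y₁, z₁, hx₁, hy₁, hz₁, hp₁⟩ := hpure ha hy hc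
      obtain ⟨x₂, y₂, z₂, hx₂, hy₂, hz₂, hp₂⟩ := hpure ha' hy hc
      have m₁ : pureTens x₁ y₁ z₁ ∈ pureLine α₁ β₁ γ₁ 1 := by
        rw [← e₁, ← hp₁]
        exact ⟨_, ⟨y, rfl⟩, rfl⟩
      have m₂ : pureTens x₂ y₂ z₂ ∈ pureLine α₂ β₂ γ₂ 2 := by
        rw [← e₂, ← hp₂]
        exact ⟨_, ⟨y, rfl⟩, rfl⟩
      have hl := h0 _ (isLine_pureLine ha hy hc 0)
      have h₁ := hl.eq_pureLine hx₁ hy₁ hz₁ ⟨_, self_mem_pureLine a y c 0, hp₁⟩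
      have m₃ : pureTens x₂ y₂ z₂ ∈ pureLine x₁ y₁ z₁ 0 := by
        rw [← h₁, ← hp₂]
        exact ⟨_, ⟨a', rfl⟩, rfl⟩
      obtain ⟨u₁, hu₁⟩ := m₁
      obtain ⟨u₂, hu₂⟩ := m₂
      obtain ⟨u₃, hu₃⟩ := m₃
      obtain ⟨⟨s₁, hs₁, k₁⟩, -, -⟩ := pureTens_inj hx₁ hy₁ hz₁ hu₁.symm
      obtain ⟨-, ⟨s₂, hs₂, k₂⟩, -⟩ := pureTens_inj hx₂ hy₂ hz₂ hu₂.symm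
      obtain ⟨-, ⟨s₃, hs₃, k₃⟩, -⟩ := pureTens_inj hx₂ hy₂ hz₂ hu₃.symm
      change g (pureTens a y c) ∈ _
      rw [hp₁]
      refine ⟨(s₁⁻¹ * s₃ * s₂⁻¹) • z₁, ?_⟩
      funext i j k
      simp only [pureMap₃_apply, k₁, k₂, k₃, pureTens, Pi.smul_apply, smul_eq_mul]
      field_simp
    exact absurd (eq_of_pureLine_le hI hJ hK hα₁ hβ₂ hγ₁ hle) (by decide)
  by_cases hex : ∃ (a : I → F) (b : J → F) (c : K → F), a ≠ 0 ∧ b ≠ 0 ∧ c ≠ 0 ∧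
      IsLine 1 ((pureLine a b c 1).map g.toLinearMap)
  · left
    obtain ⟨a, b, c, ha, hb, hc, h⟩ := hex
    rintro n _ ⟨a', b', c', ha', hb', hc', rfl⟩
    have h1 := hbc ha' hb hb' hc hc' (haa ha ha' hb hc h)
    fin_cases n
    · exact h0 _ (isLine_pureLine ha' hb' hc' 0)
    · exact h1
    · rcases hiff ha' hb' hc' with ⟨-, h2⟩ | ⟨h2, -⟩
      · exact h2
      · exact absurd h2 (hexcl h1)
  · right
    have key : ∀ {a : I → F} {b : J → F} {c : K → F}, a ≠ 0 → b ≠ 0 → c ≠ 0 →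
        IsLine 2 ((pureLine a b c 1).map g.toLinearMap) ∧
        IsLine 1 ((pureLine a b c 2).map g.toLinearMap) := by
      intro a b c ha hb hc
      rcases hiff ha hb hc with ⟨h1, -⟩ | h1
      · exact absurd ⟨a, b, c, ha, hb, hc, h1⟩ hex
      · exact h1
    constructor
    · obtain ⟨a, ha, -⟩ := exists_not_proportional (F := F) hI 0
      obtain ⟨b, hb, -⟩ := exists_not_proportional (F := F) hJ 0
      obtain ⟨c, hc, -⟩ := exists_not_proportional (F := F) hK 0
      have h1 := (isLine_pureLine ha hb hc 1).finrank_eq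
      have h2 := (key ha hb hc).1.finrank_eq
      rw [LinearEquiv.finrank_map_eq g] at h2
      exact h1.symm.trans h2
    · rintro n _ ⟨a', b', c', ha', hb', hc', rfl⟩
      fin_cases n
      · exact h0 _ (isLine_pureLine ha' hb' hc' 0)
      · exact (key ha' hb' hc').1
      · exact (key ha' hb' hc').2

variable [DecidableEq I] [DecidableEq J] [DecidableEq K]

theorem tens_eq_sum (t : Tens I J K F) :
    t = ∑ i, ∑ j, ∑ k, t i j k • pureTens (Pi.single i 1) (Pi.single j 1) (Pi.single k 1) := by
  funext x y z
  simp only [Finset.sum_apply, Matrix.sum_apply, Pi.smul_apply, Matrix.smul_apply]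
  rw [Finset.sum_eq_single x, Finset.sum_eq_single y, Finset.sum_eq_single z]
  all_goals simp +contextual [pureTens, Pi.single_apply, eq_comm]

/-- Elementary tensors of the standard basis are eigenvectors, so h is diagonal; the all-ones tensor
is pure and therefore forces all diagonal entries to agree. -/
theorem eq_smul_of_pureTens_eigen [Nonempty I] [Nonempty J] [Nonempty K]
    (h : Tens I J K F →ₗ[F] Tens I J K F)
    (hp : ∀ a b c, a ≠ 0 → b ≠ 0 → c ≠ 0 → ∃ s : F, h (pureTens a b c) = s • pureTens a b c) :
    ∃ s : F, ∀ t, h t = s • t := by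
  obtain ⟨s, hs⟩ := hp 1 1 1 one_ne_zero one_ne_zero one_ne_zero
  choose l hl using fun (i : I) (j : J) (k : K) =>
    hp (Pi.single i 1) (Pi.single j 1) (Pi.single k 1) (by simp) (by simp) (by simp)
  have exp : ∀ t, h t = fun i j k => t i j k * l i j k := by
    intro t
    conv_lhs => rw [tens_eq_sum t]
    simp only [map_sum, map_smul, hl]
    rw [tens_eq_sum (fun i j k => t i j k * l i j k)]
    simp only [smul_smul]
  have hl' : ∀ i j k, l i j k = s := by
    intro i j k
    have := congrFun (congrFun (congrFun ((exp _).symm.trans hs) i) j) k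
    simpa [pureTens] using this
  refine ⟨s, fun t => ?_⟩
  rw [exp]
  funext i j k
  simp [hl', mul_comm]

theorem exists_gl_mulVec_eq {A : (I → F) →ₗ[F] (I → F)} (hA : Function.Injective A) :
    ∃ M : GL I F, ∀ v, M.1.mulVec v = A v := by
  refine ⟨(glEquiv F I).symm (LinearEquiv.ofInjectiveEndo A hA), fun v => ?_⟩
  rw [← glEquiv_apply, MulEquiv.apply_symm_apply]
  rfl

/-- The restrictions of g to the three lines through a base point give linear maps A, B, C. The
image of any a ⊗ b ⊗ c is located, up to a scalar, as the intersection of two known lines, first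
with one factor kept at the base point (`hab`, `hbc`), then in general (`habc`). Thus g differs from
A ⊗ B ⊗ C by a map with every pure tensor as an eigenvector. -/
theorem exists_tensAct_of_preserves_types (hI : 2 ≤ Fintype.card I) (hJ : 2 ≤ Fintype.card J)
    (hK : 2 ≤ Fintype.card K) {g : Tens I J K F ≃ₗ[F] Tens I J K F}
    (hg : g '' pureSet I J K F = pureSet I J K F)
    (ht : ∀ n L, IsLine n L → IsLine n (L.map g.toLinearMap)) :
    ∃ (M : GL I F) (P : GL J F) (Q : GL K F), ∀ t, g t = tensAct M.1 P.1 Q.1 t := by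
  obtain ⟨a₀, ha₀, -⟩ := exists_not_proportional (F := F) hI 0
  obtain ⟨b₀, hb₀, -⟩ := exists_not_proportional (F := F) hJ 0
  obtain ⟨c₀, hc₀, -⟩ := exists_not_proportional (F := F) hK 0
  have hpure : ∀ {a : I → F} {b : J → F} {c : K → F}, a ≠ 0 → b ≠ 0 → c ≠ 0 →
      ∃ a' b' c', a' ≠ 0 ∧ b' ≠ 0 ∧ c' ≠ 0 ∧ g (pureTens a b c) = pureTens a' b' c' := by
    intro a b c ha hb hc
    have : g (pureTens a b c) ∈ pureSet I J K F := by
      rw [← hg]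
      exact ⟨_, ⟨a, b, c, ha, hb, hc, rfl⟩, rfl⟩
    exact this
  have hline : ∀ {a a' : I → F} {b b' : J → F} {c c' : K → F}, a ≠ 0 → b ≠ 0 → c ≠ 0 → a' ≠ 0 →
      b' ≠ 0 → c' ≠ 0 → ∀ {s : F}, s ≠ 0 → g (pureTens a b c) = s • pureTens a' b' c' → ∀ n,
      (pureLine a b c n).map g.toLinearMap = pureLine a' b' c' n := by
    intro a a' b b' c c' ha hb hc ha' hb' hc' s hs h n
    refine (ht n _ (isLine_pureLine ha hb hc n)).eq_pureLine ha' hb' hc' ?_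
    refine ⟨s⁻¹ • pureTens a b c, Submodule.smul_mem _ _ (self_mem_pureLine a b c n), ?_⟩
    simp [h, smul_smul, hs]
  obtain ⟨α, β, γ, hα, hβ, hγ, h₀⟩ := hpure ha₀ hb₀ hc₀
  have hl₀ := hline ha₀ hb₀ hc₀ hα hβ hγ one_ne_zero (by rw [h₀, one_smul])
  obtain ⟨A, hA⟩ := exists_factor_of_range_le (g.toLinearMap ∘ₗ pureMap₁ b₀ c₀)
    (pureMap₁_injective hβ hγ) (fun x => by
      have : g (pureTens x b₀ c₀) ∈ pureLine α β γ 0 := by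
        rw [← hl₀]
        exact ⟨_, ⟨x, rfl⟩, rfl⟩
      exact this)
  obtain ⟨B, hB⟩ := exists_factor_of_range_le (g.toLinearMap ∘ₗ pureMap₂ a₀ c₀)
    (pureMap₂_injective hα hγ) (fun x => by
      have : g (pureTens a₀ x c₀) ∈ pureLine α β γ 1 := by
        rw [← hl₀]
        exact ⟨_, ⟨x, rfl⟩, rfl⟩
      exact this)
  obtain ⟨C, hC⟩ := exists_factor_of_range_le (g.toLinearMap ∘ₗ pureMap₃ a₀ b₀)
    (pureMap₃_injective hα hβ) (fun x => by
      have : g (pureTens a₀ b₀ x) ∈ pureLine α β γ 2 := by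
        rw [← hl₀]
        exact ⟨_, ⟨x, rfl⟩, rfl⟩
      exact this)
  have hA' : ∀ x, g (pureTens x b₀ c₀) = pureTens (A x) β γ := fun x => (hA x).symm
  have hB' : ∀ x, g (pureTens a₀ x c₀) = pureTens α (B x) γ := fun x => (hB x).symm
  have hC' : ∀ x, g (pureTens a₀ b₀ x) = pureTens α β (C x) := fun x => (hC x).symm
  have iA : Function.Injective A := fun x y h => pureMap₁_injective hb₀ hc₀
    (g.injective (by simp only [pureMap₁_apply, hA', h]))
  have iB : Function.Injective B := fun x y h => pureMap₂_injective ha₀ hc₀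
    (g.injective (by simp only [pureMap₂_apply, hB', h]))
  have iC : Function.Injective C := fun x y h => pureMap₃_injective ha₀ hb₀
    (g.injective (by simp only [pureMap₃_apply, hC', h]))
  have nA : ∀ {x}, x ≠ 0 → A x ≠ 0 := fun h h' => h (iA (by rw [h', map_zero]))
  have nB : ∀ {x}, x ≠ 0 → B x ≠ 0 := fun h h' => h (iB (by rw [h', map_zero]))
  have nC : ∀ {x}, x ≠ 0 → C x ≠ 0 := fun h h' => h (iC (by rw [h', map_zero]))
  have hab : ∀ {a : I → F} {b : J → F}, a ≠ 0 → b ≠ 0 →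
      ∃ s : F, s ≠ 0 ∧ g (pureTens a b c₀) = s • pureTens (A a) (B b) γ := by
    intro a b ha hb
    obtain ⟨x, y, z, hx, hy, hz, h⟩ := hpure ha hb hc₀
    have m1 : g (pureTens a b c₀) ∈ pureLine (A a) β γ 1 := by
      rw [← hline ha hb₀ hc₀ (nA ha) hβ hγ one_ne_zero (by rw [hA', one_smul]) 1]
      exact ⟨_, ⟨b, rfl⟩, rfl⟩
    have m2 : g (pureTens a b c₀) ∈ pureLine α (B b) γ 0 := by
      rw [← hline ha₀ hb hc₀ hα (nB hb) hγ one_ne_zero (by rw [hB', one_smul]) 0]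
      exact ⟨_, ⟨a, rfl⟩, rfl⟩
    obtain ⟨u, hu⟩ := m1
    obtain ⟨v, hv⟩ := m2
    rw [h] at hu hv
    obtain ⟨⟨s, hs, e1⟩, -, ⟨s', hs', e2⟩⟩ := pureTens_inj hx hy hz hu.symm
    obtain ⟨-, ⟨s'', hs'', e3⟩, -⟩ := pureTens_inj hx hy hz hv.symm
    refine ⟨(s * s'' * s')⁻¹, by positivity, ?_⟩
    rw [h, e1, e2, e3]
    funext i j k
    simp only [pureTens, Pi.smul_apply, Matrix.smul_apply, smul_eq_mul]
    field_simp
  have hbc : ∀ {b : J → F} {c : K → F}, b ≠ 0 → c ≠ 0 →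
      ∃ s : F, s ≠ 0 ∧ g (pureTens a₀ b c) = s • pureTens α (B b) (C c) := by
    intro b c hb hc
    obtain ⟨x, y, z, hx, hy, hz, h⟩ := hpure ha₀ hb hc
    have m1 : g (pureTens a₀ b c) ∈ pureLine α (B b) γ 2 := by
      rw [← hline ha₀ hb hc₀ hα (nB hb) hγ one_ne_zero (by rw [hB', one_smul]) 2]
      exact ⟨_, ⟨c, rfl⟩, rfl⟩
    have m2 : g (pureTens a₀ b c) ∈ pureLine α β (C c) 1 := by
      rw [← hline ha₀ hb₀ hc hα hβ (nC hc) one_ne_zero (by rw [hC', one_smul]) 1]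
      exact ⟨_, ⟨b, rfl⟩, rfl⟩
    obtain ⟨u, hu⟩ := m1
    obtain ⟨v, hv⟩ := m2
    rw [h] at hu hv
    obtain ⟨⟨s, hs, e1⟩, ⟨s', hs', e2⟩, -⟩ := pureTens_inj hx hy hz hu.symm
    obtain ⟨-, -, ⟨s'', hs'', e3⟩⟩ := pureTens_inj hx hy hz hv.symm
    refine ⟨(s * s'' * s')⁻¹, by positivity, ?_⟩
    rw [h, e1, e2, e3]
    funext i j k
    simp only [pureTens, Pi.smul_apply, Matrix.smul_apply, smul_eq_mul]
    field_simp
  have habc : ∀ {a : I → F} {b : J → F} {c : K → F}, a ≠ 0 → b ≠ 0 → c ≠ 0 →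
      ∃ s : F, s ≠ 0 ∧ g (pureTens a b c) = s • pureTens (A a) (B b) (C c) := by
    intro a b c ha hb hc
    obtain ⟨x, y, z, hx, hy, hz, h⟩ := hpure ha hb hc
    obtain ⟨p, hp, hp'⟩ := hab ha hb
    obtain ⟨q, hq, hq'⟩ := hbc hb hc
    have m1 : g (pureTens a b c) ∈ pureLine (A a) (B b) γ 2 := by
      rw [← hline ha hb hc₀ (nA ha) (nB hb) hγ hp hp' 2]
      exact ⟨_, ⟨c, rfl⟩, rfl⟩
    have m2 : g (pureTens a b c) ∈ pureLine α (B b) (C c) 0 := by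
      rw [← hline ha₀ hb hc hα (nB hb) (nC hc) hq hq' 0]
      exact ⟨_, ⟨a, rfl⟩, rfl⟩
    obtain ⟨u, hu⟩ := m1
    obtain ⟨v, hv⟩ := m2
    rw [h] at hu hv
    obtain ⟨⟨s, hs, e1⟩, ⟨s', hs', e2⟩, -⟩ := pureTens_inj hx hy hz hu.symm
    obtain ⟨-, -, ⟨s'', hs'', e3⟩⟩ := pureTens_inj hx hy hz hv.symm
    refine ⟨(s * s'' * s')⁻¹, by positivity, ?_⟩
    rw [h, e1, e2, e3]
    funext i j k
    simp only [pureTens, Pi.smul_apply, Matrix.smul_apply, smul_eq_mul]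
    field_simp
  have : Nonempty I := Fintype.card_pos_iff.1 (by omega)
  have : Nonempty J := Fintype.card_pos_iff.1 (by omega)
  have : Nonempty K := Fintype.card_pos_iff.1 (by omega)
  obtain ⟨P, hP⟩ : ∃ M : GL J F, ∀ v, M.1.mulVec v = B v :=
    exists_gl_mulVec_eq iB
  obtain ⟨Q, hQ⟩ : ∃ M : GL K F, ∀ v, M.1.mulVec v = C v :=
    exists_gl_mulVec_eq iC
  obtain ⟨M, hM⟩ : ∃ M : GL I F, ∀ v, M.1.mulVec v = A v :=
    exists_gl_mulVec_eq iA
  have inv : ∀ t, tensAct M⁻¹.1 P⁻¹.1 Q⁻¹.1 (tensAct M.1 P.1 Q.1 t) = t := by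
    intro t
    rw [tensAct_tensAct]
    simp only [← Units.val_mul, inv_mul_cancel, Units.val_one, tensAct_one]
  have inv' : ∀ t, tensAct M.1 P.1 Q.1 (tensAct M⁻¹.1 P⁻¹.1 Q⁻¹.1 t) = t := by
    intro t
    rw [tensAct_tensAct]
    simp only [← Units.val_mul, mul_inv_cancel, Units.val_one, tensAct_one]
  obtain ⟨s, hs⟩ := eq_smul_of_pureTens_eigen (tensAct M⁻¹.1 P⁻¹.1 Q⁻¹.1 ∘ₗ g.toLinearMap) (by
    intro a b c ha hb hc
    obtain ⟨s, -, h⟩ := habc ha hb hc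
    refine ⟨s, ?_⟩
    rw [LinearMap.comp_apply, LinearEquiv.coe_coe, h, ← hM, ← hP, ← hQ, ← tensAct_pureTens,
      map_smul, inv])
  have hgs : ∀ t, g t = s • tensAct M.1 P.1 Q.1 t := by
    intro t
    rw [← map_smul, ← hs, LinearMap.comp_apply, inv']
    rfl
  have hs0 : s ≠ 0 := by
    rintro rfl
    have h1 := hgs (pureTens a₀ b₀ c₀)
    rw [zero_smul, h₀] at h1
    exact pureTens_ne_zero hα hβ hγ h1
  -- The remaining global scalar is absorbed in the first factor.
  refine ⟨(Units.mk0 s hs0) • M, P, Q, fun t => ?_⟩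
  rw [hgs]
  funext i
  simp [tensAct_apply, Finset.smul_sum, Units.smul_def, smul_smul]

end Preserver

/-! ### The list of normal forms of pencils -/

/-- Labels for the normal forms of `3 × 3` pencils. -/
inductive PencilClass
  | zero | rankOne | rankTwo | rankThree | row | col | diagTwo | nilTwo | rotTwo
  | rowSplit | colSplit | rowChain | colChain
  | diagThree | doubleRoot | repeatedDiag | nilThree | nilSplit | singular | rotThree
  deriving DecidableEq

instance : Fintype PencilClass where
  elems := {.zero, .rankOne, .rankTwo, .rankThree, .row, .col, .diagTwo, .nilTwo, .rotTwo,
    .rowSplit, .colSplit, .rowChain, .colChain, .diagThree, .doubleRoot, .repeatedDiag, .nilThree,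
    .nilSplit, .singular, .rotThree}
  complete c := by cases c <;> decide

open PencilClass

/-- The normal forms of `3 × 3` pencils, as pairs of coefficient matrices. -/
def pencilRep (F : Type*) [Field F] : PencilClass → Tens (Fin 2) (Fin 3) (Fin 3) F
  | zero => ![0, 0]
  | rankOne => ![!![1, 0, 0; 0, 0, 0; 0, 0, 0], 0]
  | rankTwo => ![!![1, 0, 0; 0, 1, 0; 0, 0, 0], 0]
  | rankThree => ![!![1, 0, 0; 0, 1, 0; 0, 0, 1], 0]
  | row => ![!![1, 0, 0; 0, 0, 0; 0, 0, 0], !![0, 1, 0; 0, 0, 0; 0, 0, 0]]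
  | col => ![!![1, 0, 0; 0, 0, 0; 0, 0, 0], !![0, 0, 0; 1, 0, 0; 0, 0, 0]]
  | diagTwo => ![!![1, 0, 0; 0, 0, 0; 0, 0, 0], !![0, 0, 0; 0, 1, 0; 0, 0, 0]]
  | nilTwo => ![!![0, 1, 0; 1, 0, 0; 0, 0, 0], !![1, 0, 0; 0, 0, 0; 0, 0, 0]]
  | rotTwo => ![!![1, 0, 0; 0, -1, 0; 0, 0, 0], !![0, -1, 0; -1, 0, 0; 0, 0, 0]]
  | rowSplit => ![!![1, 0, 0; 0, 0, 1; 0, 0, 0], !![0, 1, 0; 0, 0, 0; 0, 0, 0]]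
  | colSplit => ![!![1, 0, 0; 0, 0, 0; 0, 1, 0], !![0, 0, 0; 1, 0, 0; 0, 0, 0]]
  | rowChain => ![!![1, 0, 0; 0, 1, 0; 0, 0, 0], !![0, 1, 0; 0, 0, 1; 0, 0, 0]]
  | colChain => ![!![1, 0, 0; 0, 1, 0; 0, 0, 0], !![0, 0, 0; 1, 0, 0; 0, 1, 0]]
  | diagThree => ![!![1, 0, 0; 0, 0, 0; 0, 0, 1], !![0, 0, 0; 0, 1, 0; 0, 0, 1]]
  | doubleRoot => ![!![0, 1, 0; 1, 0, 0; 0, 0, 0], !![1, 0, 0; 0, 0, 0; 0, 0, 1]]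
  | repeatedDiag => ![!![1, 0, 0; 0, 1, 0; 0, 0, 0], !![0, 0, 0; 0, 0, 0; 0, 0, 1]]
  | nilThree => ![!![0, 1, 0; 1, 0, 0; 0, 0, 0], !![0, 0, 1; 0, 1, 0; 1, 0, 0]]
  | nilSplit => ![!![0, 1, 0; 1, 0, 0; 0, 0, 1], !![1, 0, 0; 0, 0, 0; 0, 0, 0]]
  | singular => ![!![0, 0, 1; 0, 0, 0; 1, 0, 0], !![0, 0, 0; 0, 0, 1; 0, 1, 0]]
  | rotThree => ![!![1, 0, 0; 0, -1, 0; 0, 0, 1], !![0, -1, 0; -1, 0, 0; 0, 0, 0]]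

/-- The classes that are needed over `F`: the two rotation pencils only occur when `-1` is not a
square. -/
def PencilClass.Allowed (F : Type*) [Field F] (c : PencilClass) : Prop :=
  c = rotTwo ∨ c = rotThree → ∀ x : F, x ^ 2 + 1 ≠ 0

/-- The class of the transposed pencil. -/
def PencilClass.transpose : PencilClass → PencilClass
  | row => col
  | col => row
  | rowSplit => colSplit
  | colSplit => rowSplit
  | rowChain => colChain
  | colChain => rowChain
  | c => c

/-! ### Elementary reductions of pencils -/

section Classification

variable {F : Type*} [Field F]

/-- The representatives are chosen (with anti-diagonal blocks instead of Jordan blocks) so that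
transposition permutes them exactly, not merely up to equivalence. -/
theorem pencilRep_transpose (c : PencilClass) (i : Fin 2) :
    pencilRep F c.transpose i = (pencilRep F c i).transpose := by
  ext j k
  cases c <;> fin_cases i <;> fin_cases j <;> fin_cases k <;> rfl

theorem PencilClass.Allowed.transpose {c : PencilClass} (h : c.Allowed F) :
    c.transpose.Allowed F := by
  cases c <;> simp_all [PencilClass.Allowed, PencilClass.transpose]

theorem HRel.transpose {J K : Type*} [Fintype J] [Fintype K] [DecidableEq J] [DecidableEq K]
    {I : Type*} [Fintype I] [DecidableEq I] {s t : Tens I J K F} (h : HRel s t) :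
    HRel (fun i => (s i).transpose) (fun i => (t i).transpose) := by
  obtain ⟨M, P, Q, rfl⟩ := h
  refine ⟨M, Q, P, ?_⟩
  funext i
  simp [tensAct_apply, Matrix.transpose_sum, Matrix.mul_assoc]

/-- A pencil that is equivalent to a normal form. -/
def HasNormalForm (t : Tens (Fin 2) (Fin 3) (Fin 3) F) : Prop :=
  ∃ c : PencilClass, c.Allowed F ∧ HRel t (pencilRep F c)

theorem HasNormalForm.of_hRel {s t : Tens (Fin 2) (Fin 3) (Fin 3) F} (h : HasNormalForm t)
    (hst : HRel s t) : HasNormalForm s := by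
  obtain ⟨c, hc, h⟩ := h
  exact ⟨c, hc, hst.trans h⟩

theorem HasNormalForm.transpose {t : Tens (Fin 2) (Fin 3) (Fin 3) F} (h : HasNormalForm t) :
    HasNormalForm (fun i => (t i).transpose) := by
  obtain ⟨c, hc, h⟩ := h
  refine ⟨c.transpose, hc.transpose, ?_⟩
  have := h.transpose
  rwa [show pencilRep F c.transpose = fun i => (pencilRep F c i).transpose from
    funext fun i => pencilRep_transpose c i]

/-- The working form of equivalence for explicit reductions: an invertible change of the two
members, row operations on the left and column operations on the right. -/
theorem hRel_pencil (α β γ δ : F) (P Q : Matrix (Fin 3) (Fin 3) F) (h : α * δ - β * γ ≠ 0)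
    (hP : P.det ≠ 0) (hQ : Q.det ≠ 0) {A B A' B' : Matrix (Fin 3) (Fin 3) F}
    (hA : P * (α • A + β • B) * Q = A') (hB : P * (γ • A + δ • B) * Q = B') :
    HRel ![A, B] ![A', B'] := by
  refine ⟨Matrix.GeneralLinearGroup.mkOfDetNeZero !![α, β; γ, δ] (by rwa [Matrix.det_fin_two_of]),
    Matrix.GeneralLinearGroup.mkOfDetNeZero P hP,
    Matrix.GeneralLinearGroup.mkOfDetNeZero Q.transpose (by rwa [Matrix.det_transpose]), ?_⟩
  change tensAct !![α, β; γ, δ] P Q.transpose _ = _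
  funext i
  have e : ∀ x y : F, x • (P * A * Q) + y • (P * B * Q) = P * (x • A + y • B) * Q := by
    intro x y
    simp [Matrix.mul_add, Matrix.add_mul]
  rw [tensAct_apply, Fin.sum_univ_two, Matrix.transpose_transpose]
  fin_cases i
  · exact (e α β).trans hA
  · exact (e γ δ).trans hB

/-- Transvections diagonalise the matrix; permutations and scalings finish. In rank one the pivot is
put in the last position, so that the top left 2 × 2 block of the other member of a pencil remains
free for further reduction. -/
theorem exists_rankForm (M : Matrix (Fin 3) (Fin 3) F) :
    ∃ P Q : Matrix (Fin 3) (Fin 3) F, P.det ≠ 0 ∧ Q.det ≠ 0 ∧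
      (P * M * Q = 0 ∨ P * M * Q = !![0, 0, 0; 0, 0, 0; 0, 0, 1] ∨
        P * M * Q = !![1, 0, 0; 0, 1, 0; 0, 0, 0] ∨ P * M * Q = 1) := by
  obtain ⟨L, L', D, hD⟩ := Matrix.Pivot.exists_list_transvec_mul_mul_list_transvec_eq_diagonal M
  set U := (L.map Matrix.TransvectionStruct.toMatrix).prod with hU
  set V := (L'.map Matrix.TransvectionStruct.toMatrix).prod with hV
  have hU1 : U.det = 1 := Matrix.TransvectionStruct.det_toMatrix_prod L
  have hV1 : V.det = 1 := Matrix.TransvectionStruct.det_toMatrix_prod L'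
  have key : ∀ S T N : Matrix (Fin 3) (Fin 3) F, S.det ≠ 0 → T.det ≠ 0 →
      S * Matrix.diagonal D * T = N → ∃ P Q : Matrix (Fin 3) (Fin 3) F, P.det ≠ 0 ∧ Q.det ≠ 0 ∧
      P * M * Q = N := by
    intro S T N hS hT h
    refine ⟨S * U, V * T, by simpa [hU1] using hS, by simpa [hV1] using hT, ?_⟩
    rw [← h, ← hD]
    simp only [Matrix.mul_assoc]
  have hdiag : Matrix.diagonal D = !![D 0, 0, 0; 0, D 1, 0; 0, 0, D 2] := by
    ext i j
    fin_cases i <;> fin_cases j <;> rfl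
  rw [hdiag] at key
  have fin : (∃ N, (N = 0 ∨ N = !![0, 0, 0; 0, 0, 0; 0, 0, 1] ∨ N = !![1, 0, 0; 0, 1, 0; 0, 0, 0] ∨
      N = 1) ∧ ∃ S T : Matrix (Fin 3) (Fin 3) F, S.det ≠ 0 ∧ T.det ≠ 0 ∧
        S * !![D 0, 0, 0; 0, D 1, 0; 0, 0, D 2] * T = N) := by
    by_cases h0 : D 0 = 0 <;> by_cases h1 : D 1 = 0 <;> by_cases h2 : D 2 = 0
    · refine ⟨0, Or.inl rfl, 1, 1, by simp, by simp, ?_⟩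
      ext i j
      fin_cases i <;> fin_cases j <;> simp [h0, h1, h2]
    · refine ⟨_, Or.inr (Or.inl rfl), !![1, 0, 0; 0, 1, 0; 0, 0, (D 2)⁻¹], 1,
        by simp [Matrix.det_fin_three, h2], by simp, ?_⟩
      ext i j
      fin_cases i <;> fin_cases j <;> simp [h0, h1, h2]
    · refine ⟨_, Or.inr (Or.inl rfl), !![1, 0, 0; 0, 0, 1; 0, (D 1)⁻¹, 0],
        !![1, 0, 0; 0, 0, 1; 0, 1, 0],
        by simp [Matrix.det_fin_three, h1], by simp [Matrix.det_fin_three], ?_⟩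
      ext i j
      fin_cases i <;> fin_cases j <;> simp [h0, h1, h2]
    · refine ⟨_, Or.inr (Or.inr (Or.inl rfl)), !![0, 0, (D 2)⁻¹; 0, (D 1)⁻¹, 0; 1, 0, 0],
        !![0, 0, 1; 0, 1, 0; 1, 0, 0],
        by simp [Matrix.det_fin_three, h1, h2], by simp [Matrix.det_fin_three], ?_⟩
      ext i j
      fin_cases i <;> fin_cases j <;> simp [h0, h1, h2]
    · refine ⟨_, Or.inr (Or.inl rfl), !![0, 0, 1; 0, 1, 0; (D 0)⁻¹, 0, 0],
        !![0, 0, 1; 0, 1, 0; 1, 0, 0],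
        by simp [Matrix.det_fin_three, h0], by simp [Matrix.det_fin_three], ?_⟩
      ext i j
      fin_cases i <;> fin_cases j <;> simp [h0, h1, h2]
    · refine ⟨_, Or.inr (Or.inr (Or.inl rfl)), !![(D 0)⁻¹, 0, 0; 0, 0, (D 2)⁻¹; 0, 1, 0],
        !![1, 0, 0; 0, 0, 1; 0, 1, 0],
        by simp [Matrix.det_fin_three, h0, h2], by simp [Matrix.det_fin_three], ?_⟩
      ext i j
      fin_cases i <;> fin_cases j <;> simp [h0, h1, h2]
    · refine ⟨_, Or.inr (Or.inr (Or.inl rfl)), !![(D 0)⁻¹, 0, 0; 0, (D 1)⁻¹, 0; 0, 0, 1],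
        1, by simp [Matrix.det_fin_three, h0, h1], by simp, ?_⟩
      ext i j
      fin_cases i <;> fin_cases j <;> simp [h0, h1, h2]
    · refine ⟨_, Or.inr (Or.inr (Or.inr rfl)), !![(D 0)⁻¹, 0, 0; 0, (D 1)⁻¹, 0; 0, 0, (D 2)⁻¹],
        1, by simp [Matrix.det_fin_three, h0, h1, h2], by simp, ?_⟩
      ext i j
      fin_cases i <;> fin_cases j <;> simp [h0, h1, h2]
  obtain ⟨N, hN, S, T, hS, hT, h⟩ := fin
  obtain ⟨P, Q, hP, hQ, h'⟩ := key S T N hS hT h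
  exact ⟨P, Q, hP, hQ, by rwa [h']⟩

theorem exists_rankForm_two (a b c d : F) :
    ∃ P Q : Matrix (Fin 2) (Fin 2) F, P.det ≠ 0 ∧ Q.det ≠ 0 ∧
      (P * !![a, b; c, d] * Q = 0 ∨ P * !![a, b; c, d] * Q = !![1, 0; 0, 0] ∨
        P * !![a, b; c, d] * Q = 1) := by
  obtain ⟨L, L', D, hD⟩ :=
    Matrix.Pivot.exists_list_transvec_mul_mul_list_transvec_eq_diagonal !![a, b; c, d]
  set U := (L.map Matrix.TransvectionStruct.toMatrix).prod with hU
  set V := (L'.map Matrix.TransvectionStruct.toMatrix).prod with hV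
  have hU1 : U.det = 1 := Matrix.TransvectionStruct.det_toMatrix_prod L
  have hV1 : V.det = 1 := Matrix.TransvectionStruct.det_toMatrix_prod L'
  have key : ∀ S T N : Matrix (Fin 2) (Fin 2) F, S.det ≠ 0 → T.det ≠ 0 →
      S * Matrix.diagonal D * T = N → ∃ P Q : Matrix (Fin 2) (Fin 2) F, P.det ≠ 0 ∧ Q.det ≠ 0 ∧
      P * !![a, b; c, d] * Q = N := by
    intro S T N hS hT h
    refine ⟨S * U, V * T, by simpa [hU1] using hS, by simpa [hV1] using hT, ?_⟩
    rw [← h, ← hD]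
    simp only [Matrix.mul_assoc]
  have hdiag : Matrix.diagonal D = !![D 0, 0; 0, D 1] := by
    ext i j
    fin_cases i <;> fin_cases j <;> rfl
  rw [hdiag] at key
  have fin : (∃ N, (N = 0 ∨ N = !![1, 0; 0, 0] ∨ N = 1) ∧
      ∃ S T : Matrix (Fin 2) (Fin 2) F, S.det ≠ 0 ∧ T.det ≠ 0 ∧
        S * !![D 0, 0; 0, D 1] * T = N) := by
    by_cases h0 : D 0 = 0 <;> by_cases h1 : D 1 = 0
    · refine ⟨0, Or.inl rfl, 1, 1, by simp, by simp, ?_⟩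
      ext i j
      fin_cases i <;> fin_cases j <;> simp [h0, h1]
    · refine ⟨_, Or.inr (Or.inl rfl), !![0, (D 1)⁻¹; 1, 0], !![0, 1; 1, 0],
        by simp [Matrix.det_fin_two, h1], by simp [Matrix.det_fin_two], ?_⟩
      ext i j
      fin_cases i <;> fin_cases j <;> simp [h0, h1]
    · refine ⟨_, Or.inr (Or.inl rfl), !![(D 0)⁻¹, 0; 0, 1], 1,
        by simp [Matrix.det_fin_two, h0], by simp, ?_⟩
      ext i j
      fin_cases i <;> fin_cases j <;> simp [h0, h1]
    · refine ⟨_, Or.inr (Or.inr rfl), !![(D 0)⁻¹, 0; 0, (D 1)⁻¹], 1,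
        by simp [Matrix.det_fin_two, h0, h1], by simp, ?_⟩
      ext i j
      fin_cases i <;> fin_cases j <;> simp [h0, h1]
  obtain ⟨N, hN, S, T, hS, hT, h⟩ := fin
  obtain ⟨P, Q, hP, hQ, h'⟩ := key S T N hS hT h
  exact ⟨P, Q, hP, hQ, by rwa [h']⟩

theorem exists_normalize_vector (u₁ u₂ : F) :
    ∃ p q r s : F, p * s - q * r ≠ 0 ∧ r * u₁ + s * u₂ = 0 ∧
      (p * u₁ + q * u₂ = 0 ∨ p * u₁ + q * u₂ = 1) := by
  by_cases h1 : u₁ = 0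
  · by_cases h2 : u₂ = 0
    · exact ⟨1, 0, 0, 1, by simp, by simp [h2], Or.inl (by simp [h1])⟩
    · exact ⟨0, u₂⁻¹, 1, 0, by simp [h2], by simp [h1], Or.inr (by simp [h2])⟩
  · refine ⟨u₁⁻¹, 0, -u₂, u₁, by simp [h1], by ring, Or.inr (by simp [h1])⟩

end Classification

open PencilClass

/-! ### Existence of normal forms when one member has rank at most one -/

section Completeness

variable {F : Type*} [Field F]

theorem hasNormalForm_of_eq (c : PencilClass) (hc : c ≠ rotTwo ∧ c ≠ rotThree)
    {t : Tens (Fin 2) (Fin 3) (Fin 3) F} (h : HRel t (pencilRep F c)) : HasNormalForm t :=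
  ⟨c, fun h => (h.elim hc.1 hc.2).elim, h⟩

theorem hasNormalForm_of_right_zero (A : Matrix (Fin 3) (Fin 3) F) :
    HasNormalForm ![A, 0] := by
  obtain ⟨P, Q, hP, hQ, h⟩ := exists_rankForm A
  have key : ∀ N, P * A * Q = N → HRel ![A, 0] ![N, 0] := fun N hN =>
    hRel_pencil 1 0 0 1 P Q (by simp) hP hQ (by simpa using hN) (by simp)
  rcases h with h | h | h | h
  · exact hasNormalForm_of_eq zero (by decide) (key _ h)
  · refine hasNormalForm_of_eq rankOne (by decide) ((key _ h).trans ?_)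
    refine hRel_pencil 1 0 0 1 !![0, 0, 1; 0, 1, 0; 1, 0, 0] !![0, 0, 1; 0, 1, 0; 1, 0, 0]
      (by simp) (by simp [Matrix.det_fin_three]) (by simp [Matrix.det_fin_three]) ?_ (by simp)
    ext i j
    fin_cases i <;> fin_cases j <;> simp
  · exact hasNormalForm_of_eq rankTwo (by decide) (key _ h)
  · refine hasNormalForm_of_eq rankThree (by decide) ((key _ h).trans ?_)
    rw [Matrix.one_fin_three]
    exact HRel.refl _

/-! ### Pencils containing a matrix of rank one -/

/-- The identity block clears the last row and column. What is left in the corner is the Schur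
complement, a multiple of the second member, and is subtracted. -/
theorem hasNormalForm_rankOne_of_one (u₁ u₂ v₁ v₂ e : F) :
    HasNormalForm ![!![1, 0, u₁; 0, 1, u₂; v₁, v₂, e], !![0, 0, 0; 0, 0, 0; 0, 0, 1]] := by
  refine hasNormalForm_of_eq repeatedDiag (by decide) (hRel_pencil 1 (-(e - v₁ * u₁ - v₂ * u₂)) 0 1
    !![1, 0, 0; 0, 1, 0; -v₁, -v₂, 1] !![1, 0, -u₁; 0, 1, -u₂; 0, 0, 1] (by simp)
    (by simp [Matrix.det_fin_three]) (by simp [Matrix.det_fin_three]) ?_ ?_)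
  · ext i j
    fin_cases i <;> fin_cases j <;> simp
    ring
  · ext i j
    fin_cases i <;> fin_cases j <;> simp

/-- The pivot 1 clears u₁ and v₁, and the second member clears the corner. Vanishing or not of u₂
and of v₂ gives the four normal forms. -/
theorem hasNormalForm_rankOne_of_single (u₁ u₂ v₁ v₂ e : F) :
    HasNormalForm ![!![1, 0, u₁; 0, 0, u₂; v₁, v₂, e], !![0, 0, 0; 0, 0, 0; 0, 0, 1]] := by
  have h1 : HRel ![!![1, 0, u₁; 0, 0, u₂; v₁, v₂, e], !![0, 0, 0; 0, 0, 0; 0, 0, 1]]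
      ![!![1, 0, 0; 0, 0, u₂; 0, v₂, 0], !![0, 0, 0; 0, 0, 0; 0, 0, 1]] := by
    refine hRel_pencil 1 (-(e - v₁ * u₁)) 0 1
      !![1, 0, 0; 0, 1, 0; -v₁, 0, 1] !![1, 0, -u₁; 0, 1, 0; 0, 0, 1] (by simp)
      (by simp [Matrix.det_fin_three]) (by simp [Matrix.det_fin_three]) ?_ ?_
    · ext i j
      fin_cases i <;> fin_cases j <;> simp
    · ext i j
      fin_cases i <;> fin_cases j <;> simp
  refine HasNormalForm.of_hRel ?_ h1
  by_cases hu : u₂ = 0 <;> by_cases hv : v₂ = 0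
  · refine hasNormalForm_of_eq diagTwo (by decide) (hRel_pencil 1 0 0 1
      !![1, 0, 0; 0, 0, 1; 0, 1, 0] !![1, 0, 0; 0, 0, 1; 0, 1, 0] (by simp)
      (by simp [Matrix.det_fin_three]) (by simp [Matrix.det_fin_three]) ?_ ?_)
    · ext i j
      fin_cases i <;> fin_cases j <;> simp [hu, hv]
    · ext i j
      fin_cases i <;> fin_cases j <;> simp
  · refine hasNormalForm_of_eq rowSplit (by decide) (hRel_pencil 1 0 0 1
      !![0, 0, 1; 1, 0, 0; 0, 1, 0] !![0, 0, 1; v₂⁻¹, 0, 0; 0, 1, 0] (by simp)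
      (by simp [Matrix.det_fin_three]) (by simp [Matrix.det_fin_three, hv]) ?_ ?_)
    · ext i j
      fin_cases i <;> fin_cases j <;> simp [hu, hv]
    · ext i j
      fin_cases i <;> fin_cases j <;> simp
  · refine hasNormalForm_of_eq colSplit (by decide) (hRel_pencil 1 0 0 1
      !![0, u₂⁻¹, 0; 0, 0, 1; 1, 0, 0] !![0, 1, 0; 0, 0, 1; 1, 0, 0] (by simp)
      (by simp [Matrix.det_fin_three, hu]) (by simp [Matrix.det_fin_three]) ?_ ?_)
    · ext i j
      fin_cases i <;> fin_cases j <;> simp [hu, hv]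
    · ext i j
      fin_cases i <;> fin_cases j <;> simp
  · refine hasNormalForm_of_eq nilSplit (by decide) (hRel_pencil 1 0 0 1
      !![0, 0, 1; 0, u₂⁻¹, 0; 1, 0, 0] !![0, 0, 1; 0, v₂⁻¹, 0; 1, 0, 0] (by simp)
      (by simp [Matrix.det_fin_three, hu]) (by simp [Matrix.det_fin_three, hv]) ?_ ?_)
    · ext i j
      fin_cases i <;> fin_cases j <;> simp [hu, hv]
    · ext i j
      fin_cases i <;> fin_cases j <;> simp

/-- With a zero block there is nothing to preserve: the last column is normalised by row operations
and the last row, independently, by column operations. -/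
theorem hasNormalForm_rankOne_of_zero (u₁ u₂ v₁ v₂ e : F) :
    HasNormalForm ![!![0, 0, u₁; 0, 0, u₂; v₁, v₂, e], !![0, 0, 0; 0, 0, 0; 0, 0, 1]] := by
  obtain ⟨p, q, r, s, hd, h0, h⟩ := exists_normalize_vector u₁ u₂
  obtain ⟨p', q', r', s', hd', h0', h'⟩ := exists_normalize_vector v₁ v₂
  have hd'' : p' * s' - r' * q' ≠ 0 := by rwa [mul_comm r']
  have h1 : HRel ![!![0, 0, u₁; 0, 0, u₂; v₁, v₂, e], !![0, 0, 0; 0, 0, 0; 0, 0, 1]]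
      ![!![0, 0, p * u₁ + q * u₂; 0, 0, 0; p' * v₁ + q' * v₂, 0, 0],
        !![0, 0, 0; 0, 0, 0; 0, 0, 1]] := by
    refine hRel_pencil 1 (-e) 0 1
      !![p, q, 0; r, s, 0; 0, 0, 1] !![p', r', 0; q', s', 0; 0, 0, 1] (by simp)
      (by simpa [Matrix.det_fin_three] using hd) (by simpa [Matrix.det_fin_three] using hd'') ?_ ?_
    · ext i j
      fin_cases i <;> fin_cases j <;> simp <;>
        first
        | ring1
        | exact h0
        | linear_combination h0
        | linear_combination h0'
    · ext i j
      fin_cases i <;> fin_cases j <;> simp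
  refine HasNormalForm.of_hRel ?_ h1
  rcases h with h | h <;> rcases h' with h' | h' <;> rw [h, h']
  · refine hasNormalForm_of_eq rankOne (by decide) (hRel_pencil 0 1 1 0
      !![0, 0, 1; 0, 1, 0; 1, 0, 0] !![0, 0, 1; 0, 1, 0; 1, 0, 0] (by simp)
      (by simp [Matrix.det_fin_three]) (by simp [Matrix.det_fin_three]) ?_ ?_)
    · ext i j
      fin_cases i <;> fin_cases j <;> simp
    · ext i j
      fin_cases i <;> fin_cases j <;> simp
  · refine hasNormalForm_of_eq row (by decide) (hRel_pencil 1 0 0 1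
      !![0, 0, 1; 0, 1, 0; 1, 0, 0] !![1, 0, 0; 0, 0, 1; 0, 1, 0] (by simp)
      (by simp [Matrix.det_fin_three]) (by simp [Matrix.det_fin_three]) ?_ ?_)
    · ext i j
      fin_cases i <;> fin_cases j <;> simp
    · ext i j
      fin_cases i <;> fin_cases j <;> simp
  · refine hasNormalForm_of_eq col (by decide) (hRel_pencil 1 0 0 1
      !![1, 0, 0; 0, 0, 1; 0, 1, 0] !![0, 0, 1; 0, 1, 0; 1, 0, 0] (by simp)
      (by simp [Matrix.det_fin_three]) (by simp [Matrix.det_fin_three]) ?_ ?_)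
    · ext i j
      fin_cases i <;> fin_cases j <;> simp
    · ext i j
      fin_cases i <;> fin_cases j <;> simp
  · refine hasNormalForm_of_eq nilTwo (by decide) (hRel_pencil 1 0 0 1
      !![0, 0, 1; 1, 0, 0; 0, 1, 0] !![0, 1, 0; 0, 0, 1; 1, 0, 0] (by simp)
      (by simp [Matrix.det_fin_three]) (by simp [Matrix.det_fin_three]) ?_ ?_)
    · ext i j
      fin_cases i <;> fin_cases j <;> simp
    · ext i j
      fin_cases i <;> fin_cases j <;> simp

/-- Row and column operations on the first two indices fix the second member, so the block may be
brought to its own rank normal form. -/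
theorem hasNormalForm_rankOne (a b c d u₁ u₂ v₁ v₂ e : F) :
    HasNormalForm ![!![a, b, u₁; c, d, u₂; v₁, v₂, e], !![0, 0, 0; 0, 0, 0; 0, 0, 1]] := by
  obtain ⟨P, Q, hP, hQ, h⟩ := exists_rankForm_two (a) (b) (c) (d)
  have key : ∀ N : Matrix (Fin 2) (Fin 2) F,
      P * !![a, b; c, d] * Q = N → ∃ u₁' u₂' v₁' v₂' e' : F,
      HRel ![!![a, b, u₁; c, d, u₂; v₁, v₂, e], !![0, 0, 0; 0, 0, 0; 0, 0, 1]]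
        ![!![N 0 0, N 0 1, u₁'; N 1 0, N 1 1, u₂'; v₁', v₂', e'], !![0, 0, 0; 0, 0, 0; 0, 0, 1]] := by
    rintro N rfl
    refine ⟨P 0 0 * u₁ + P 0 1 * u₂, P 1 0 * u₁ + P 1 1 * u₂,
      v₁ * Q 0 0 + v₂ * Q 1 0, v₁ * Q 0 1 + v₂ * Q 1 1, e,
      hRel_pencil 1 0 0 1 !![P 0 0, P 0 1, 0; P 1 0, P 1 1, 0; 0, 0, 1]
        !![Q 0 0, Q 0 1, 0; Q 1 0, Q 1 1, 0; 0, 0, 1] (by simp)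
        (by simpa [Matrix.det_fin_three, Matrix.det_fin_two] using hP)
        (by simpa [Matrix.det_fin_three, Matrix.det_fin_two] using hQ) ?_ ?_⟩
    · ext i j
      fin_cases i <;> fin_cases j <;>
        simp [Matrix.mul_apply, Fin.sum_univ_three, Fin.sum_univ_two]
    · ext i j
      fin_cases i <;> fin_cases j <;> simp
  rcases h with h | h | h <;> obtain ⟨u₁, u₂, v₁, v₂, e, hr⟩ := key _ h <;>
    refine HasNormalForm.of_hRel ?_ hr
  · exact hasNormalForm_rankOne_of_zero u₁ u₂ v₁ v₂ e
  · exact hasNormalForm_rankOne_of_single u₁ u₂ v₁ v₂ e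
  · exact hasNormalForm_rankOne_of_one u₁ u₂ v₁ v₂ e

end Completeness

open PencilClass

section Completeness

variable {F : Type*} [Field F]

/-! ### Pencils containing the matrix `diag(1, 1, 0)` -/

/-- The block is the companion matrix of x² - τx + δ: a double root, two distinct roots, or an
irreducible quadratic give three shapes, each with or without the extra summand ε. -/
theorem hasNormalForm_companion
    (hquad : ∀ b c : F, (∃ x, x ^ 2 + b * x + c = 0) ∨
      ((∀ x : F, x ^ 2 + 1 ≠ 0) ∧ ∃ u s : F, s ≠ 0 ∧ b = 2 * u ∧ c = u ^ 2 + s ^ 2))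
    (τ δ : F) {ε : F} (hε : ε = 0 ∨ ε = 1) :
    HasNormalForm ![!![0, -δ, 0; 1, τ, 0; 0, 0, ε], !![1, 0, 0; 0, 1, 0; 0, 0, 0]] := by
  rcases hquad (-τ) δ with ⟨l, hl⟩ | ⟨hirr, u, s, hs, hb, hc⟩
  · obtain ⟨m, rfl⟩ : ∃ m, τ = l + m := ⟨τ - l, by ring⟩
    obtain rfl : δ = l * m := by linear_combination hl
    by_cases hlm : l = m
    · subst hlm
      have h : HRel ![!![0, -(l * l), 0; 1, l + l, 0; 0, 0, ε], !![1, 0, 0; 0, 1, 0; 0, 0, 0]]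
          ![!![0, 1, 0; 1, 0, 0; 0, 0, 0], !![1, 0, 0; 0, 0, 0; 0, 0, ε]] := by
        refine hRel_pencil 0 1 1 (-l) !![0, 1, 0; 1, l, 0; 0, 0, 1] !![1, -l, 0; 0, 1, 0; 0, 0, 1]
          (by simp) (by simp [Matrix.det_fin_three]) (by simp [Matrix.det_fin_three]) ?_ ?_
        · ext i j
          fin_cases i <;> fin_cases j <;> simp
        · ext i j
          fin_cases i <;> fin_cases j <;> simp
      rcases hε with rfl | rfl
      · exact hasNormalForm_of_eq nilTwo (by decide) h
      · exact hasNormalForm_of_eq doubleRoot (by decide) h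
    · have hk : l - m ≠ 0 := sub_ne_zero.2 hlm
      have h : HRel ![!![0, -(l * m), 0; 1, l + m, 0; 0, 0, ε], !![1, 0, 0; 0, 1, 0; 0, 0, 0]]
          ![!![1, 0, 0; 0, 0, 0; 0, 0, ε], !![0, 0, 0; 0, 1, 0; 0, 0, ε]] := by
        -- On the block, A - mB and A - lB each have rank one. The columns of the right matrix are
        -- eigenvectors for l and m; the left matrix is its inverse with rows rescaled by 1 / (l -
        -- m) and 1 / (m - l).
        refine hRel_pencil 1 (-m) 1 (-l)
          !![1 / (l - m) ^ 2, l / (l - m) ^ 2, 0; 1 / (l - m) ^ 2, m / (l - m) ^ 2, 0; 0, 0, 1]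
          !![-m, -l, 0; 1, 1, 0; 0, 0, 1] ?_ ?_ ?_ ?_ ?_
        · intro hh
          exact hk (by linear_combination -hh)
        · simp only [Matrix.det_fin_three, Matrix.of_apply, Matrix.cons_val]
          field_simp
          simp
          exact ⟨fun hh => hk (by linear_combination -hh), hk⟩
        · simp only [Matrix.det_fin_three, Matrix.of_apply, Matrix.cons_val]
          intro hh
          exact hk (by linear_combination hh)
        · ext i j
          fin_cases i <;> fin_cases j <;> simp <;> field_simp <;> ring
        · ext i j
          fin_cases i <;> fin_cases j <;> simp <;> field_simp <;> ring
      rcases hε with rfl | rfl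
      · exact hasNormalForm_of_eq diagTwo (by decide) h
      · exact hasNormalForm_of_eq diagThree (by decide) h
  · obtain rfl : τ = -(2 * u) := by linear_combination -hb
    subst hc
    have h : HRel ![!![0, -(u ^ 2 + s ^ 2), 0; 1, -(2 * u), 0; 0, 0, ε],
          !![1, 0, 0; 0, 1, 0; 0, 0, 0]]
        ![!![1, 0, 0; 0, -1, 0; 0, 0, ε], !![0, -1, 0; -1, 0, 0; 0, 0, 0]] := by
      -- Completing the square: on the block (A + uB) / s squares to -1, and the matrices turn the
      -- pair into the rotation form. The entry -s undoes the factor -1 / s on ε.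
      refine hRel_pencil (-1 / s) (-u / s) 0 1 !![0, -1, 0; -1 / s, u / s, 0; 0, 0, -s]
        !![s, u, 0; 0, 1, 0; 0, 0, 1] (by simpa using hs) (by simpa [Matrix.det_fin_three] using hs)
        (by simpa [Matrix.det_fin_three] using hs) ?_ ?_
      · ext i j
        fin_cases i <;> fin_cases j <;> simp [hs] <;> field_simp <;> ring
      · ext i j
        fin_cases i <;> fin_cases j <;> simp [hs] <;> field_simp <;> ring
    rcases hε with rfl | rfl
    · exact ⟨rotTwo, fun _ => hirr, h⟩
    · exact ⟨rotThree, fun _ => hirr, h⟩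

/-- A non-scalar 2 × 2 block has a cyclic vector (p, r), with image (q, s) independent of it, so it
is conjugate to its companion matrix. Among e₁, e₂ and e₁ + e₂ one is cyclic, as the cases at the
end show. A scalar block is removed by subtracting a multiple of the second member. -/
theorem hasNormalForm_block
    (hquad : ∀ b c : F, (∃ x, x ^ 2 + b * x + c = 0) ∨
      ((∀ x : F, x ^ 2 + 1 ≠ 0) ∧ ∃ u s : F, s ≠ 0 ∧ b = 2 * u ∧ c = u ^ 2 + s ^ 2))
    (a b c d : F) {ε : F} (hε : ε = 0 ∨ ε = 1) :
    HasNormalForm ![!![a, b, 0; c, d, 0; 0, 0, ε], !![1, 0, 0; 0, 1, 0; 0, 0, 0]] := by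
  have key : ∀ p q r s : F, p * s - q * r ≠ 0 → a * p + b * r = q → c * p + d * r = s →
      HasNormalForm ![!![a, b, 0; c, d, 0; 0, 0, ε], !![1, 0, 0; 0, 1, 0; 0, 0, 0]] := by
    rintro p _ r _ h rfl rfl
    refine (hasNormalForm_companion hquad (a + d) (a * d - b * c) hε).of_hRel ?_
    set k := p * (c * p + d * r) - (a * p + b * r) * r with hk
    refine hRel_pencil 1 0 0 1
      !![(c * p + d * r) / k, -(a * p + b * r) / k, 0; -r / k, p / k, 0; 0, 0, 1]
      !![p, a * p + b * r, 0; r, c * p + d * r, 0; 0, 0, 1] (by simp) ?_ ?_ ?_ ?_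
    · simp only [Matrix.det_fin_three, Matrix.of_apply, Matrix.cons_val]
      have : (c * p + d * r) / k * (p / k) * 1 - (c * p + d * r) / k * 0 * 0
          - -(a * p + b * r) / k * (-r / k) * 1 + -(a * p + b * r) / k * 0 * 0
          + 0 * (-r / k) * 0 - 0 * (p / k) * 0 = 1 / k := by
        field_simp
        rw [hk]
        ring
      rw [this]
      exact one_div_ne_zero h
    · simp only [Matrix.det_fin_three, Matrix.of_apply, Matrix.cons_val]
      intro hh
      exact h (by linear_combination hh)
    · ext i j
      fin_cases i <;> fin_cases j <;> simp <;> field_simp <;> ring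
    · ext i j
      fin_cases i <;> fin_cases j <;> simp <;> field_simp <;> ring
  by_cases hc : c = 0
  · by_cases hb : b = 0
    · by_cases had : a = d
      · subst hb hc had
        have h : HRel ![!![a, 0, 0; 0, a, 0; 0, 0, ε], !![1, 0, 0; 0, 1, 0; 0, 0, 0]]
            ![!![1, 0, 0; 0, 1, 0; 0, 0, 0], !![0, 0, 0; 0, 0, 0; 0, 0, ε]] := by
          refine hRel_pencil 0 1 1 (-a) 1 1 (by simp) (by simp) (by simp) ?_ ?_
          · ext i j
            fin_cases i <;> fin_cases j <;> simp
          · ext i j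
            fin_cases i <;> fin_cases j <;> simp
        rcases hε with rfl | rfl
        · refine hasNormalForm_of_eq rankTwo (by decide) (h.trans ?_)
          rw [show (!![0, 0, 0; 0, 0, 0; 0, 0, 0] : Matrix (Fin 3) (Fin 3) F) = 0 by
            ext i j
            fin_cases i <;> fin_cases j <;> rfl]
          exact HRel.refl _
        · exact hasNormalForm_of_eq repeatedDiag (by decide) h
      · subst hb hc
        exact key 1 a 1 d (fun h => had (by linear_combination -h)) (by ring) (by ring)
    · subst hc
      exact key 0 b 1 d (fun h => hb (by linear_combination -h)) (by ring) (by ring)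
  · exact key 1 a 0 c (by simpa using hc) (by ring) (by ring)

/-- The pivot in the last column clears the first row once d has been shifted away; only whether c
vanishes matters. -/
theorem hasNormalForm_rankTwo_of_row (a b c d : F) :
    HasNormalForm ![!![a, b, 1; c, d, 0; 0, 0, 0], !![1, 0, 0; 0, 1, 0; 0, 0, 0]] := by
  have h1 : HRel ![!![a, b, 1; c, d, 0; 0, 0, 0], !![1, 0, 0; 0, 1, 0; 0, 0, 0]]
      ![!![0, 0, 1; c, 0, 0; 0, 0, 0], !![1, 0, 0; 0, 1, 0; 0, 0, 0]] := by
    refine hRel_pencil 1 (-d) 0 1 1 !![1, 0, 0; 0, 1, 0; d - a, -b, 1] (by simp) (by simp)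
      (by simp [Matrix.det_fin_three]) ?_ ?_
    · ext i j
      fin_cases i <;> fin_cases j <;> simp
      ring
    · ext i j
      fin_cases i <;> fin_cases j <;> simp
  refine HasNormalForm.of_hRel ?_ h1
  by_cases hc : c = 0
  · subst hc
    refine hasNormalForm_of_eq rowSplit (by decide) (hRel_pencil 0 1 1 0 1
      !![1, 0, 0; 0, 0, 1; 0, 1, 0] (by simp) (by simp) (by simp [Matrix.det_fin_three]) ?_ ?_)
    · ext i j
      fin_cases i <;> fin_cases j <;> simp
    · ext i j
      fin_cases i <;> fin_cases j <;> simp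
  · refine hasNormalForm_of_eq rowChain (by decide) (hRel_pencil 1 0 0 1
      !![1, 0, 0; 0, c⁻¹, 0; 0, 0, 1] !![0, 1, 0; 0, 0, c; 1, 0, 0] (by simp)
      (by simpa [Matrix.det_fin_three] using hc) (by simpa [Matrix.det_fin_three] using hc) ?_ ?_)
    · ext i j
      fin_cases i <;> fin_cases j <;> simp [hc]
    · ext i j
      fin_cases i <;> fin_cases j <;> simp [hc]

/-- The border row pairs to 1 with the border column. Both pivots then clear the block up to one
diagonal entry, d - c v, which is subtracted as a multiple of the second member. -/
theorem hasNormalForm_rankTwo_of_corner (a b c d v : F) :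
    HasNormalForm ![!![a, b, 1; c, d, 0; 1, v, 0], !![1, 0, 0; 0, 1, 0; 0, 0, 0]] := by
  have h1 : HRel ![!![a, b, 1; c, d, 0; 1, v, 0], !![1, 0, 0; 0, 1, 0; 0, 0, 0]]
      ![!![0, 0, 1; 0, 0, 0; 1, 0, 0], !![1, 0, 0; 0, 1, 0; 0, 0, 0]] := by
    refine hRel_pencil 1 (-(d - c * v)) 0 1 !![1, v, -(a + v * c) + (d - c * v); 0, 1, -c; 0, 0, 1]
      !![1, -v, 0; 0, 1, 0; 0, -(b + v * d) + (a + v * c) * v , 1] (by simp)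
      (by simp [Matrix.det_fin_three]) (by simp [Matrix.det_fin_three]) ?_ ?_
    · ext i j
      fin_cases i <;> fin_cases j <;> simp <;> ring
    · ext i j
      fin_cases i <;> fin_cases j <;> simp
  refine hasNormalForm_of_eq doubleRoot (by decide) (h1.trans (hRel_pencil 1 0 0 1
    !![1, 0, 0; 0, 0, 1; 0, 1, 0] !![1, 0, 0; 0, 0, 1; 0, 1, 0] (by simp)
    (by simp [Matrix.det_fin_three]) (by simp [Matrix.det_fin_three]) ?_ ?_))
  · ext i j
    fin_cases i <;> fin_cases j <;> simp
  · ext i j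
    fin_cases i <;> fin_cases j <;> simp

/-- The border row and column pair to zero. After clearing, the determinant of xA + yB is c x³, so c
decides between an identically singular pencil and a triple root. -/
theorem hasNormalForm_rankTwo_of_isotropic (a b c d : F) :
    HasNormalForm ![!![a, b, 1; c, d, 0; 0, 1, 0], !![1, 0, 0; 0, 1, 0; 0, 0, 0]] := by
  have h1 : HRel ![!![a, b, 1; c, d, 0; 0, 1, 0], !![1, 0, 0; 0, 1, 0; 0, 0, 0]]
      ![!![0, 0, 1; c, 0, 0; 0, 1, 0], !![1, 0, 0; 0, 1, 0; 0, 0, 0]] := by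
    refine hRel_pencil 1 0 0 1 !![1, 0, 0; 0, 1, -d; 0, 0, 1] !![1, 0, 0; 0, 1, 0; -a, -b, 1]
      (by simp) (by simp [Matrix.det_fin_three]) (by simp [Matrix.det_fin_three]) ?_ ?_
    · ext i j
      fin_cases i <;> fin_cases j <;> simp
    · ext i j
      fin_cases i <;> fin_cases j <;> simp
  refine HasNormalForm.of_hRel ?_ h1
  by_cases hc : c = 0
  · subst hc
    refine hasNormalForm_of_eq singular (by decide) (hRel_pencil 1 0 0 1
      !![0, 0, 1; 0, 1, 0; 1, 0, 0] !![0, 1, 0; 0, 0, 1; 1, 0, 0] (by simp)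
      (by simp [Matrix.det_fin_three]) (by simp [Matrix.det_fin_three]) ?_ ?_)
    · ext i j
      fin_cases i <;> fin_cases j <;> simp
    · ext i j
      fin_cases i <;> fin_cases j <;> simp
  · refine hasNormalForm_of_eq nilThree (by decide) (hRel_pencil 0 1 1 0
      !![1, 0, 0; 0, c⁻¹, 0; 0, 0, c⁻¹] !![0, 1, 0; c, 0, 0; 0, 0, 1] (by simp)
      (by simpa [Matrix.det_fin_three] using hc) (by simpa [Matrix.det_fin_three] using hc) ?_ ?_)
    · ext i j
      fin_cases i <;> fin_cases j <;> simp [hc]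
    · ext i j
      fin_cases i <;> fin_cases j <;> simp [hc]

end Completeness

open PencilClass

/-! ### Existence of a normal form for every pencil -/

section Completeness

variable {F : Type*} [Field F]

/-- The stabiliser of `diag(1, 1, 0)` acts on the top left block by conjugation. -/
theorem hRel_conj (a b c d u₁ u₂ v₁ v₂ p q r s w : F) (hd : p * s - q * r ≠ 0) (hw : w ≠ 0) :
    ∃ a' b' c' d' : F,
      HRel ![!![a, b, u₁; c, d, u₂; v₁, v₂, 0], !![1, 0, 0; 0, 1, 0; 0, 0, 0]]
        ![!![a', b', p * u₁ + q * u₂; c', d', r * u₁ + s * u₂;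
          w * (v₁ * s - v₂ * r), w * (v₂ * p - v₁ * q), 0], !![1, 0, 0; 0, 1, 0; 0, 0, 0]] := by
  set k := p * s - q * r with hk
  refine ⟨(p * a + q * c) * (s / k) + (p * b + q * d) * (-r / k),
    (p * a + q * c) * (-q / k) + (p * b + q * d) * (p / k),
    (r * a + s * c) * (s / k) + (r * b + s * d) * (-r / k),
    (r * a + s * c) * (-q / k) + (r * b + s * d) * (p / k),
    hRel_pencil 1 0 0 1 !![p, q, 0; r, s, 0; 0, 0, w * k]
      !![s / k, -q / k, 0; -r / k, p / k, 0; 0, 0, 1] (by simp) ?_ ?_ ?_ ?_⟩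
  · simp only [Matrix.det_fin_three, Matrix.of_apply, Matrix.cons_val]
    intro hh
    exact mul_ne_zero (mul_ne_zero hw hd) hd (by rw [← hh, hk]; ring)
  · simp only [Matrix.det_fin_three, Matrix.of_apply, Matrix.cons_val]
    have : s / k * (p / k) * 1 - s / k * 0 * 0 - -q / k * (-r / k) * 1 + -q / k * 0 * 0
        + 0 * (-r / k) * 0 - 0 * (p / k) * 0 = 1 / k := by
      field_simp
      rw [hk]
      ring
    rw [this]
    exact one_div_ne_zero hd
  · ext i j
    fin_cases i <;> fin_cases j <;> simp <;> field_simp <;> ring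
  · ext i j
    fin_cases i <;> fin_cases j <;> simp <;> field_simp <;> rw [hk] <;> ring

variable (hquad : ∀ b c : F, (∃ x, x ^ 2 + b * x + c = 0) ∨
  ((∀ x : F, x ^ 2 + 1 ≠ 0) ∧ ∃ u s : F, s ≠ 0 ∧ b = 2 * u ∧ c = u ^ 2 + s ^ 2))

include hquad

theorem hasNormalForm_rankTwo_of_last_row (a b c d u₁ u₂ : F) :
    HasNormalForm ![!![a, b, u₁; c, d, u₂; 0, 0, 0], !![1, 0, 0; 0, 1, 0; 0, 0, 0]] := by
  obtain ⟨p, q, r, s, hd, h0, h⟩ := exists_normalize_vector u₁ u₂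
  obtain ⟨a', b', c', d', hr⟩ := hRel_conj a b c d u₁ u₂ 0 0 p q r s 1 hd one_ne_zero
  refine HasNormalForm.of_hRel ?_ hr
  simp only [zero_mul, sub_self, mul_zero]
  rcases h with h | h <;> rw [h0, h]
  · exact hasNormalForm_block hquad a' b' c' d' (Or.inl rfl)
  · exact hasNormalForm_rankTwo_of_row a' b' c' d'

theorem hasNormalForm_rankTwo_of_last_col (a b c d v₁ v₂ : F) :
    HasNormalForm ![!![a, b, 0; c, d, 0; v₁, v₂, 0], !![1, 0, 0; 0, 1, 0; 0, 0, 0]] := by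
  have h := (hasNormalForm_rankTwo_of_last_row hquad a c b d v₁ v₂).transpose
  convert h using 1
  funext i
  ext j k
  fin_cases i <;> fin_cases j <;> fin_cases k <;> rfl

/-- A nonzero corner e splits off as a direct summand by a Schur complement. If e = 0, conjugation
makes the border column u equal to 0 or e₁; it preserves the pairing of the border row v with u up
to the free scale w of the last row, so whether v is zero, isotropic or non-isotropic against u
determines the case. -/
theorem hasNormalForm_rankTwo (a b c d u₁ u₂ v₁ v₂ e : F) :
    HasNormalForm ![!![a, b, u₁; c, d, u₂; v₁, v₂, e], !![1, 0, 0; 0, 1, 0; 0, 0, 0]] := by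
  by_cases he : e = 0
  · subst he
    obtain ⟨p, q, r, s, hd, h0, h⟩ := exists_normalize_vector u₁ u₂
    rcases h with h | h
    · obtain ⟨a', b', c', d', hr⟩ := hRel_conj a b c d u₁ u₂ v₁ v₂ p q r s 1 hd one_ne_zero
      refine HasNormalForm.of_hRel ?_ hr
      rw [h0, h]
      exact hasNormalForm_rankTwo_of_last_col hquad _ _ _ _ _ _
    · by_cases h1 : v₁ * s - v₂ * r = 0
      · by_cases h2 : v₂ * p - v₁ * q = 0
        · obtain ⟨a', b', c', d', hr⟩ := hRel_conj a b c d u₁ u₂ v₁ v₂ p q r s 1 hd one_ne_zero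
          refine HasNormalForm.of_hRel ?_ hr
          rw [h1, h2, mul_zero]
          exact hasNormalForm_rankTwo_of_last_row hquad _ _ _ _ _ _
        · obtain ⟨a', b', c', d', hr⟩ := hRel_conj a b c d u₁ u₂ v₁ v₂ p q r s
            (v₂ * p - v₁ * q)⁻¹ hd (inv_ne_zero h2)
          refine HasNormalForm.of_hRel ?_ hr
          rw [h1, h, h0, inv_mul_cancel₀ h2, mul_zero]
          exact hasNormalForm_rankTwo_of_isotropic _ _ _ _
      · obtain ⟨a', b', c', d', hr⟩ := hRel_conj a b c d u₁ u₂ v₁ v₂ p q r s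
          (v₁ * s - v₂ * r)⁻¹ hd (inv_ne_zero h1)
        refine HasNormalForm.of_hRel ?_ hr
        rw [h, h0, inv_mul_cancel₀ h1]
        exact hasNormalForm_rankTwo_of_corner _ _ _ _ _
  · refine (hasNormalForm_block hquad (a - u₁ / e * v₁) (b - u₁ / e * v₂) (c - u₂ / e * v₁)
      (d - u₂ / e * v₂) (Or.inr rfl)).of_hRel (hRel_pencil 1 0 0 1
      !![1, 0, -u₁ / e; 0, 1, -u₂ / e; 0, 0, 1 / e] !![1, 0, 0; 0, 1, 0; -v₁ / e, -v₂ / e, 1]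
      (by simp) (by simpa [Matrix.det_fin_three] using he) (by simp [Matrix.det_fin_three]) ?_ ?_)
    · ext i j
      fin_cases i <;> fin_cases j <;> simp [he] <;> field_simp <;> ring
    · ext i j
      fin_cases i <;> fin_cases j <;> simp

/-- Every pencil of `3 × 3` matrices is equivalent to a normal form, provided that cubics have roots
and irreducible quadratics are similar to `x ^ 2 + 1`. -/
theorem hasNormalForm (hcubic : ∀ b c d : F, ∃ x, x ^ 3 + b * x ^ 2 + c * x + d = 0)
    (t : Tens (Fin 2) (Fin 3) (Fin 3) F) : HasNormalForm t := by
  have main : ∀ A B : Matrix (Fin 3) (Fin 3) F, B.det = 0 → HasNormalForm ![A, B] := by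
    intro A B hB
    obtain ⟨P, Q, hP, hQ, h⟩ := exists_rankForm B
    have key : ∀ N, P * B * Q = N → HRel ![A, B] ![P * A * Q, N] := fun N hN =>
      hRel_pencil 1 0 0 1 P Q (by simp) hP hQ (by simp) (by simpa using hN)
    rcases h with h | h | h | h
    · exact (hasNormalForm_of_right_zero _).of_hRel (key _ h)
    · refine HasNormalForm.of_hRel ?_ (key _ h)
      rw [Matrix.eta_fin_three (P * A * Q)]
      exact hasNormalForm_rankOne _ _ _ _ _ _ _ _ _
    · refine HasNormalForm.of_hRel ?_ (key _ h)
      rw [Matrix.eta_fin_three (P * A * Q)]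
      exact hasNormalForm_rankTwo hquad _ _ _ _ _ _ _ _ _
    · have := congrArg Matrix.det h
      simp [hB] at this
  obtain ⟨A, B, rfl⟩ : ∃ A B, t = ![A, B] := ⟨t 0, t 1, by
    funext i
    fin_cases i <;> rfl⟩
  by_cases hB : B.det = 0
  · exact main A B hB
  -- For invertible B the determinant of A + xB is a cubic in x with leading coefficient det B. A
  -- root gives a singular member, which then takes the second place.
  · obtain ⟨x, hx⟩ := hcubic ((B.adjugate * A).trace / B.det) ((A.adjugate * B).trace / B.det)
      (A.det / B.det)
    have hdet : (A + x • B).det = B.det * (x ^ 3 + (B.adjugate * A).trace / B.det * x ^ 2 +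
        (A.adjugate * B).trace / B.det * x + A.det / B.det) := by
      field_simp
      simp only [Matrix.det_fin_three, Matrix.adjugate_fin_three, Matrix.trace_fin_three,
        Matrix.mul_apply, Fin.sum_univ_three, Matrix.add_apply, Matrix.smul_apply, smul_eq_mul,
        Matrix.of_apply, Matrix.cons_val]
      ring
    rw [hx, mul_zero] at hdet
    exact (main B (A + x • B) hdet).of_hRel
      (hRel_pencil 0 1 1 x 1 1 (by simp) (by simp) (by simp) (by simp) (by simp))

end Completeness

/-! ### Tensors as spaces of slices -/

section Slices

variable {F I J K : Type*} [Field F] [Fintype I] [Fintype J] [Fintype K]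
  [DecidableEq I] [DecidableEq J] [DecidableEq K]

/-- The contraction of a coordinate array with a vector of the third factor. -/
def sliceMap (t : Tens I J K F) : (K → F) →ₗ[F] Matrix I J F where
  toFun c := Matrix.of fun i => (t i).mulVec c
  map_add' x y := by
    ext i j
    simp [Matrix.mulVec_add]
  map_smul' x y := by
    ext i j
    simp [Matrix.mulVec_smul]

theorem sliceMap_apply (t : Tens I J K F) (c : K → F) (i : I) (j : J) :
    sliceMap t c i j = (t i).mulVec c j := rfl

/-- The space spanned by the slices of a coordinate array. -/
def sliceSpan (t : Tens I J K F) : Submodule F (Matrix I J F) := LinearMap.range (sliceMap t)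

/-- The action of two invertible matrices on matrices. -/
def matAct (M : GL I F) (P : GL J F) : Matrix I J F ≃ₗ[F] Matrix I J F where
  toFun X := M.1 * X * P.1.transpose
  invFun X := M⁻¹.1 * X * P⁻¹.1.transpose
  map_add' X Y := by rw [Matrix.mul_add, Matrix.add_mul]
  map_smul' c X := by simp
  left_inv X := by
    have h1 : M⁻¹.1 * M.1 = 1 := M.inv_mul
    have h2 : P⁻¹.1 * P.1 = 1 := P.inv_mul
    beta_reduce
    rw [Matrix.mul_assoc, Matrix.mul_assoc, Matrix.mul_assoc, ← Matrix.transpose_mul, h2,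
      Matrix.transpose_one, Matrix.mul_one, ← Matrix.mul_assoc, h1, Matrix.one_mul]
  right_inv X := by
    have h1 : M.1 * M⁻¹.1 = 1 := M.mul_inv
    have h2 : P.1 * P⁻¹.1 = 1 := P.mul_inv
    beta_reduce
    rw [Matrix.mul_assoc, Matrix.mul_assoc, Matrix.mul_assoc, ← Matrix.transpose_mul, h2,
      Matrix.transpose_one, Matrix.mul_one, ← Matrix.mul_assoc, h1, Matrix.one_mul]

theorem matAct_apply (M : GL I F) (P : GL J F) (X : Matrix I J F) :
    matAct M P X = M.1 * X * P.1.transpose := rfl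

theorem sliceMap_tensAct (M : GL I F) (P : GL J F) (Q : GL K F) (t : Tens I J K F) (c : K → F) :
    sliceMap (tensAct M.1 P.1 Q.1 t) c = matAct M P (sliceMap t (Q.1.transpose.mulVec c)) := by
  ext i j
  rw [sliceMap_apply, tensAct_apply, Matrix.sum_mulVec, Finset.sum_apply, matAct_apply,
    Matrix.mul_assoc, Matrix.mul_apply]
  refine Finset.sum_congr rfl fun x _ => ?_
  rw [Matrix.smul_mulVec, Pi.smul_apply, smul_eq_mul, ← Matrix.mulVec_mulVec,
    ← Matrix.mulVec_mulVec]
  congr 1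
  simp only [Matrix.mulVec, dotProduct, Matrix.mul_apply, Matrix.transpose_apply, sliceMap_apply]
  exact Finset.sum_congr rfl fun y _ => mul_comm _ _

theorem sliceSpan_tensAct (M : GL I F) (P : GL J F) (Q : GL K F) (t : Tens I J K F) :
    sliceSpan (tensAct M.1 P.1 Q.1 t) = (sliceSpan t).map (matAct M P).toLinearMap := by
  ext X
  constructor
  · rintro ⟨c, rfl⟩
    exact ⟨_, ⟨_, rfl⟩, (sliceMap_tensAct M P Q t c).symm⟩
  · rintro ⟨_, ⟨c, rfl⟩, rfl⟩
    refine ⟨Q⁻¹.1.transpose.mulVec c, ?_⟩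
    have h : Q⁻¹.1 * Q.1 = 1 := Q.inv_mul
    rw [sliceMap_tensAct, Matrix.mulVec_mulVec, ← Matrix.transpose_mul, h, Matrix.transpose_one,
      Matrix.one_mulVec]
    rfl

/-- Two linear maps with the same range differ by an automorphism of the source. -/
theorem exists_equiv_of_range_eq {V W : Type*} [AddCommGroup V] [Module F V]
    [FiniteDimensional F V] [AddCommGroup W] [Module F W] (f g : V →ₗ[F] W)
    (h : LinearMap.range f = LinearMap.range g) : ∃ e : V ≃ₗ[F] V, ∀ v, f (e v) = g v := by
  obtain ⟨C, hC⟩ := Submodule.exists_isCompl (LinearMap.ker f)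
  obtain ⟨D, hD⟩ := Submodule.exists_isCompl (LinearMap.ker g)
  have hk : Module.finrank F (LinearMap.ker f) = Module.finrank F (LinearMap.ker g) := by
    have h1 := f.finrank_range_add_finrank_ker
    have h2 := g.finrank_range_add_finrank_ker
    rw [h] at h1
    omega
  let ek : LinearMap.ker g ≃ₗ[F] LinearMap.ker f := LinearEquiv.ofFinrankEq _ _ hk.symm
  let ec : D ≃ₗ[F] C :=
    ((LinearMap.kerComplementEquivRange g hD.symm).trans (LinearEquiv.ofEq _ _ h.symm)).trans
      (LinearMap.kerComplementEquivRange f hC.symm).symm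
  refine ⟨((Submodule.prodEquivOfIsCompl _ _ hD).symm.trans (ek.prodCongr ec)).trans
    (Submodule.prodEquivOfIsCompl _ _ hC), fun v => ?_⟩
  obtain ⟨⟨k, d⟩, rfl⟩ := (Submodule.prodEquivOfIsCompl _ _ hD).surjective v
  have hd : f (ec d) = g d := by
    have h1 : LinearMap.kerComplementEquivRange f hC.symm (ec d) =
        LinearEquiv.ofEq _ _ h.symm (LinearMap.kerComplementEquivRange g hD.symm d) :=
      LinearEquiv.apply_symm_apply _ _
    exact congrArg Subtype.val h1
  simp [hd]

theorem sliceMap_injective : Function.Injective (sliceMap : Tens I J K F → _) := by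
  intro s t h
  funext i j k
  have := congrFun (congrFun (LinearMap.congr_fun h (Pi.single k 1)) i) j
  simpa [sliceMap_apply] using this

/-- The third matrix only precomposes the contraction map with an automorphism, and two maps out of
the same space with equal range always differ by such an automorphism. -/
theorem hRel_iff_sliceSpan (s t : Tens I J K F) :
    HRel s t ↔ ∃ (M : GL I F) (P : GL J F),
      (sliceSpan s).map (matAct M P).toLinearMap = sliceSpan t := by
  constructor
  · rintro ⟨M, P, Q, rfl⟩
    exact ⟨M, P, (sliceSpan_tensAct M P Q s).symm⟩
  · rintro ⟨M, P, h⟩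
    have hr : LinearMap.range (sliceMap (tensAct M.1 P.1 (1 : GL K F).1 s)) =
        LinearMap.range (sliceMap t) := (sliceSpan_tensAct M P 1 s).trans h
    obtain ⟨e, he⟩ := exists_equiv_of_range_eq _ _ hr
    obtain ⟨Q, hQ⟩ := exists_gl_mulVec_eq (A := e.toLinearMap) e.injective
    have hdet : Q.1.transpose.det ≠ 0 := by
      rw [Matrix.det_transpose]
      exact (Q.1.isUnit_iff_isUnit_det.1 Q.isUnit).ne_zero
    refine ⟨M, P, Matrix.GeneralLinearGroup.mkOfDetNeZero _ hdet, sliceMap_injective ?_⟩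
    refine LinearMap.ext fun c => ?_
    rw [← he, sliceMap_tensAct, sliceMap_tensAct]
    have h1 : (Matrix.GeneralLinearGroup.mkOfDetNeZero _ hdet).1.transpose = Q.1 :=
      Matrix.transpose_transpose _
    rw [h1, hQ, Units.val_one, Matrix.transpose_one, Matrix.one_mulVec]
    rfl

/-- The dimension bound gives a linear surjection from K → F onto W; the images of the basis vectors
are the slices. -/
theorem exists_sliceSpan_eq (W : Submodule F (Matrix I J F))
    (hW : Module.finrank F W ≤ Fintype.card K) : ∃ t : Tens I J K F, sliceSpan t = W := by
  obtain ⟨e⟩ := Function.Embedding.nonempty_of_card_le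
    (show Fintype.card (Fin (Module.finrank F W)) ≤ Fintype.card K by simpa using hW)
  obtain ⟨ρ, hρ⟩ : ∃ ρ : (K → F) →ₗ[F] W, Function.Surjective ρ :=
    ⟨(Module.finBasis F W).equivFun.symm.toLinearMap ∘ₗ LinearMap.funLeft F F e,
      (Module.finBasis F W).equivFun.symm.surjective.comp
        (LinearMap.funLeft_surjective_of_injective F F _ e.injective)⟩
  obtain ⟨t, ht⟩ : ∃ t : Tens I J K F, ∀ i j k, t i j k = (ρ (Pi.single k 1)).1 i j :=
    ⟨fun i j k => (ρ (Pi.single k 1)).1 i j, fun _ _ _ => rfl⟩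
  have h : sliceMap t = W.subtype ∘ₗ ρ := by
    refine LinearMap.pi_ext' fun k => LinearMap.ext_ring ?_
    ext i j
    simp [sliceMap_apply, ht]
  refine ⟨t, ?_⟩
  rw [sliceSpan, h, LinearMap.range_comp, LinearMap.range_eq_top.2 hρ, Submodule.map_top,
    Submodule.range_subtype]

/-- The dimension of the span of the slices. -/
noncomputable def sliceRank (t : Tens I J K F) : ℕ := Module.finrank F (sliceSpan t)

theorem HRel.sliceRank_eq {s t : Tens I J K F} (h : HRel s t) : sliceRank s = sliceRank t := by
  obtain ⟨M, P, Q, rfl⟩ := h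
  rw [sliceRank, sliceRank, sliceSpan_tensAct]
  exact (LinearEquiv.finrank_map_eq (matAct M P) _).symm

theorem sliceRank_eq_card (t : Tens I J K F) (s : Finset K)
    (h : ∀ c : K → F, (∀ i, (t i).mulVec c = 0) ↔ ∀ k ∈ s, c k = 0) : sliceRank t = s.card := by
  have h1 := (sliceMap t).finrank_range_add_finrank_ker
  let ρ : (K → F) →ₗ[F] (s → F) := LinearMap.funLeft F F Subtype.val
  have h2 := ρ.finrank_range_add_finrank_ker
  have hρ : Function.Surjective ρ :=
    LinearMap.funLeft_surjective_of_injective F F _ Subtype.val_injective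
  rw [LinearMap.range_eq_top.2 hρ, finrank_top, Module.finrank_fintype_fun_eq_card,
    Fintype.card_coe] at h2
  have hker : LinearMap.ker (sliceMap t) = LinearMap.ker ρ := by
    ext c
    have e1 : sliceMap t c = 0 ↔ ∀ i, (t i).mulVec c = 0 := by
      rw [← Matrix.ext_iff]
      simp [sliceMap_apply, funext_iff]
    have e2 : ρ c = 0 ↔ ∀ k ∈ s, c k = 0 := by
      simp [ρ, funext_iff, LinearMap.funLeft_apply]
    rw [LinearMap.mem_ker, LinearMap.mem_ker, e1, e2, h]
  rw [hker] at h1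
  rw [sliceRank, sliceSpan]
  omega

end Slices

open PencilClass

/-! ### Invariants separating the normal forms -/

section Invariants

variable {F : Type*} [Field F]

/-- The member of a pencil with given coefficients. -/
def pencilEval (t : Tens (Fin 2) (Fin 3) (Fin 3) F) (p : Fin 2 → F) : Matrix (Fin 3) (Fin 3) F :=
  p 0 • t 0 + p 1 • t 1

/-- Coefficients transform contragrediently, by the inverse transpose of M. This makes every
property of members that is stable under P · Q an invariant of the orbit. -/
theorem HRel.exists_pencilEval {s t : Tens (Fin 2) (Fin 3) (Fin 3) F} (h : HRel s t) :
    ∃ (L : (Fin 2 → F) ≃ₗ[F] (Fin 2 → F)) (P Q : Matrix (Fin 3) (Fin 3) F), P.det ≠ 0 ∧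
      Q.det ≠ 0 ∧ ∀ p, pencilEval t (L p) = P * pencilEval s p * Q := by
  obtain ⟨M, P, Q, rfl⟩ := h
  have hdet : M⁻¹.1.transpose.det ≠ 0 := by
    rw [Matrix.det_transpose]
    exact (M⁻¹.1.isUnit_iff_isUnit_det.1 M⁻¹.isUnit).ne_zero
  refine ⟨glEquiv F _ (Matrix.GeneralLinearGroup.mkOfDetNeZero _ hdet), P.1, Q.1.transpose,
    (P.1.isUnit_iff_isUnit_det.1 P.isUnit).ne_zero, ?_, fun p => ?_⟩
  · rw [Matrix.det_transpose]
    exact (Q.1.isUnit_iff_isUnit_det.1 Q.isUnit).ne_zero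
  have hL : glEquiv F _ (Matrix.GeneralLinearGroup.mkOfDetNeZero _ hdet) p =
      Matrix.vecMul p M⁻¹.1 :=
    (glEquiv_apply _ _).trans (Matrix.mulVec_transpose _ _)
  obtain ⟨q, hq⟩ : ∃ q, q = Matrix.vecMul p M⁻¹.1 := ⟨_, rfl⟩
  have hp : p = Matrix.vecMul q M.1 := by
    have : M⁻¹.1 * M.1 = 1 := M.inv_mul
    rw [hq, Matrix.vecMul_vecMul, this, Matrix.vecMul_one]
  rw [hL, ← hq, hp]
  simp only [pencilEval, tensAct_apply, Fin.sum_univ_two, Matrix.vecMul, dotProduct,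
    Matrix.mul_add, Matrix.add_mul, Matrix.mul_smul, Matrix.smul_mul, smul_add, add_smul, smul_smul]
  abel

/-- The pencil contains a zero matrix. -/
def HasZero (t : Tens (Fin 2) (Fin 3) (Fin 3) F) : Prop :=
  ∃ p, p ≠ 0 ∧ pencilEval t p = 0

/-- The pencil contains a matrix of rank at most one. -/
def HasRankOne (t : Tens (Fin 2) (Fin 3) (Fin 3) F) : Prop :=
  ∃ p, p ≠ 0 ∧ ∃ b c, pencilEval t p = Matrix.vecMulVec b c

/-- The pencil contains two independent matrices of rank at most one. -/
def HasTwoRankOne (t : Tens (Fin 2) (Fin 3) (Fin 3) F) : Prop :=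
  ∃ p q, p ≠ 0 ∧ (∀ s : F, q ≠ s • p) ∧ (∃ b c, pencilEval t p = Matrix.vecMulVec b c) ∧
    ∃ b c, pencilEval t q = Matrix.vecMulVec b c

/-- The pencil contains two independent singular matrices. -/
def HasTwoSingular (t : Tens (Fin 2) (Fin 3) (Fin 3) F) : Prop :=
  ∃ p q, p ≠ 0 ∧ (∀ s : F, q ≠ s • p) ∧ (pencilEval t p).det = 0 ∧ (pencilEval t q).det = 0

/-- The pencil contains an invertible matrix. -/
def HasRegular (t : Tens (Fin 2) (Fin 3) (Fin 3) F) : Prop := ∃ p, (pencilEval t p).det ≠ 0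

/-- The determinant has a multiple root on the pencil. -/
def HasMultipleRoot (t : Tens (Fin 2) (Fin 3) (Fin 3) F) : Prop :=
  ∃ p, p ≠ 0 ∧ (pencilEval t p).det = 0 ∧
    ∀ q, ((pencilEval t p).adjugate * pencilEval t q).trace = 0

theorem HRel.hasZero {s t : Tens (Fin 2) (Fin 3) (Fin 3) F} (h : HRel s t) (hs : HasZero s) :
    HasZero t := by
  obtain ⟨L, P, Q, hP, hQ, e⟩ := h.exists_pencilEval
  obtain ⟨p, hp, h⟩ := hs
  exact ⟨L p, by simpa using hp, by rw [e, h, Matrix.mul_zero, Matrix.zero_mul]⟩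

theorem HRel.hasRankOne {s t : Tens (Fin 2) (Fin 3) (Fin 3) F} (h : HRel s t)
    (hs : HasRankOne s) : HasRankOne t := by
  obtain ⟨L, P, Q, hP, hQ, e⟩ := h.exists_pencilEval
  obtain ⟨p, hp, b, c, h⟩ := hs
  exact ⟨L p, by simpa using hp, _, _, by rw [e, h, Matrix.mul_vecMulVec, Matrix.vecMulVec_mul]⟩

theorem HRel.hasTwoRankOne {s t : Tens (Fin 2) (Fin 3) (Fin 3) F} (h : HRel s t)
    (hs : HasTwoRankOne s) : HasTwoRankOne t := by
  obtain ⟨L, P, Q, hP, hQ, e⟩ := h.exists_pencilEval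
  obtain ⟨p, q, hp, hq, ⟨b, c, h⟩, ⟨b', c', h'⟩⟩ := hs
  refine ⟨L p, L q, by simpa using hp, fun s h => hq s (L.injective (by rw [h, map_smul])),
    ⟨_, _, by rw [e, h, Matrix.mul_vecMulVec, Matrix.vecMulVec_mul]⟩,
    ⟨_, _, by rw [e, h', Matrix.mul_vecMulVec, Matrix.vecMulVec_mul]⟩⟩

theorem HRel.hasTwoSingular {s t : Tens (Fin 2) (Fin 3) (Fin 3) F} (h : HRel s t)
    (hs : HasTwoSingular s) : HasTwoSingular t := by
  obtain ⟨L, P, Q, hP, hQ, e⟩ := h.exists_pencilEval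
  obtain ⟨p, q, hp, hq, h, h'⟩ := hs
  refine ⟨L p, L q, by simpa using hp, fun s h => hq s (L.injective (by rw [h, map_smul])),
    by simp [e, h], by simp [e, h']⟩

theorem HRel.hasRegular {s t : Tens (Fin 2) (Fin 3) (Fin 3) F} (h : HRel s t)
    (hs : HasRegular s) : HasRegular t := by
  obtain ⟨L, P, Q, hP, hQ, e⟩ := h.exists_pencilEval
  obtain ⟨p, h⟩ := hs
  exact ⟨L p, by simp [e, h, hP, hQ]⟩

/-- By Jacobi's formula, trace (adj X · Y) is the derivative of the determinant at X in the
direction Y; under X ↦ PXQ, Y ↦ PYQ it is multiplied by det P · det Q. -/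
theorem HRel.hasMultipleRoot {s t : Tens (Fin 2) (Fin 3) (Fin 3) F} (h : HRel s t)
    (hs : HasMultipleRoot s) : HasMultipleRoot t := by
  obtain ⟨L, P, Q, hP, hQ, e⟩ := h.exists_pencilEval
  obtain ⟨p, hp, h, h'⟩ := hs
  refine ⟨L p, by simpa using hp, by simp [e, h], fun q => ?_⟩
  obtain ⟨q, rfl⟩ := L.surjective q
  rw [e, e, Matrix.adjugate_mul_distrib, Matrix.adjugate_mul_distrib]
  have : Q.adjugate * ((pencilEval s p).adjugate * P.adjugate) * (P * pencilEval s q * Q) =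
      P.det • (Q.adjugate * ((pencilEval s p).adjugate * pencilEval s q) * Q) := by
    calc _ = Q.adjugate * (pencilEval s p).adjugate * (P.adjugate * P) * pencilEval s q * Q := by
          simp only [Matrix.mul_assoc]
      _ = _ := by
          rw [Matrix.adjugate_mul]
          simp [Matrix.mul_assoc]
  rw [this, Matrix.trace_smul, Matrix.mul_assoc, Matrix.trace_mul_comm, Matrix.mul_assoc,
    Matrix.mul_adjugate, Matrix.mul_smul, Matrix.mul_one, Matrix.trace_smul, h', smul_zero,
    smul_zero]

theorem vecMulVec_minor {N : Matrix (Fin 3) (Fin 3) F} (h : ∃ b c, N = Matrix.vecMulVec b c)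
    (i i' j j' : Fin 3) : N i j * N i' j' = N i j' * N i' j := by
  obtain ⟨b, c, rfl⟩ := h
  simp only [Matrix.vecMulVec_apply]
  ring

theorem eq_zero_of_coords {p : Fin 2 → F} (h0 : p 0 = 0) (h1 : p 1 = 0) : p = 0 := by
  funext i
  fin_cases i
  exacts [h0, h1]

theorem exists_smul_eq_of_zero {p q : Fin 2 → F} (hp : p ≠ 0) (i j : Fin 2) (hij : i ≠ j)
    (hpi : p i = 0) (hqi : q i = 0) : ∃ s : F, q = s • p := by
  have hpj : p j ≠ 0 := by
    intro h
    apply hp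
    funext k
    fin_cases i <;> fin_cases j <;> fin_cases k <;> simp_all
  refine ⟨q j / p j, ?_⟩
  funext k
  have : k = i ∨ k = j := by
    revert hij
    clear hpi hqi hpj
    revert i j k
    decide
  rcases this with rfl | rfl
  · simp [hpi, hqi]
  · simp [hpj]

theorem eq_zero_of_sq_add_sq (h : ∀ x : F, x ^ 2 + 1 ≠ 0) {x y : F} (hxy : x ^ 2 + y ^ 2 = 0) :
    x = 0 ∧ y = 0 := by
  have hy : y = 0 := by
    by_contra hy
    refine h (x / y) ?_
    field_simp
    simpa using hxy
  subst hy
  exact ⟨by simpa using hxy, rfl⟩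

theorem hasZero_pencilRep {c : PencilClass} (h : c = rankTwo ∨ c = rankThree) :
    HasZero (pencilRep F c) := by
  refine ⟨![0, 1], by simp, ?_⟩
  rcases h with rfl | rfl <;> simp [pencilEval, pencilRep]

theorem not_hasZero_pencilRep {c : PencilClass}
    (h : c ≠ zero ∧ c ≠ rankOne ∧ c ≠ rankTwo ∧ c ≠ rankThree) : ¬ HasZero (pencilRep F c) := by
  rintro ⟨p, hp, h0⟩
  refine hp (eq_zero_of_coords ?_ ?_)
  · cases c <;> simp_all [pencilEval, pencilRep, ← Matrix.ext_iff, Fin.forall_fin_succ]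
  · cases c <;> simp_all [pencilEval, pencilRep, ← Matrix.ext_iff, Fin.forall_fin_succ]

theorem hasRankOne_pencilRep {c : PencilClass}
    (h : c = nilTwo ∨ c = diagTwo ∨ c = rowSplit ∨ c = colSplit ∨ c = repeatedDiag ∨ c = nilSplit) :
    HasRankOne (pencilRep F c) := by
  have key : ∀ i j : Fin 3, pencilRep F c 1 = Matrix.single i j (1 : F) →
      HasRankOne (pencilRep F c) := fun i j e => ⟨![0, 1], by simp, Pi.single i 1, Pi.single j 1, by
    rw [← Matrix.single_eq_single_vecMulVec_single, ← e]
    simp [pencilEval]⟩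
  rcases h with rfl | rfl | rfl | rfl | rfl | rfl
  · refine key 0 0 ?_
    ext i j
    fin_cases i <;> fin_cases j <;> rfl
  · refine key 1 1 ?_
    ext i j
    fin_cases i <;> fin_cases j <;> rfl
  · refine key 0 1 ?_
    ext i j
    fin_cases i <;> fin_cases j <;> rfl
  · refine key 1 0 ?_
    ext i j
    fin_cases i <;> fin_cases j <;> rfl
  · refine key 2 2 ?_
    ext i j
    fin_cases i <;> fin_cases j <;> rfl
  · refine key 0 0 ?_
    ext i j
    fin_cases i <;> fin_cases j <;> rfl

theorem not_hasRankOne_pencilRep {c : PencilClass} (hc : c.Allowed F)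
    (h : c = rotTwo ∨ c = rowChain ∨ c = colChain ∨ c = diagThree ∨ c = doubleRoot ∨ c = nilThree ∨
      c = singular ∨ c = rotThree) : ¬ HasRankOne (pencilRep F c) := by
  rintro ⟨p, hp, h1⟩
  have m := vecMulVec_minor h1
  refine hp ?_
  rcases h with rfl | rfl | rfl | rfl | rfl | rfl | rfl | rfl
  · have h := eq_zero_of_sq_add_sq (hc (Or.inl rfl)) (x := p 0) (y := p 1) (by
      have := m 0 1 0 1
      simp [pencilEval, pencilRep] at this
      linear_combination -this)
    exact eq_zero_of_coords h.1 h.2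
  · refine eq_zero_of_coords ?_ ?_
    · simpa [pencilEval, pencilRep] using m 0 1 0 1
    · simpa [pencilEval, pencilRep] using m 0 1 1 2
  · refine eq_zero_of_coords ?_ ?_
    · simpa [pencilEval, pencilRep] using m 0 1 0 1
    · simpa [pencilEval, pencilRep] using m 1 2 0 1
  · have h1 := m 0 1 0 1
    have h2 := m 0 2 0 2
    have h3 := m 1 2 1 2
    simp only [pencilEval, pencilRep, Matrix.cons_val_zero, Matrix.cons_val_one, Matrix.add_apply,
      Matrix.smul_apply, Matrix.of_apply, Matrix.cons_val, smul_eq_mul, mul_one, mul_zero, add_zero,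
      zero_add] at h1 h2 h3
    exact eq_zero_of_coords (pow_eq_zero_iff two_ne_zero |>.1 (by linear_combination h2 - h1))
      (pow_eq_zero_iff two_ne_zero |>.1 (by linear_combination h3 - h1))
  · refine eq_zero_of_coords ?_ ?_
    · simpa [pencilEval, pencilRep] using m 0 1 0 1
    · simpa [pencilEval, pencilRep] using m 0 2 0 2
  · refine eq_zero_of_coords ?_ ?_
    · simpa [pencilEval, pencilRep] using m 0 1 0 1
    · simpa [pencilEval, pencilRep] using m 0 2 0 2
  · refine eq_zero_of_coords ?_ ?_
    · simpa [pencilEval, pencilRep] using m 0 2 0 2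
    · simpa [pencilEval, pencilRep] using m 1 2 1 2
  · have h := eq_zero_of_sq_add_sq (hc (Or.inr rfl)) (x := p 0) (y := p 1) (by
      have := m 0 1 0 1
      simp [pencilEval, pencilRep] at this
      linear_combination -this)
    exact eq_zero_of_coords h.1 h.2

theorem hasTwoRankOne_diagTwo : HasTwoRankOne (pencilRep F diagTwo) := by
  refine ⟨![1, 0], ![0, 1], by simp, fun s h => ?_, ⟨![1, 0, 0], ![1, 0, 0], ?_⟩,
    ⟨![0, 1, 0], ![0, 1, 0], ?_⟩⟩
  · have := congrFun h 1
    simp at this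
  · ext i j
    fin_cases i <;> fin_cases j <;> simp [pencilEval, pencilRep, Matrix.vecMulVec_apply]
  · ext i j
    fin_cases i <;> fin_cases j <;> simp [pencilEval, pencilRep, Matrix.vecMulVec_apply]

theorem not_hasTwoRankOne_nilTwo : ¬ HasTwoRankOne (pencilRep F nilTwo) := by
  rintro ⟨p, q, hp, hpq, h1, h2⟩
  have m1 := vecMulVec_minor h1 0 1 0 1
  have m2 := vecMulVec_minor h2 0 1 0 1
  simp [pencilEval, pencilRep] at m1 m2
  obtain ⟨s, hs⟩ := exists_smul_eq_of_zero hp 0 1 (by decide) m1 m2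
  exact hpq s hs

theorem hasTwoSingular_pencilRep {c : PencilClass}
    (h : c = repeatedDiag ∨ c = diagThree ∨ c = doubleRoot ∨ c = singular) :
    HasTwoSingular (pencilRep F c) := by
  refine ⟨![1, 0], ![0, 1], by simp, fun s h => ?_, ?_⟩
  · have := congrFun h 1
    simp at this
  · rcases h with rfl | rfl | rfl | rfl <;> simp [pencilEval, pencilRep, Matrix.det_fin_three]

theorem not_hasTwoSingular_pencilRep {c : PencilClass} (hc : c.Allowed F)
    (h : c = nilSplit ∨ c = nilThree ∨ c = rotThree) : ¬ HasTwoSingular (pencilRep F c) := by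
  rintro ⟨p, q, hp, hpq, h1, h2⟩
  have key : ∃ s : F, q = s • p := by
    rcases h with rfl | rfl | rfl
    · simp [pencilEval, pencilRep, Matrix.det_fin_three] at h1 h2
      exact exists_smul_eq_of_zero hp 0 1 (by decide) h1 h2
    · simp [pencilEval, pencilRep, Matrix.det_fin_three] at h1 h2
      exact exists_smul_eq_of_zero hp 1 0 (by decide) h1 h2
    · have key : ∀ p : Fin 2 → F, (pencilEval (pencilRep F rotThree) p).det = 0 → p 0 = 0 := by
        intro p h
        have e : (pencilEval (pencilRep F rotThree) p).det = -(p 0 * (p 0 ^ 2 + p 1 ^ 2)) := by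
          simp [pencilEval, pencilRep, Matrix.det_fin_three]
          ring
        rw [e, neg_eq_zero] at h
        rcases mul_eq_zero.1 h with h | h
        · exact h
        · exact (eq_zero_of_sq_add_sq (hc (Or.inr rfl)) h).1
      exact exists_smul_eq_of_zero hp 0 1 (by decide) (key p h1) (key q h2)
  obtain ⟨s, hs⟩ := key
  exact hpq s hs

theorem hasRegular_doubleRoot : HasRegular (pencilRep F doubleRoot) :=
  ⟨![1, 1], by simp [pencilEval, pencilRep, Matrix.det_fin_three]⟩

theorem not_hasRegular_singular : ¬ HasRegular (pencilRep F singular) := by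
  rintro ⟨p, h⟩
  exact h (by simp [pencilEval, pencilRep, Matrix.det_fin_three])

theorem hasMultipleRoot_pencilRep {c : PencilClass}
    (h : c = nilThree ∨ c = doubleRoot ∨ c = singular) : HasMultipleRoot (pencilRep F c) := by
  rcases h with rfl | rfl | rfl
  · refine ⟨![1, 0], by simp, by simp [pencilEval, pencilRep, Matrix.det_fin_three], fun q => ?_⟩
    simp [pencilEval, pencilRep, Matrix.adjugate_fin_three, Matrix.trace_fin_three]
  · refine ⟨![0, 1], by simp, by simp [pencilEval, pencilRep, Matrix.det_fin_three], fun q => ?_⟩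
    simp [pencilEval, pencilRep, Matrix.adjugate_fin_three, Matrix.trace_fin_three]
  · refine ⟨![0, 1], by simp, by simp [pencilEval, pencilRep, Matrix.det_fin_three], fun q => ?_⟩
    simp [pencilEval, pencilRep, Matrix.adjugate_fin_three, Matrix.trace_fin_three]

theorem not_hasMultipleRoot_pencilRep {c : PencilClass} (hc : c.Allowed F)
    (h : c = diagThree ∨ c = rotThree) : ¬ HasMultipleRoot (pencilRep F c) := by
  rintro ⟨p, hp, h0, hq⟩
  have h1 := hq ![1, 0]
  have h2 := hq ![0, 1]
  rcases h with rfl | rfl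
  · simp [pencilEval, pencilRep, Matrix.det_fin_three, Matrix.adjugate_fin_three,
      Matrix.trace_fin_three] at h0 h1 h2
    have h3 : p 0 * p 1 * (p 0 + p 1) = 0 := by simpa using h0
    rcases mul_eq_zero.1 h3 with h | h
    · rcases mul_eq_zero.1 h with h | h
      · refine hp (eq_zero_of_coords h (pow_eq_zero_iff two_ne_zero |>.1 ?_))
        linear_combination h1 - 2 * p 1 * h
      · refine hp (eq_zero_of_coords (pow_eq_zero_iff two_ne_zero |>.1 ?_) h)
        linear_combination h2 - 2 * p 0 * h
    · have h4 : p 0 = 0 := by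
        refine pow_eq_zero_iff two_ne_zero |>.1 ?_
        linear_combination -h2 + 2 * p 0 * h
      exact hp (eq_zero_of_coords h4 (by linear_combination h - h4))
  · simp [pencilEval, pencilRep, Matrix.det_fin_three, Matrix.adjugate_fin_three,
      Matrix.trace_fin_three] at h0 h1 h2
    have h3 : p 0 * (p 0 ^ 2 + p 1 ^ 2) = 0 := by linear_combination -h0
    rcases mul_eq_zero.1 h3 with h | h
    · refine hp (eq_zero_of_coords h (pow_eq_zero_iff two_ne_zero |>.1 ?_))
      linear_combination -h1 - 3 * p 0 * h
    · obtain ⟨h4, h5⟩ := eq_zero_of_sq_add_sq (hc (Or.inr rfl)) h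
      exact hp (eq_zero_of_coords h4 h5)

/-- The dimension of the span of the slices of a normal form. -/
def PencilClass.rank : PencilClass → ℕ
  | zero => 0
  | rankOne => 1
  | rankTwo => 2
  | rankThree => 3
  | row => 2
  | col => 1
  | diagTwo => 2
  | nilTwo => 2
  | rotTwo => 2
  | rowSplit => 3
  | colSplit => 2
  | rowChain => 3
  | colChain => 2
  | _ => 3

/-- In each normal form the slices that are nonzero come first and are linearly independent. -/
theorem sliceRank_pencilRep {c : PencilClass} (hc : c.Allowed F) :
    sliceRank (pencilRep F c) = c.rank := by
  rw [sliceRank_eq_card (s := Finset.univ.filter fun k : Fin 3 => k.1 < c.rank)]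
  · cases c <;> rfl
  · intro v
    cases c <;> simp [pencilRep, PencilClass.rank, funext_iff, Fin.forall_fin_succ, Matrix.mulVec,
      dotProduct, Fin.sum_univ_three] <;> tauto

theorem HRel.rank_eq {c c' : PencilClass} (hc : c.Allowed F) (hc' : c'.Allowed F)
    (h : HRel (pencilRep F c) (pencilRep F c')) : c.rank = c'.rank := by
  rw [← sliceRank_pencilRep hc, ← sliceRank_pencilRep hc', h.sliceRank_eq]

theorem HRel.transpose_rank_eq {c c' : PencilClass} (hc : c.Allowed F) (hc' : c'.Allowed F)
    (h : HRel (pencilRep F c) (pencilRep F c')) : c.transpose.rank = c'.transpose.rank := by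
  refine HRel.rank_eq hc.transpose hc'.transpose ?_
  have := h.transpose
  rwa [← show pencilRep F c.transpose = fun i => (pencilRep F c i).transpose from
    funext fun i => pencilRep_transpose c i, ← show pencilRep F c'.transpose = fun i =>
    (pencilRep F c' i).transpose from funext fun i => pencilRep_transpose c' i] at this

set_option maxRecDepth 100000 in
set_option synthInstance.maxSize 4096 in
set_option synthInstance.maxHeartbeats 400000 in
/-- Distinct normal forms are inequivalent. -/
theorem eq_of_hRel_pencilRep (c c' : PencilClass) (hc : c.Allowed F) (hc' : c'.Allowed F)
    (h : HRel (pencilRep F c) (pencilRep F c')) : c = c' := by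
  have r3 := h.rank_eq hc hc'
  have r2 := h.transpose_rank_eq hc hc'
  have h' := h.symm
  have f1 := fun z z' => not_hasZero_pencilRep z' (h.hasZero (hasZero_pencilRep z))
  have f1' := fun z z' => not_hasZero_pencilRep z' (h'.hasZero (hasZero_pencilRep z))
  have f2 := fun z z' => not_hasRankOne_pencilRep hc' z' (h.hasRankOne (hasRankOne_pencilRep z))
  have f2' := fun z z' => not_hasRankOne_pencilRep hc z' (h'.hasRankOne (hasRankOne_pencilRep z))
  have f3 := fun z z' =>
    not_hasTwoSingular_pencilRep hc' z' (h.hasTwoSingular (hasTwoSingular_pencilRep z))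
  have f3' := fun z z' =>
    not_hasTwoSingular_pencilRep hc z' (h'.hasTwoSingular (hasTwoSingular_pencilRep z))
  have f4 := fun z z' =>
    not_hasMultipleRoot_pencilRep hc' z' (h.hasMultipleRoot (hasMultipleRoot_pencilRep z))
  have f4' := fun z z' =>
    not_hasMultipleRoot_pencilRep hc z' (h'.hasMultipleRoot (hasMultipleRoot_pencilRep z))
  have f5 : c = diagTwo → c' = nilTwo → False := by
    rintro rfl rfl
    exact not_hasTwoRankOne_nilTwo (h.hasTwoRankOne hasTwoRankOne_diagTwo)
  have f5' : c' = diagTwo → c = nilTwo → False := by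
    rintro rfl rfl
    exact not_hasTwoRankOne_nilTwo (h'.hasTwoRankOne hasTwoRankOne_diagTwo)
  have f6 : c = doubleRoot → c' = singular → False := by
    rintro rfl rfl
    exact not_hasRegular_singular (h.hasRegular hasRegular_doubleRoot)
  have f6' : c' = doubleRoot → c = singular → False := by
    rintro rfl rfl
    exact not_hasRegular_singular (h'.hasRegular hasRegular_doubleRoot)
  -- The tensors have served their purpose: the remaining hypotheses concern the labels alone, and a
  -- finite check over all pairs shows that they leave only equal labels.
  clear h h' hc hc'
  revert c c'
  decide

end Invariants

/-! ### Classes of matrix spaces and their duality -/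

section Spaces

variable {F I J : Type*} [Field F] [Fintype I] [Fintype J] [DecidableEq I] [DecidableEq J]

/-- Equivalence of spaces of matrices under `GL × GL`. -/
def SpaceRel (W W' : Submodule F (Matrix I J F)) : Prop :=
  ∃ (M : GL I F) (P : GL J F), W.map (matAct M P).toLinearMap = W'

theorem matAct_one : matAct (1 : GL I F) (1 : GL J F) = LinearEquiv.refl F _ := by
  ext X : 1
  simp [matAct_apply]

theorem matAct_mul (M M' : GL I F) (P P' : GL J F) :
    matAct (M * M') (P * P') = (matAct M' P').trans (matAct M P) := by
  ext X : 1
  simp [matAct_apply, Matrix.mul_assoc]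

theorem SpaceRel.refl (W : Submodule F (Matrix I J F)) : SpaceRel W W :=
  ⟨1, 1, by rw [matAct_one]; exact Submodule.map_id W⟩

theorem SpaceRel.trans {W W' W'' : Submodule F (Matrix I J F)} :
    SpaceRel W W' → SpaceRel W' W'' → SpaceRel W W'' := by
  rintro ⟨M, P, rfl⟩ ⟨M', P', rfl⟩
  exact ⟨M' * M, P' * P, by rw [matAct_mul]; exact Submodule.map_comp _ _ _⟩

theorem SpaceRel.symm {W W' : Submodule F (Matrix I J F)} :
    SpaceRel W W' → SpaceRel W' W := by
  rintro ⟨M, P, rfl⟩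
  refine ⟨M⁻¹, P⁻¹, ?_⟩
  have h : (matAct M⁻¹ P⁻¹).toLinearMap ∘ₗ (matAct M P).toLinearMap = LinearMap.id := by
    have := matAct_mul M⁻¹ M P⁻¹ P
    rw [inv_mul_cancel, inv_mul_cancel, matAct_one] at this
    exact congrArg LinearEquiv.toLinearMap this.symm
  rw [← Submodule.map_comp, h, Submodule.map_id]

/-- The setoid of `SpaceRel`. -/
def spaceSetoid (I J F : Type*) [Field F] [Fintype I] [Fintype J] [DecidableEq I]
    [DecidableEq J] : Setoid (Submodule F (Matrix I J F)) :=
  ⟨SpaceRel, SpaceRel.refl, SpaceRel.symm, SpaceRel.trans⟩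

/-- The dimension of a class of spaces of matrices. -/
noncomputable def classFinrank : Quotient (spaceSetoid I J F) → ℕ :=
  Quotient.lift (fun W => Module.finrank F W) (by
    rintro W _ ⟨M, P, rfl⟩
    exact (LinearEquiv.finrank_map_eq (matAct M P) W).symm)

variable (I J F) in
/-- The number of classes of spaces of matrices of a given dimension. -/
noncomputable def spaceCount (d : ℕ) : ℕ :=
  Nat.card {q : Quotient (spaceSetoid I J F) // classFinrank q = d}

/-- The pairing `trace (Xᵀ Y)` of matrices. -/
def pairing (I J F : Type*) [Field F] [Fintype I] [Fintype J] :
    LinearMap.BilinForm F (Matrix I J F) :=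
  LinearMap.mk₂ F (fun X Y => (X.transpose * Y).trace)
    (fun X X' Y => by simp [Matrix.add_mul]) (fun c X Y => by simp)
    (fun X Y Y' => by simp [Matrix.mul_add]) (fun c X Y => by simp)

theorem pairing_apply (X Y : Matrix I J F) : pairing I J F X Y = (X.transpose * Y).trace := rfl

theorem pairing_symm (X Y : Matrix I J F) : pairing I J F X Y = pairing I J F Y X := by
  rw [pairing_apply, pairing_apply, ← Matrix.trace_transpose, Matrix.transpose_mul,
    Matrix.transpose_transpose]

theorem pairing_isRefl : LinearMap.BilinForm.IsRefl (pairing I J F) :=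
  fun X Y h => by rw [pairing_symm, h]

theorem pairing_nondegenerate : (pairing I J F).Nondegenerate := by
  have key : ∀ Y : Matrix I J F, (∀ X, pairing I J F X Y = 0) → Y = 0 := fun Y h =>
    Matrix.ext_iff_trace_mul_left.2 fun X => by
      have := h X.transpose
      rw [pairing_apply, Matrix.transpose_transpose] at this
      rw [this, Matrix.mul_zero, Matrix.trace_zero]
  exact ⟨fun X h => key X fun Y => by rw [pairing_symm, h], key⟩

theorem pairing_matAct (M : GL I F) (P : GL J F) {M' : GL I F} {P' : GL J F}
    (hM : M'.1 = M.1.transpose) (hP : P'.1 = P.1.transpose) (X Y : Matrix I J F) :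
    pairing I J F (matAct M P X) Y = pairing I J F X (matAct M' P' Y) := by
  rw [pairing_apply, pairing_apply, matAct_apply, matAct_apply, hM, hP]
  simp only [Matrix.transpose_mul, Matrix.transpose_transpose, Matrix.mul_assoc]
  rw [Matrix.trace_mul_comm]
  simp only [Matrix.mul_assoc]

theorem exists_gl_transpose (M : GL I F) : ∃ M' : GL I F, M'.1 = M.1.transpose := by
  have hdet : M.1.transpose.det ≠ 0 := by
    rw [Matrix.det_transpose]
    exact (M.1.isUnit_iff_isUnit_det.1 M.isUnit).ne_zero
  exact ⟨Matrix.GeneralLinearGroup.mkOfDetNeZero _ hdet, rfl⟩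

/-- The adjoint of (M, P) for the trace pairing is (Mᵀ, Pᵀ), which carries the orthogonal of the
image of W onto the orthogonal of W. -/
theorem SpaceRel.orthogonal {W W' : Submodule F (Matrix I J F)} (h : SpaceRel W W') :
    SpaceRel ((pairing I J F).orthogonal W) ((pairing I J F).orthogonal W') := by
  obtain ⟨M, P, rfl⟩ := h
  obtain ⟨M', hM⟩ := exists_gl_transpose M
  obtain ⟨P', hP⟩ := exists_gl_transpose P
  refine SpaceRel.symm ⟨M', P', ?_⟩
  ext Y
  constructor
  · rintro ⟨Z, hZ, rfl⟩ X hX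
    have := hZ _ ⟨X, hX, rfl⟩
    exact (pairing_matAct M P hM hP X Z).symm.trans this
  · intro hY
    refine ⟨(matAct M' P').symm Y, ?_, (matAct M' P').apply_symm_apply Y⟩
    rintro _ ⟨X, hX, rfl⟩
    refine (pairing_matAct M P hM hP X _).trans ?_
    rw [LinearEquiv.apply_symm_apply]
    exact hY X hX

theorem orthogonal_orthogonal (W : Submodule F (Matrix I J F)) :
    (pairing I J F).orthogonal ((pairing I J F).orthogonal W) = W :=
  LinearMap.BilinForm.orthogonal_orthogonal pairing_nondegenerate pairing_isRefl W

/-- Orthogonality as an involution on the classes of spaces of matrices. -/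
noncomputable def orthogonalEquiv :
    Quotient (spaceSetoid I J F) ≃ Quotient (spaceSetoid I J F) where
  toFun := Quotient.map (pairing I J F).orthogonal fun _ _ => SpaceRel.orthogonal
  invFun := Quotient.map (pairing I J F).orthogonal fun _ _ => SpaceRel.orthogonal
  left_inv := Quotient.ind fun W => congrArg (Quotient.mk _) (orthogonal_orthogonal W)
  right_inv := Quotient.ind fun W => congrArg (Quotient.mk _) (orthogonal_orthogonal W)

theorem classFinrank_le (q : Quotient (spaceSetoid I J F)) :
    classFinrank q ≤ Fintype.card I * Fintype.card J := by
  induction q using Quotient.inductionOn with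
  | h W => exact (Submodule.finrank_le W).trans_eq (by simp [Module.finrank_matrix])

theorem classFinrank_orthogonalEquiv (q : Quotient (spaceSetoid I J F)) :
    classFinrank (orthogonalEquiv q) = Fintype.card I * Fintype.card J - classFinrank q := by
  induction q using Quotient.inductionOn with
  | h W =>
    refine (LinearMap.BilinForm.finrank_orthogonal pairing_nondegenerate W).trans ?_
    rw [Module.finrank_matrix, Module.finrank_self, mul_one]
    rfl

/-- Orthogonality exchanges the classes of complementary dimensions. -/
noncomputable def orthogonalEquivOfAdd {d e : ℕ} (h : d + e = Fintype.card I * Fintype.card J) :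
    {q : Quotient (spaceSetoid I J F) // classFinrank q = d} ≃
      {q : Quotient (spaceSetoid I J F) // classFinrank q = e} :=
  orthogonalEquiv.subtypeEquiv fun q => by
    have := classFinrank_le q
    rw [classFinrank_orthogonalEquiv]
    omega

/-- Sending a tensor to the class of its slice space is well defined and injective on orbits, and
reaches every space of dimension at most r. -/
theorem numClasses_eq (r : ℕ) :
    Nat.card (Quotient (hSetoid I J (Fin r) F)) =
      Nat.card {q : Quotient (spaceSetoid I J F) // classFinrank q ≤ r} := by
  have hle : ∀ t : Tens I J (Fin r) F, Module.finrank F (sliceSpan t) ≤ r := fun t => by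
    exact (sliceMap t).finrank_range_le.trans_eq (by simp)
  have hrel : ∀ s t : Tens I J (Fin r) F,
      HRel s t ↔ SpaceRel (sliceSpan s) (sliceSpan t) := hRel_iff_sliceSpan
  refine Nat.card_eq_of_bijective (Quotient.lift
    (fun t : Tens I J (Fin r) F => (⟨Quotient.mk (spaceSetoid I J F) (sliceSpan t), hle t⟩ :
      {q : Quotient (spaceSetoid I J F) // classFinrank q ≤ r}))
    fun s t h => Subtype.ext (Quotient.sound ((hrel s t).1 h))) ⟨?_, ?_⟩
  · intro p q
    refine Quotient.inductionOn₂ p q fun s t h => Quotient.sound ((hrel s t).2 ?_)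
    exact Quotient.exact (congrArg Subtype.val h)
  · rintro ⟨q, hq⟩
    induction q using Quotient.inductionOn with
    | h W =>
      obtain ⟨t, ht⟩ := exists_sliceSpan_eq (K := Fin r) W (hq.trans_eq (by simp))
      exact ⟨Quotient.mk _ t, Subtype.ext (congrArg (Quotient.mk _) ht)⟩

theorem numClasses_eq_sum [∀ d, Finite {q : Quotient (spaceSetoid I J F) // classFinrank q = d}]
    (r : ℕ) : Nat.card (Quotient (hSetoid I J (Fin r) F)) =
      ∑ d ∈ Finset.range (r + 1), spaceCount F I J d := by
  simp only [spaceCount]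
  rw [numClasses_eq, ← Fin.sum_univ_eq_sum_range
    (fun d => Nat.card {q : Quotient (spaceSetoid I J F) // classFinrank q = d}), ← Nat.card_sigma (α := Fin (r + 1))
    (β := fun d => {q : Quotient (spaceSetoid I J F) // classFinrank q = (d : ℕ)})]
  refine Nat.card_congr ⟨fun q => ⟨⟨classFinrank q.1, Nat.lt_succ_of_le q.2⟩, q.1, rfl⟩,
    fun q => ⟨q.2.1, by rw [q.2.2]; exact Nat.le_of_lt_succ q.1.2⟩, fun q => rfl, ?_⟩
  rintro ⟨⟨d, hd⟩, q, (rfl : classFinrank q = d)⟩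
  rfl

end Spaces

/-! ### Counting H-orbits -/

section Counting

variable {F : Type*} [Field F]

/-- The solvability of low degree equations used to find normal forms of pencils. -/
structure HasPencilRoots (F : Type*) [Field F] : Prop where
  quad : ∀ b c : F, (∃ x, x ^ 2 + b * x + c = 0) ∨
    ((∀ x : F, x ^ 2 + 1 ≠ 0) ∧ ∃ u s, s ≠ 0 ∧ b = 2 * u ∧ c = u ^ 2 + s ^ 2)
  cubic : ∀ b c d : F, ∃ x, x ^ 3 + b * x ^ 2 + c * x + d = 0

/-- The normal forms are in bijection with the classes of spaces of dimension at most three. -/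
noncomputable def pencilClassEquiv (hF : HasPencilRoots F) {d : ℕ} (hd : d ≤ 3) :
    {c : PencilClass // c.Allowed F ∧ c.rank = d} ≃
      {q : Quotient (spaceSetoid (Fin 2) (Fin 3) F) // classFinrank q = d} :=
  Equiv.ofBijective (fun c => ⟨Quotient.mk _ (sliceSpan (pencilRep F c.1)),
    (sliceRank_pencilRep c.2.1).trans c.2.2⟩) (by
    constructor
    · intro c c' h
      refine Subtype.ext (eq_of_hRel_pencilRep _ _ c.2.1 c'.2.1 ((hRel_iff_sliceSpan _ _).2 ?_))
      exact Quotient.exact (congrArg Subtype.val h)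
    · rintro ⟨q, hq⟩
      induction q using Quotient.inductionOn with
      | h W =>
        have hW : Module.finrank F W = d := hq
        obtain ⟨t, rfl⟩ := exists_sliceSpan_eq (K := Fin 3) W (by simpa [hW] using hd)
        obtain ⟨c, hc, h⟩ := hasNormalForm hF.quad hF.cubic t
        refine ⟨⟨c, hc, ?_⟩, Subtype.ext (Quotient.sound ((hRel_iff_sliceSpan _ _).1 h.symm))⟩
        rw [← sliceRank_pencilRep hc, ← h.sliceRank_eq]
        exact hW)

theorem finite_classFinrank (hF : HasPencilRoots F) (d : ℕ) :
    Finite {q : Quotient (spaceSetoid (Fin 2) (Fin 3) F) // classFinrank q = d} := by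
  rcases le_or_gt d 3 with h | h
  · exact Finite.of_equiv _ (pencilClassEquiv hF h)
  · rcases le_or_gt d 6 with h' | h'
    · refine Finite.of_equiv _ ((pencilClassEquiv hF (d := 6 - d) (by omega)).trans
        (orthogonalEquivOfAdd ?_))
      simp only [Fintype.card_fin]
      omega
    · refine @Finite.of_subsingleton _ ⟨fun q => ?_⟩
      have := (classFinrank_le q.1).trans_lt (by simpa using h')
      exact absurd q.2 this.ne

/-- The number of normal forms of a given rank. -/
noncomputable def pencilCount (F : Type*) [Field F] (d : ℕ) : ℕ :=
  Nat.card {c : PencilClass // c.Allowed F ∧ c.rank = d}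

theorem spaceCount_eq (hF : HasPencilRoots F) {d : ℕ} (hd : d ≤ 3) :
    spaceCount F (Fin 2) (Fin 3) d = pencilCount F d :=
  (Nat.card_congr (pencilClassEquiv hF hd)).symm

theorem spaceCount_eq_of_add_eq (hF : HasPencilRoots F) {d e : ℕ} (hd : d ≤ 3) (h : d + e = 6) :
    spaceCount F (Fin 2) (Fin 3) e = pencilCount F d := by
  rw [← spaceCount_eq hF hd]
  exact (Nat.card_congr (orthogonalEquivOfAdd (by simpa using h))).symm

theorem spaceCount_eq_zero {d : ℕ} (hd : 6 < d) : spaceCount F (Fin 2) (Fin 3) d = 0 := by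
  refine @Nat.card_of_isEmpty _ ⟨fun q => ?_⟩
  have := (classFinrank_le q.1).trans_lt (by simpa using hd)
  exact absurd q.2 this.ne

theorem numOrbitsH_eq_sum (hF : HasPencilRoots F) (r : ℕ) :
    numOrbitsH F r = ∑ d ∈ Finset.range (r + 1), spaceCount F (Fin 2) (Fin 3) d := by
  have := finite_classFinrank hF
  rw [numOrbitsH_eq, numClasses_eq_sum]

/-- By duality the numbers of classes in dimensions 0 to 6 are n₀, n₁, n₂, n₃, n₂, n₁, n₀, and there
are none beyond. -/
theorem numOrbitsH_values (hF : HasPencilRoots F) {n₀ n₁ n₂ n₃ : ℕ} (h₀ : pencilCount F 0 = n₀)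
    (h₁ : pencilCount F 1 = n₁) (h₂ : pencilCount F 2 = n₂) (h₃ : pencilCount F 3 = n₃) :
    numOrbitsH F 1 = n₀ + n₁ ∧ numOrbitsH F 2 = n₀ + n₁ + n₂ ∧
      numOrbitsH F 3 = n₀ + n₁ + n₂ + n₃ ∧ numOrbitsH F 4 = n₀ + n₁ + n₂ + n₃ + n₂ ∧
      numOrbitsH F 5 = n₀ + n₁ + n₂ + n₃ + n₂ + n₁ ∧
      ∀ r, 6 ≤ r → numOrbitsH F r = n₀ + n₁ + n₂ + n₃ + n₂ + n₁ + n₀ := by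
  have e₀ := (spaceCount_eq hF (d := 0) (by decide)).trans h₀
  have e₁ := (spaceCount_eq hF (d := 1) (by decide)).trans h₁
  have e₂ := (spaceCount_eq hF (d := 2) (by decide)).trans h₂
  have e₃ := (spaceCount_eq hF (d := 3) (by decide)).trans h₃
  have e₄ := (spaceCount_eq_of_add_eq hF (d := 2) (e := 4) (by decide) rfl).trans h₂
  have e₅ := (spaceCount_eq_of_add_eq hF (d := 1) (e := 5) (by decide) rfl).trans h₁
  have e₆ := (spaceCount_eq_of_add_eq hF (d := 0) (e := 6) (by decide) rfl).trans h₀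
  have h6 : ∀ r, 6 ≤ r → numOrbitsH F r =
      ∑ d ∈ Finset.range 7, spaceCount F (Fin 2) (Fin 3) d := fun r hr => by
    rw [numOrbitsH_eq_sum hF]
    refine (Finset.sum_subset (Finset.range_subset_range.2 (by omega)) fun d _ h => ?_).symm
    exact spaceCount_eq_zero (by rw [Finset.mem_range] at h; omega)
  refine ⟨?_, ?_, ?_, ?_, ?_, fun r hr => ?_⟩
  · simp [numOrbitsH_eq_sum hF, Finset.sum_range_succ, e₀, e₁]
  · simp [numOrbitsH_eq_sum hF, Finset.sum_range_succ, e₀, e₁, e₂]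
  · simp [numOrbitsH_eq_sum hF, Finset.sum_range_succ, e₀, e₁, e₂, e₃]
  · simp [numOrbitsH_eq_sum hF, Finset.sum_range_succ, e₀, e₁, e₂, e₃, e₄]
  · simp [numOrbitsH_eq_sum hF, Finset.sum_range_succ, e₀, e₁, e₂, e₃, e₄, e₅]
  · simp [h6 r hr, Finset.sum_range_succ, e₀, e₁, e₂, e₃, e₄, e₅, e₆]

theorem pencilClass_allowed_iff (h : ∃ x : F, x ^ 2 + 1 = 0) (c : PencilClass) :
    c.Allowed F ↔ c ≠ .rotTwo ∧ c ≠ .rotThree := by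
  obtain ⟨x, hx⟩ := h
  constructor
  · intro hc
    exact ⟨fun h => hc (Or.inl h) x hx, fun h => hc (Or.inr h) x hx⟩
  · rintro ⟨h1, h2⟩ (h | h)
    exacts [absurd h h1, absurd h h2]

theorem pencilCount_of_sqrt (h : ∃ x : F, x ^ 2 + 1 = 0) :
    pencilCount F 0 = 1 ∧ pencilCount F 1 = 2 ∧ pencilCount F 2 = 6 ∧ pencilCount F 3 = 9 := by
  simp only [pencilCount, pencilClass_allowed_iff h, Nat.card_eq_fintype_card]
  decide

theorem pencilCount_of_no_sqrt (h : ∀ x : F, x ^ 2 + 1 ≠ 0) :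
    pencilCount F 0 = 1 ∧ pencilCount F 1 = 2 ∧ pencilCount F 2 = 7 ∧ pencilCount F 3 = 10 := by
  have : ∀ c : PencilClass, c.Allowed F ↔ True := fun c => iff_true_intro fun _ => h
  simp only [pencilCount, this, Nat.card_eq_fintype_card, true_and]
  decide

end Counting

/-! ### Permuting the tensor factors -/

section Permutations

variable {F I J K : Type*} [Field F]

variable (F I J K) in
/-- Exchange of the last two factors. -/
def swapLast : Tens I J K F ≃ₗ[F] Tens I K J F where
  toFun t i := (t i).transpose
  invFun t i := (t i).transpose
  map_add' _ _ := rfl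
  map_smul' _ _ := rfl
  left_inv _ := rfl
  right_inv _ := rfl

variable (F I J K) in
/-- Exchange of the first two factors. -/
def swapFirst : Tens I J K F ≃ₗ[F] Tens J I K F where
  toFun t j i k := t i j k
  invFun t i j k := t j i k
  map_add' _ _ := rfl
  map_smul' _ _ := rfl
  left_inv _ := rfl
  right_inv _ := rfl

theorem swapLast_pureTens (a : I → F) (b : J → F) (c : K → F) :
    swapLast F I J K (pureTens a b c) = pureTens a c b := by
  funext i j k
  exact mul_right_comm _ _ _

theorem swapFirst_pureTens (a : I → F) (b : J → F) (c : K → F) :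
    swapFirst F I J K (pureTens a b c) = pureTens b a c := by
  funext i j k
  change a j * b i * c k = b i * a j * c k
  rw [mul_comm (a j)]

theorem swapLast_image : swapLast F I J K '' pureSet I J K F = pureSet I K J F := by
  ext t
  constructor
  · rintro ⟨_, ⟨a, b, c, ha, hb, hc, rfl⟩, rfl⟩
    exact ⟨a, c, b, ha, hc, hb, swapLast_pureTens a b c⟩
  · rintro ⟨a, b, c, ha, hb, hc, rfl⟩
    exact ⟨_, ⟨a, c, b, ha, hc, hb, rfl⟩, swapLast_pureTens a c b⟩

theorem swapFirst_image : swapFirst F I J K '' pureSet I J K F = pureSet J I K F := by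
  ext t
  constructor
  · rintro ⟨_, ⟨a, b, c, ha, hb, hc, rfl⟩, rfl⟩
    exact ⟨b, a, c, hb, ha, hc, swapFirst_pureTens a b c⟩
  · rintro ⟨a, b, c, ha, hb, hc, rfl⟩
    exact ⟨_, ⟨b, a, c, hb, ha, hc, rfl⟩, swapFirst_pureTens b a c⟩

theorem GRel.map {I' J' K' : Type*} {e : Tens I J K F ≃ₗ[F] Tens I' J' K' F}
    (he : e '' pureSet I J K F = pureSet I' J' K' F) {s t : Tens I J K F} (h : GRel s t) :
    GRel (e s) (e t) := by
  obtain ⟨g, hg, rfl⟩ := h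
  refine ⟨(e.symm.trans g).trans e, ?_, by simp⟩
  have : ⇑((e.symm.trans g).trans e) = e ∘ g ∘ e.symm := rfl
  have h1 : ⇑(e.symm) ∘ ⇑e = id := by
    funext x
    simp
  rw [this, Set.image_comp, Set.image_comp]
  conv_lhs => rw [← he, ← Set.image_comp e.symm, h1, Set.image_id, hg, he]

theorem IsLine.swapLast {n : Fin 3} {L : Submodule F (Tens I J K F)} (hL : IsLine n L) :
    IsLine (Equiv.swap 1 2 n) (L.map (swapLast F I J K).toLinearMap) := by
  obtain ⟨a, b, c, ha, hb, hc, rfl⟩ := hL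
  refine ⟨a, c, b, ha, hc, hb, ?_⟩
  fin_cases n
  · exact (LinearMap.range_comp _ _).symm.trans
      (congrArg _ (LinearMap.ext fun x => swapLast_pureTens x b c))
  · exact (LinearMap.range_comp _ _).symm.trans
      (congrArg _ (LinearMap.ext fun x => swapLast_pureTens a x c))
  · exact (LinearMap.range_comp _ _).symm.trans
      (congrArg _ (LinearMap.ext fun x => swapLast_pureTens a b x))

variable [Fintype I] [Fintype J] [Fintype K] [DecidableEq I] [DecidableEq J] [DecidableEq K]

theorem Tens.linearMap_ext {V : Type*} [AddCommGroup V] [Module F V] {f g : Tens I J K F →ₗ[F] V}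
    (h : ∀ a b c, f (pureTens a b c) = g (pureTens a b c)) : f = g := by
  have : f ∘ₗ (coordEquiv F I J K).toLinearMap = g ∘ₗ (coordEquiv F I J K).toLinearMap :=
    TensorProduct.ext_threefold fun a b c => by
      simp only [LinearMap.comp_apply, LinearEquiv.coe_coe, coordEquiv_tmul, h]
  refine LinearMap.ext fun t => ?_
  obtain ⟨v, rfl⟩ := (coordEquiv F I J K).surjective t
  exact LinearMap.congr_fun this v

theorem swapFirst_tensAct (M : Matrix I I F) (P : Matrix J J F) (Q : Matrix K K F)
    (t : Tens I J K F) :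
    swapFirst F I J K (tensAct M P Q t) = tensAct P M Q (swapFirst F I J K t) := by
  have : (swapFirst F I J K).toLinearMap ∘ₗ tensAct M P Q =
      tensAct P M Q ∘ₗ (swapFirst F I J K).toLinearMap :=
    Tens.linearMap_ext fun a b c => by
      simp only [LinearMap.comp_apply, LinearEquiv.coe_coe, tensAct_pureTens, swapFirst_pureTens]
  exact LinearMap.congr_fun this t

theorem HRel.swapFirst {s t : Tens I J K F} (h : HRel s t) :
    HRel (swapFirst F I J K s) (swapFirst F I J K t) := by
  obtain ⟨M, P, Q, rfl⟩ := h
  exact ⟨P, M, Q, (swapFirst_tensAct _ _ _ _).symm⟩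

theorem HRel.gRel {s t : Tens I J K F} (h : HRel s t) : GRel s t := by
  obtain ⟨M, P, Q, rfl⟩ := h
  have inv : ∀ (M : GL I F) (P : GL J F) (Q : GL K F) (t : Tens I J K F),
      tensAct M⁻¹.1 P⁻¹.1 Q⁻¹.1 (tensAct M.1 P.1 Q.1 t) = t := fun M P Q t => by
    rw [tensAct_tensAct]
    simp only [← Units.val_mul, inv_mul_cancel, Units.val_one, tensAct_one]
  have inv' : ∀ (M : GL I F) (P : GL J F) (Q : GL K F) (t : Tens I J K F),
      tensAct M.1 P.1 Q.1 (tensAct M⁻¹.1 P⁻¹.1 Q⁻¹.1 t) = t := fun M P Q t => by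
    simpa only [inv_inv] using inv M⁻¹ P⁻¹ Q⁻¹ t
  have hpure : ∀ (M : GL I F) (P : GL J F) (Q : GL K F), ∀ t ∈ pureSet I J K F,
      tensAct M.1 P.1 Q.1 t ∈ pureSet I J K F := by
    rintro M P Q _ ⟨a, b, c, ha, hb, hc, rfl⟩
    refine ⟨glEquiv F I M a, glEquiv F J P b, glEquiv F K Q c, by simpa using ha, by simpa using hb,
      by simpa using hc, tensAct_pureTens _ _ _ _ _ _⟩
  refine ⟨LinearEquiv.ofLinearMap (tensAct M.1 P.1 Q.1) (tensAct M⁻¹.1 P⁻¹.1 Q⁻¹.1)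
    (LinearMap.ext fun t => ?_) (LinearMap.ext fun t => inv M P Q t), ?_, rfl⟩
  · exact inv' M P Q t
  · refine Set.Subset.antisymm (Set.image_subset_iff.2 fun t ht => hpure M P Q t ht) fun t ht =>
      ⟨_, hpure M⁻¹ P⁻¹ Q⁻¹ t ht, ?_⟩
    exact inv' M P Q t

/-- If the dimensions are distinct, then the two kinds of orbits agree. -/
theorem GRel.hRel [Infinite F] (hI : 2 ≤ Fintype.card I) (hJ : 2 ≤ Fintype.card J)
    (hK : 2 ≤ Fintype.card K) (hIJ : Fintype.card I ≠ Fintype.card J)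
    (hIK : Fintype.card I ≠ Fintype.card K) (hJK : Fintype.card J ≠ Fintype.card K)
    {s t : Tens I J K F} (h : GRel s t) : HRel s t := by
  obtain ⟨g, hg, rfl⟩ := h
  rcases preserves_types hI hJ hK hIJ hIK hg with h | h
  · obtain ⟨M, P, Q, h⟩ := exists_tensAct_of_preserves_types hI hJ hK hg h
    exact ⟨M, P, Q, (h s).symm⟩
  · exact absurd h.1 hJK

/-- If the last two factors agree, then the fundamental tensors are also preserved by their
exchange, and by nothing essentially different. -/
theorem GRel.hRel_or [Infinite F] (hI : 2 ≤ Fintype.card I) (hJ : 2 ≤ Fintype.card J)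
    (hIJ : Fintype.card I ≠ Fintype.card J) {s t : Tens I J J F} (h : GRel s t) :
    HRel s t ∨ HRel (TensorOrbits.swapLast F I J J s) t := by
  obtain ⟨g, hg, rfl⟩ := h
  rcases preserves_types hI hJ hJ hIJ hIJ hg with h | ⟨-, h⟩
  · obtain ⟨M, P, Q, h⟩ := exists_tensAct_of_preserves_types hI hJ hJ hg h
    exact Or.inl ⟨M, P, Q, (h s).symm⟩
  · have hg' : (swapLast F I J J).trans g '' pureSet I J J F = pureSet I J J F := by
      have : ⇑((swapLast F I J J).trans g) = g ∘ swapLast F I J J := rfl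
      rw [this, Set.image_comp, swapLast_image, hg]
    obtain ⟨M, P, Q, h⟩ := exists_tensAct_of_preserves_types hI hJ hJ hg' fun n L hL => by
      have := h _ _ hL.swapLast
      rw [Equiv.swap_apply_self] at this
      rw [LinearEquiv.coe_trans, Submodule.map_comp]
      exact this
    exact Or.inr ⟨M, P, Q, (h _).symm⟩

theorem gRel_swapLast (t : Tens I J J F) : GRel t (swapLast F I J J t) :=
  ⟨_, swapLast_image, rfl⟩

/-- Dropping zero slices does not change the span; this transfers the 3 × 3 normal forms to r < 3.
-/
theorem sliceSpan_comp_embedding {K' : Type*} [Fintype K'] [DecidableEq K'] (t : Tens I J K F)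
    (e : K' ↪ K) (h : ∀ k ∉ Set.range e, ∀ i j, t i j k = 0) :
    sliceSpan (fun i => Matrix.of fun j k => t i j (e k) : Tens I J K' F) = sliceSpan t := by
  have key : ∀ c : K → F, sliceMap (fun i => Matrix.of fun j k => t i j (e k) : Tens I J K' F)
      (c ∘ e) = sliceMap t c := fun c => by
    ext i j
    exact Fintype.sum_of_injective e e.injective _ _ (fun k hk => by simp [h k hk]) fun k => rfl
  ext X
  constructor
  · rintro ⟨c', rfl⟩
    obtain ⟨c, rfl⟩ := LinearMap.funLeft_surjective_of_injective F F _ e.injective c'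
    exact ⟨c, (key c).symm⟩
  · rintro ⟨c, rfl⟩
    exact ⟨_, key c⟩

end Permutations

/-- The idempotent m picks one label from each set of labels with equivalent representatives, so its
fixed points index the classes. -/
theorem card_quotient_eq_card_fixed {X κ : Type*} (s : Setoid X) (p : κ → Prop) (rep : κ → X)
    (m : κ → κ) (hp : ∀ c, p c → p (m c)) (hm : ∀ c, m (m c) = m c)
    (hrep : ∀ x, ∃ c, p c ∧ s x (rep c))
    (h : ∀ c c', p c → p c' → (s (rep c) (rep c') ↔ m c = m c')) :
    Nat.card (Quotient s) = Nat.card {c // p c ∧ m c = c} := by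
  refine (Nat.card_eq_of_bijective (fun c : {c // p c ∧ m c = c} => Quotient.mk s (rep c.1))
    ⟨fun c c' e => Subtype.ext ?_, fun q => ?_⟩).symm
  · rw [← c.2.2, ← c'.2.2]
    exact (h _ _ c.2.1 c'.2.1).1 (Quotient.exact e)
  · induction q using Quotient.inductionOn with
    | h x =>
      obtain ⟨c, hc, hx⟩ := hrep x
      refine ⟨⟨m c, hp c hc, hm c⟩, Quotient.sound (s.trans ?_ (s.symm hx))⟩
      exact (h _ _ (hp c hc) hc).2 (hm c)

/-! ### Counting G-orbits -/

section GCounting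

variable {F : Type*} [Field F]

theorem pencilRep_eq_zero {c : PencilClass} {k : Fin 3} (h : c.rank ≤ k) (i : Fin 2) (j : Fin 3) :
    pencilRep F c i j k = 0 := by
  cases c <;> fin_cases k <;> first
    | exact absurd h (by decide)
    | (fin_cases i <;> fin_cases j <;> rfl)

/-- The normal forms with few slices. -/
def truncRep (F : Type*) [Field F] {r : ℕ} (hr : r ≤ 3) (c : PencilClass) :
    Tens (Fin 2) (Fin 3) (Fin r) F :=
  fun i => Matrix.of fun j k => pencilRep F c i j (Fin.castLEEmb hr k)

theorem sliceSpan_truncRep {r : ℕ} (hr : r ≤ 3) {c : PencilClass} (hc : c.rank ≤ r) :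
    sliceSpan (truncRep F hr c) = sliceSpan (pencilRep F c) := by
  refine sliceSpan_comp_embedding _ _ fun k hk i j => pencilRep_eq_zero ?_ i j
  by_contra! h
  exact hk ⟨⟨k, h.trans_le hc⟩, rfl⟩

theorem hRel_truncRep_iff {r : ℕ} (hr : r ≤ 3) {c c' : PencilClass}
    (hc : c.Allowed F ∧ c.rank ≤ r) (hc' : c'.Allowed F ∧ c'.rank ≤ r) :
    HRel (truncRep F hr c) (truncRep F hr c') ↔ c = c' := by
  refine ⟨fun h => eq_of_hRel_pencilRep _ _ hc.1 hc'.1 ?_, fun h => h ▸ HRel.refl _⟩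
  rwa [hRel_iff_sliceSpan, sliceSpan_truncRep hr hc.2, sliceSpan_truncRep hr hc'.2,
    ← hRel_iff_sliceSpan] at h

theorem exists_hRel_truncRep (hF : HasPencilRoots F) {r : ℕ} (hr : r ≤ 3)
    (t : Tens (Fin 2) (Fin 3) (Fin r) F) :
    ∃ c : PencilClass, (c.Allowed F ∧ c.rank ≤ r) ∧ HRel t (truncRep F hr c) := by
  have ht : Module.finrank F (sliceSpan t) ≤ r :=
    (sliceMap t).finrank_range_le.trans_eq (by simp)
  obtain ⟨u, hu⟩ := exists_sliceSpan_eq (K := Fin 3) (sliceSpan t) (by simpa using ht.trans hr)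
  obtain ⟨c, hc, h⟩ := hasNormalForm hF.quad hF.cubic u
  have hcr : c.rank ≤ r := by
    rw [← sliceRank_pencilRep hc, ← h.sliceRank_eq, sliceRank, hu]
    exact ht
  refine ⟨c, ⟨hc, hcr⟩, ?_⟩
  rw [hRel_iff_sliceSpan] at h ⊢
  rwa [sliceSpan_truncRep hr hcr, ← hu]

theorem numOrbitsG_eq_card_fixed (hF : HasPencilRoots F) {r : ℕ} (hr : r ≤ 3)
    (m : PencilClass → PencilClass)
    (hp : ∀ c : PencilClass, c.Allowed F ∧ c.rank ≤ r → (m c).Allowed F ∧ (m c).rank ≤ r)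
    (hm : ∀ c, m (m c) = m c)
    (h : ∀ c c' : PencilClass, c.Allowed F ∧ c.rank ≤ r → c'.Allowed F ∧ c'.rank ≤ r →
      (GRel (truncRep F hr c) (truncRep F hr c') ↔ m c = m c')) :
    numOrbitsG F r = Nat.card {c : PencilClass // (c.Allowed F ∧ c.rank ≤ r) ∧ m c = c} := by
  rw [numOrbitsG_eq]
  refine card_quotient_eq_card_fixed _ _ (truncRep F hr) m hp hm (fun t => ?_) h
  obtain ⟨c, hc, ht⟩ := exists_hRel_truncRep hF hr t
  exact ⟨c, hc, ht.gRel⟩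

/-- The dimensions 2, 3 and r are distinct, so no factors can be exchanged. -/
theorem numOrbitsG_eq_numOrbitsH [Infinite F] {r : ℕ} (hr : 4 ≤ r) :
    numOrbitsG F r = numOrbitsH F r := by
  rw [numOrbitsG_eq, numOrbitsH_eq]
  refine Nat.card_congr (Quotient.congr (Equiv.refl _) fun s t => ⟨fun h => ?_, HRel.gRel⟩)
  refine GRel.hRel ?_ ?_ ?_ ?_ ?_ ?_ h <;> simp only [Fintype.card_fin] <;> omega

/-- A choice of one class in each pair of transposed classes. -/
def PencilClass.foldTranspose : PencilClass → PencilClass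
  | col => row
  | colSplit => rowSplit
  | colChain => rowChain
  | c => c

theorem numOrbitsG_three [Infinite F] (hF : HasPencilRoots F) :
    numOrbitsG F 3 =
      Nat.card {c : PencilClass // (c.Allowed F ∧ c.rank ≤ 3) ∧ c.foldTranspose = c} := by
  refine numOrbitsG_eq_card_fixed hF le_rfl _ ?_ (by decide) fun c c' hc hc' => ?_
  · intro c hc
    refine ⟨?_, ?_⟩
    · cases c <;> simp_all [PencilClass.Allowed, PencilClass.foldTranspose]
    · cases c <;> decide
  have key : ∀ c c' : PencilClass, (c = c' ∨ c.transpose = c') ↔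
      c.foldTranspose = c'.foldTranspose := by decide
  have hrep : ∀ c, truncRep F (le_refl 3) c = pencilRep F c := fun c => rfl
  have htr : ∀ c, swapLast F _ _ _ (pencilRep F c) = pencilRep F c.transpose := fun c =>
    funext fun i => (pencilRep_transpose c i).symm
  rw [← key, hrep, hrep]
  constructor
  · intro h
    rcases h.hRel_or (by simp) (by simp) (by simp) with h | h
    · exact Or.inl (eq_of_hRel_pencilRep _ _ hc.1 hc'.1 h)
    · rw [htr] at h
      exact Or.inr (eq_of_hRel_pencilRep _ _ hc.1.transpose hc'.1 h)
  · rintro (rfl | rfl)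
    · exact (HRel.refl _).gRel
    · rw [← htr]
      exact gRel_swapLast _

/-- The class of the tensor with the first and the last factor exchanged, for tensors with at most
two slices. -/
def PencilClass.reverse : PencilClass → PencilClass
  | rankTwo => col
  | col => rankTwo
  | c => c

/-- A choice of one class in each pair of classes exchanged by `reverse`. -/
def PencilClass.foldReverse : PencilClass → PencilClass
  | rankTwo => col
  | c => c

/-- Exchange of the first and the last factor. -/
def reverseTens (t : Tens (Fin 2) (Fin 3) (Fin 2) F) : Tens (Fin 2) (Fin 3) (Fin 2) F :=
  swapFirst F _ _ _ (swapLast F _ _ _ (swapFirst F _ _ _ t))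

theorem gRel_reverseTens (t : Tens (Fin 2) (Fin 3) (Fin 2) F) : GRel t (reverseTens t) :=
  (gRel_swapLast (swapFirst F _ _ _ t)).map (e := swapFirst F _ _ _) swapFirst_image

/-- Moving the factor of dimension 3 to the front puts the two equal factors last, where
`GRel.hRel_or` applies. -/
theorem GRel.hRel_or_reverseTens [Infinite F] {s t : Tens (Fin 2) (Fin 3) (Fin 2) F}
    (h : GRel s t) : HRel s t ∨ HRel (reverseTens s) t := by
  rcases (h.map (e := swapFirst F _ _ _) swapFirst_image).hRel_or (by simp) (by simp) (by simp)
    with h | h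
  · exact Or.inl h.swapFirst
  · exact Or.inr h.swapFirst

/-- The reversed representative is again a representative on the nose, except for `colSplit`, where
two basis vectors of the middle factor must be interchanged. -/
theorem hRel_reverseTens_truncRep {c : PencilClass} (hc : c.rank ≤ 2) :
    HRel (reverseTens (truncRep F (show 2 ≤ 3 by decide) c))
      (truncRep F (show 2 ≤ 3 by decide) c.reverse) := by
  by_cases h : c = .colSplit
  · subst h
    refine ⟨1, Matrix.GeneralLinearGroup.mkOfDetNeZero !![1, 0, 0; 0, 0, 1; 0, 1, 0]
      (by simp [Matrix.det_fin_three]), 1, ?_⟩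
    have h1 : reverseTens (truncRep F (show 2 ≤ 3 by decide) .colSplit) =
        ![!![1, 0; 0, 1; 0, 0], !![0, 0; 0, 0; 1, 0]] := by
      funext i j k
      fin_cases i <;> fin_cases j <;> fin_cases k <;> rfl
    have h2 : truncRep F (show 2 ≤ 3 by decide) PencilClass.colSplit.reverse =
        ![!![1, 0; 0, 0; 0, 1], !![0, 0; 1, 0; 0, 0]] := by
      funext i j k
      fin_cases i <;> fin_cases j <;> fin_cases k <;> rfl
    rw [h1, h2]
    funext i
    fin_cases i <;> simp [tensAct_apply, Matrix.GeneralLinearGroup.mkOfDetNeZero]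
  · have : reverseTens (truncRep F (show 2 ≤ 3 by decide) c) =
        truncRep F (show 2 ≤ 3 by decide) c.reverse := by
      cases c <;> first
        | exact absurd hc (by decide)
        | exact absurd rfl h
        | (funext i j k
           fin_cases i <;> fin_cases j <;> fin_cases k <;> rfl)
    rw [this]
    exact HRel.refl _

theorem numOrbitsG_two [Infinite F] (hF : HasPencilRoots F) :
    numOrbitsG F 2 =
      Nat.card {c : PencilClass // (c.Allowed F ∧ c.rank ≤ 2) ∧ c.foldReverse = c} := by
  refine numOrbitsG_eq_card_fixed hF (by decide) _ ?_ (by decide) fun c c' hc hc' => ?_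
  · intro c hc
    refine ⟨?_, ?_⟩
    · cases c <;> simp_all [PencilClass.Allowed, PencilClass.foldReverse]
    · cases c <;> first | exact hc.2 | decide
  have key : ∀ c c' : PencilClass, (c = c' ∨ c.reverse = c') ↔
      c.foldReverse = c'.foldReverse := by decide
  have hrev : c.reverse.Allowed F ∧ c.reverse.rank ≤ 2 := by
    refine ⟨?_, ?_⟩
    · cases c <;> simp_all [PencilClass.Allowed, PencilClass.reverse]
    · cases c <;> first | exact hc.2 | decide
  rw [← key]
  constructor
  · intro h
    rcases h.hRel_or_reverseTens with h | h
    · exact Or.inl ((hRel_truncRep_iff _ hc hc').1 h)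
    · exact Or.inr ((hRel_truncRep_iff _ hrev hc').1
        ((hRel_reverseTens_truncRep hc.2).symm.trans h))
  · rintro (rfl | rfl)
    · exact (HRel.refl _).gRel
    · exact (gSetoid _ _ _ F).trans (gRel_reverseTens _) (hRel_reverseTens_truncRep hc.2).gRel

theorem GRel.eq_zero {I J K : Type*} {s t : Tens I J K F} (h : GRel s t) (hs : s = 0) : t = 0 := by
  obtain ⟨g, -, rfl⟩ := h
  rw [hs, map_zero]

theorem GRel.mem_pureSet {I J K : Type*} {s t : Tens I J K F} (h : GRel s t)
    (hs : s ∈ pureSet I J K F) : t ∈ pureSet I J K F := by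
  obtain ⟨g, hg, rfl⟩ := h
  rw [← hg]
  exact ⟨s, hs, rfl⟩

/-- A factor of dimension 1 is outside the reach of the structure theorem. But only three normal
forms have rank at most 1, and they are zero, pure, and neither; G preserves these properties. -/
theorem numOrbitsG_one (hF : HasPencilRoots F) :
    numOrbitsG F 1 = Nat.card {c : PencilClass // (c.Allowed F ∧ c.rank ≤ 1) ∧ id c = c} := by
  have hr : 1 ≤ 3 := by decide
  refine numOrbitsG_eq_card_fixed hF hr _ (fun c => id) (fun c => rfl) fun c c' hc hc' =>
    ⟨fun h => ?_, fun h => ?_⟩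
  · have hz : truncRep F hr .zero = 0 := by
      funext i j k
      fin_cases i <;> fin_cases j <;> fin_cases k <;> rfl
    have ho : truncRep F hr .rankOne ∈ pureSet (Fin 2) (Fin 3) (Fin 1) F := by
      refine ⟨![1, 0], ![1, 0, 0], ![1], by simp, by simp, by simp, ?_⟩
      funext i j k
      fin_cases i <;> fin_cases j <;> fin_cases k <;>
        simp [truncRep, pencilRep, pureTens]
    have hcol : truncRep F hr .col ∉ pureSet (Fin 2) (Fin 3) (Fin 1) F := by
      rintro ⟨a, b, c, -, -, -, h⟩
      have h1 : (1 : F) = a 0 * b 0 * c 0 := congrFun (congrFun (congrFun h 0) 0) 0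
      have h2 : (1 : F) = a 1 * b 1 * c 0 := congrFun (congrFun (congrFun h 1) 1) 0
      have h3 : (0 : F) = a 0 * b 1 * c 0 := congrFun (congrFun (congrFun h 0) 1) 0
      refine one_ne_zero (α := F) ?_
      -- A pure tensor would have vanishing 2 × 2 minors, but this array contains an identity block.
      linear_combination h1 + a 0 * b 0 * c 0 * h2 - a 1 * b 0 * c 0 * h3
    have ho' : truncRep F hr .rankOne ≠ 0 := by
      obtain ⟨a, b, c, ha, hb, hc, h⟩ := ho
      rw [h]
      exact pureTens_ne_zero ha hb hc
    have hcol' : truncRep F hr .col ≠ 0 := fun h => by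
      have h1 : (1 : F) = 0 := congrFun (congrFun (congrFun h 0) 0) 0
      exact one_ne_zero h1
    have h' := (gSetoid _ _ _ F).symm h
    have cases_of_rank : ∀ c : PencilClass, c.rank ≤ 1 → c = .zero ∨ c = .rankOne ∨ c = .col := by
      decide
    rcases cases_of_rank c hc.2 with rfl | rfl | rfl <;>
      rcases cases_of_rank c' hc'.2 with rfl | rfl | rfl
    exacts [rfl, absurd (h.eq_zero hz) ho', absurd (h.eq_zero hz) hcol',
      absurd (GRel.eq_zero h' hz) ho', rfl, absurd (h.mem_pureSet ho) hcol,
      absurd (GRel.eq_zero h' hz) hcol', absurd (GRel.mem_pureSet h' ho) hcol, rfl]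
  · rw [show c = c' from h]
    exact (HRel.refl _).gRel

theorem numOrbitsG_of_sqrt [Infinite F] (hF : HasPencilRoots F) (h : ∃ x : F, x ^ 2 + 1 = 0) :
    numOrbitsG F 1 = 3 ∧ numOrbitsG F 2 = 8 ∧ numOrbitsG F 3 = 15 := by
  simp only [numOrbitsG_one hF, numOrbitsG_two hF, numOrbitsG_three hF, pencilClass_allowed_iff h,
    Nat.card_eq_fintype_card]
  decide

theorem numOrbitsG_of_no_sqrt [Infinite F] (hF : HasPencilRoots F) (h : ∀ x : F, x ^ 2 + 1 ≠ 0) :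
    numOrbitsG F 1 = 3 ∧ numOrbitsG F 2 = 9 ∧ numOrbitsG F 3 = 17 := by
  have : ∀ c : PencilClass, c.Allowed F ↔ True := fun c => iff_true_intro fun _ => h
  simp only [numOrbitsG_one hF, numOrbitsG_two hF, numOrbitsG_three hF, this,
    Nat.card_eq_fintype_card, true_and]
  decide

end GCounting

/-! ### Algebraically closed fields and the real numbers -/

section Fields

theorem hasPencilRoots_of_isAlgClosed (F : Type*) [Field F] [IsAlgClosed F] : HasPencilRoots F where
  quad b c := by
    obtain ⟨x, hx⟩ := IsAlgClosed.exists_root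
      (Polynomial.X ^ 2 + Polynomial.C b * Polynomial.X + Polynomial.C c : Polynomial F) (by
        have : (Polynomial.X ^ 2 + Polynomial.C b * Polynomial.X + Polynomial.C c :
          Polynomial F).degree = 2 := by compute_degree!
        rw [this]
        decide)
    exact Or.inl ⟨x, by simpa using hx⟩
  cubic b c d := by
    obtain ⟨x, hx⟩ := IsAlgClosed.exists_root
      (Polynomial.X ^ 3 + Polynomial.C b * Polynomial.X ^ 2 + Polynomial.C c * Polynomial.X +
        Polynomial.C d : Polynomial F) (by
        have : (Polynomial.X ^ 3 + Polynomial.C b * Polynomial.X ^ 2 + Polynomial.C c *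
          Polynomial.X + Polynomial.C d : Polynomial F).degree = 3 := by compute_degree!
        rw [this]
        decide)
    exact ⟨x, by simpa using hx⟩

theorem exists_sq_add_one_eq_zero (F : Type*) [Field F] [IsAlgClosed F] :
    ∃ x : F, x ^ 2 + 1 = 0 := by
  obtain ⟨x, hx⟩ := IsAlgClosed.exists_pow_nat_eq (-1 : F) two_pos
  exact ⟨x, by rw [hx, neg_add_cancel]⟩

theorem hasPencilRoots_real : HasPencilRoots ℝ where
  quad b c := by
    rcases le_or_gt c (b ^ 2 / 4) with h | h
    · refine Or.inl ⟨-b / 2 + √(b ^ 2 / 4 - c), ?_⟩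
      have := Real.sq_sqrt (sub_nonneg.2 h)
      linear_combination this
    · refine Or.inr ⟨fun x => by positivity, b / 2, √(c - b ^ 2 / 4),
        (Real.sqrt_pos.2 (sub_pos.2 h)).ne', by ring, ?_⟩
      rw [Real.sq_sqrt (sub_pos.2 h).le]
      ring
  cubic b c d := by
    -- Since R ≥ 1, the lower terms at ±R are bounded by (|b| + |c| + |d|) R² = R³ - R², so the
    -- cubic changes sign on [-R, R].
    obtain ⟨R, hR⟩ : ∃ R, R = 1 + |b| + |c| + |d| := ⟨_, rfl⟩
    have hb := abs_le.1 (le_refl |b|)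
    have hc := abs_le.1 (le_refl |c|)
    have hd := abs_le.1 (le_refl |d|)
    have h1 : 1 ≤ R := by
      have := abs_nonneg b
      have := abs_nonneg c
      have := abs_nonneg d
      linarith
    have hRR : R ≤ R ^ 2 := by nlinarith
    have e1 : R ^ 3 = R ^ 2 + |b| * R ^ 2 + |c| * R ^ 2 + |d| * R ^ 2 := by
      rw [pow_succ, hR]
      ring
    have e2 : |c| * R ≤ |c| * R ^ 2 := mul_le_mul_of_nonneg_left hRR (abs_nonneg c)
    have e3 : |d| ≤ |d| * R ^ 2 := le_mul_of_one_le_right (abs_nonneg d) (by linarith)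
    have b1 := mul_le_mul_of_nonneg_right hb.1 (sq_nonneg R)
    have b2 := mul_le_mul_of_nonneg_right hb.2 (sq_nonneg R)
    have c1 := mul_le_mul_of_nonneg_right hc.1 (zero_le_one.trans h1)
    have c2 := mul_le_mul_of_nonneg_right hc.2 (zero_le_one.trans h1)
    have hcont : Continuous fun x : ℝ => x ^ 3 + b * x ^ 2 + c * x + d := by fun_prop
    obtain ⟨x, -, hx⟩ := intermediate_value_Icc (show -R ≤ R by linarith)
      hcont.continuousOn (show (0 : ℝ) ∈ _ from ⟨by nlinarith, by nlinarith⟩)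
    exact ⟨x, hx⟩

end Fields

end TensorOrbits

open TensorOrbits in
theorem mainTheorem8 :
    (∀ (F : Type*) [Field F] [IsAlgClosed F],
      (numOrbitsH F 1 = 3 ∧ numOrbitsH F 2 = 9 ∧ numOrbitsH F 3 = 18 ∧
        numOrbitsH F 4 = 24 ∧ numOrbitsH F 5 = 26 ∧ ∀ r : ℕ, 6 ≤ r → numOrbitsH F r = 27) ∧
      (numOrbitsG F 1 = 3 ∧ numOrbitsG F 2 = 8 ∧ numOrbitsG F 3 = 15 ∧
        ∀ r : ℕ, 4 ≤ r → numOrbitsG F r = numOrbitsH F r)) ∧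
    ((numOrbitsH ℝ 1 = 3 ∧ numOrbitsH ℝ 2 = 10 ∧ numOrbitsH ℝ 3 = 20 ∧
        numOrbitsH ℝ 4 = 27 ∧ numOrbitsH ℝ 5 = 29 ∧ ∀ r : ℕ, 6 ≤ r → numOrbitsH ℝ r = 30) ∧
      (numOrbitsG ℝ 1 = 3 ∧ numOrbitsG ℝ 2 = 9 ∧ numOrbitsG ℝ 3 = 17 ∧
        ∀ r : ℕ, 4 ≤ r → numOrbitsG ℝ r = numOrbitsH ℝ r)) := by
  refine ⟨fun F _ _ => ⟨?_, ?_⟩, ?_, ?_⟩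
  · obtain ⟨h₀, h₁, h₂, h₃⟩ := pencilCount_of_sqrt (exists_sq_add_one_eq_zero F)
    exact numOrbitsH_values (hasPencilRoots_of_isAlgClosed F) h₀ h₁ h₂ h₃
  · obtain ⟨h₁, h₂, h₃⟩ := numOrbitsG_of_sqrt (hasPencilRoots_of_isAlgClosed F)
      (exists_sq_add_one_eq_zero F)
    exact ⟨h₁, h₂, h₃, fun r => numOrbitsG_eq_numOrbitsH⟩
  · obtain ⟨h₀, h₁, h₂, h₃⟩ := pencilCount_of_no_sqrt (F := ℝ) fun x => by positivity
    exact numOrbitsH_values hasPencilRoots_real h₀ h₁ h₂ h₃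
  · obtain ⟨h₁, h₂, h₃⟩ := numOrbitsG_of_no_sqrt hasPencilRoots_real fun x => by positivity
    exact ⟨h₁, h₂, h₃, fun r => numOrbitsG_eq_numOrbitsH⟩
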